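/- Let $T>0$, $d\in\mathbb N$ and $\Omega=D([0,T],\mathbb R^d)$ (right-continuous paths with left limits) with the supremum norm; equip $[0,T]\times\Omega$ with the pseudo-metric $\mathbf d_\infty((t,x),(s,y))=|t-s|+\sup_{0\le r\le T}|x(r\wedge t)-y(r\wedge s)|$, and $[0,T]\times\Omega\times\Omega$ with the analogous one (two path terms). Semicontinuity and continuity of functions of $(t,x)$ or $(t,x,\tilde x)$ refer to these. **Control problem.** Let $A\neq\emptyset$ be a topological space that is a countable union of compact metrizable subsets, and $\mathcal A$ the set of Borel functions $[0,T]\to A$. Let $f,\lambda,\ell$ be functions on $[0,T]\times\Omega\times A$ with values in $\mathbb R^d$, $[0,\infty)$, $\mathbb R$, and let $h:\Omega\to\mathbb R$ be continuous, such that: for a.e. $t$ the map $(x,a)\mapsto(f,\lambda,\ell)(t,x,a)$ is continuous; for all $(x,a)$ the map $t\mapsto(f,\lambda,\ell)(t,x,a)$ is Borel; and there are constants $C_f,C_\lambda,L_f\ge0$ such that for a.e. $t$ and all $x,\tilde x\in\Omega$, $a\in A$, $$|f(t,x,a)|+|\ell(t,x,a)|\le C_f\Bigl(1+\sup_{s\le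 t}|x(s)|\Bigr),\qquad |\lambda(t,x,a)|\le C_\lambda,$$ $$|f(t,x,a)-f(t,\tilde x,a)|+|\ell(t,x,a)-\ell(t,\tilde x,a)|+|\lambda(t,x,a)-\lambda(t,\tilde x,a)|\le L_f\sup_{s\le t}|x(s)-\tilde x(s)|.$$ For $\alpha\in\mathcal A$ let $\phi=\phi^{s,x,\alpha}$ be the solution of $\phi'(t)=f(t,\phi,\alpha(t))$ a.e. on $(s,T)$, $\phi=x$ on $[0,s]$, and put $\chi(t)=\exp(-\int_s^t\lambda(r,\phi,\alpha(r))\,dr)$. The value function is $$v(s,x)=\inf_{\alpha\in\mathcal A}\Bigl[\int_s^T\chi(t)\,\ell(t,\phi,\alpha(t))\,dt+\chi(T)\,h(\phi)\Bigr],$$ and $H(t,x,y,z)=\inf_{a\in A}[\ell(t,x,a)+(f(t,x,a),z)-\lambda(t,x,a)\,y]$, which is finite for a.e. $t$ (its values at other $t$ are irrelevant). **Minimax semisolutions.** For $L\ge 0$ let $\mathcal X^L(s_0,x_0)$ be the set of $x\in\Omega$ with $x=x_0$ on $[0,s_0]$ that are absolutely continuous on $[s_0,T]$ with $|x'(t)|\le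 L(1+\sup_{s\le t}|x(s)|)$ a.e. on $(s_0,T)$. Let $\mathcal Y^L(s_0,x_0,y_0,z)$ be the set of pairs $(x,y)\in\mathcal X^L(s_0,x_0)\times C([s_0,T])$ with $y(t)=y_0+\int_{s_0}^t[(x'(s),z)-H(s,x,y(s),z)]\,ds$ on $[s_0,T]$. A function $u:[0,T]\times\Omega\to\mathbb R$ is a *minimax $L$-subsolution* of $-\partial_tu-H(t,x,u,\partial_xu)=0$, $u(T,\cdot)=h$, if it is u.s.c., $u(T,\cdot)\le h$, and for all $(s_0,x_0,z)\in[0,T)\times\Omega\times\mathbb R^d$ and $y_0\le u(s_0,x_0)$ there is $(x,y)\in\mathcal Y^L(s_0,x_0,y_0,z)$ with $y(t)\le u(t,x)$ for all $t\in[s_0,T]$. It is a *minimax $L$-supersolution* if it is l.s.c. and the same holds with both inequalities for $u(T,\cdot)$ and $y$ and the one for $y_0$ reversed. **Doubled equation.** $\varphi\in C^{1,1,1}([s_0,T]\times\Omega\times\Omega)$ means that $\varphi$ is continuous and there are continuous $\partial_t\varphi$, $\partial_x\varphi$, $\partial_{\tilde x}\varphi$ such that for all $t_0\in[s_0,T)$,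 all $x_0,\tilde x_0\in\Omega$, all $x,\tilde x\in\Omega$ that agree with $x_0,\tilde x_0$ on $[0,t_0]$ and are Lipschitz on $[t_0,T]$, and all $t\in(t_0,T]$, $$\varphi(t,x,\tilde x)-\varphi(t_0,x_0,\tilde x_0)=\int_{t_0}^t[\partial_t\varphi+x'(s)\cdot\partial_x\varphi+\tilde x'(s)\cdot\partial_{\tilde x}\varphi](s,x,\tilde x)\,ds.$$ Given constants $M,K$, $L\ge0$ and $\Upsilon:[0,T]\times\Omega\to\mathbb R$, a u.s.c. function $w:[0,T]\times\Omega\times\Omega\to\mathbb R$ is a *viscosity $L$-subsolution with parameter $\Upsilon$* of the doubled equation $$\max\{w,0\}\Bigl[\partial_tw+M(1+|\Upsilon|+|\partial_xw|)\sup_{t\le s}|x(t)-\tilde x(t)|+K\Bigl(1+\sup_{t\le s}|\tilde x(t)|\Bigr)|\partial_xw+\partial_{\tilde x}w|\Bigr]=0$$ if, for every $(s_0,x_0,\tilde x_0)\in[0,T)\times\Omega\times\Omega$ with $w(s_0,x_0,\tilde x_0)>0$ and every $\varphi\in C^{1,1,1}([s_0,T]\times\Omega\times\Omega)$ such that for some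 $T_0\in(s_0,T]$ $$0=(\varphi-w)(s_0,x_0,\tilde x_0)=\inf_{[s_0,T_0]\times\mathcal X^L(s_0,x_0)\times\mathcal X^L(s_0,\tilde x_0)}(\varphi-w),$$ the bracket, with $\partial_tw,\partial_xw,\partial_{\tilde x}w$ replaced by the path derivatives of $\varphi$ and everything evaluated at $(s_0,x_0,\tilde x_0)$ (with $\Upsilon$ at $(s_0,x_0)$), is $\ge0$. **Lemma.** The constants $M=L_f$ and $K=C_f$ satisfy, for a.e. $t\in(0,T)$ and all $x,\tilde x\in\Omega$, $y\in\mathbb R$, $z,\tilde z\in\mathbb R^d$, $$|H(t,x,y,z)-H(t,\tilde x,y,z)|\le M(1+|y|+|z|)\sup_{s\le t}|x(s)-\tilde x(s)|,\qquad |H(t,x,y,z)-H(t,x,y,\tilde z)|\le K\Bigl(1+\sup_{s\le t}|x(s)|\Bigr)|z-\tilde z|,$$ and for all constants $M,K$ with these two properties: 1. if $u$ is a minimax $C_f$-subsolution, then $(t,x,\tilde x)\mapsto u(t,x)-v(t,\tilde x)$ is a viscosity $C_f$-subsolution of the doubled equation with parameter $\Upsilon=u$; 2. if $u$ is a minimax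 $C_f$-supersolution, then $(t,x,\tilde x)\mapsto v(t,x)-u(t,\tilde x)$ is a viscosity $C_f$-subsolution of the doubled equation with parameter $\Upsilon=v$. -/

import Mathlib

open Set Filter Topology MeasureTheory

noncomputable section

/-- The state space `ℝᵈ` with its Euclidean norm and inner product. -/
abbrev State (d : ℕ) : Type := EuclideanSpace ℝ (Fin d)

/-- The path space `Ω = D([0,T], ℝᵈ)`: right-continuous functions on `[0,T]` with left limits.
A path is represented by its unique extension to `ℝ` that is constant on `(-∞,0]` and on
`[T,∞)`; this extension is right-continuous with left limits exactly when the path is. -/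
@[ext]
structure CadlagPath (T : ℝ) (d : ℕ) where
  toFun : ℝ → State d
  const_left : ∀ t ≤ 0, toFun t = toFun 0
  const_right : ∀ t, T ≤ t → toFun t = toFun T
  right_cont : ∀ t, ContinuousWithinAt toFun (Ici t) t
  left_lim : ∀ t, ∃ l, Tendsto toFun (𝓝[<] t) (𝓝 l)

namespace CadlagPath

variable {T : ℝ} {d : ℕ}

instance : CoeFun (CadlagPath T d) (fun _ => ℝ → State d) := ⟨CadlagPath.toFun⟩

theorem bounded_on_Icc (x : CadlagPath T d) (a b : ℝ) : ∃ C, ∀ t ∈ Icc a b, ‖x t‖ ≤ C := by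
  refine isCompact_Icc.induction_on (p := fun s => ∃ C, ∀ t ∈ s, ‖x t‖ ≤ C)
    ⟨0, by simp⟩ ?_ ?_ ?_
  · rintro s t hst ⟨C, hC⟩
    exact ⟨C, fun r hr => hC r (hst hr)⟩
  · rintro s t ⟨C, hC⟩ ⟨D, hD⟩
    refine ⟨max C D, ?_⟩
    rintro r (hr | hr)
    · exact (hC r hr).trans (le_max_left _ _)
    · exact (hD r hr).trans (le_max_right _ _)
  · intro t _
    obtain ⟨l, hl⟩ := x.left_lim t
    have h1 : ∀ᶠ r in 𝓝[<] t, ‖x r‖ ≤ ‖l‖ + 1 :=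
      (hl.norm.eventually (gt_mem_nhds (lt_add_one _))).mono fun _ h => h.le
    have h2 : ∀ᶠ r in 𝓝[≥] t, ‖x r‖ ≤ ‖x t‖ + 1 :=
      ((x.right_cont t).norm.eventually (gt_mem_nhds (lt_add_one _))).mono fun _ h => h.le
    have h3 : ∀ᶠ r in 𝓝 t, ‖x r‖ ≤ max (‖l‖ + 1) (‖x t‖ + 1) := by
      rw [← nhdsLT_sup_nhdsGE, eventually_sup]
      exact ⟨h1.mono fun _ h => h.trans (le_max_left _ _),
        h2.mono fun _ h => h.trans (le_max_right _ _)⟩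
    exact ⟨_, mem_nhdsWithin_of_mem_nhds h3, _, fun r hr => hr⟩

theorem bounded (x : CadlagPath T d) : ∃ C, ∀ t, ‖x t‖ ≤ C := by
  obtain ⟨C, hC⟩ := x.bounded_on_Icc (min 0 T) (max 0 T)
  refine ⟨C, fun t => ?_⟩
  rcases le_total t 0 with h | h
  · rw [x.const_left t h]
    exact hC 0 ⟨min_le_left _ _, le_max_left _ _⟩
  · rcases le_total T t with h' | h'
    · rw [x.const_right t h']
      exact hC T ⟨min_le_right _ _, le_max_right _ _⟩
    · exact hC t ⟨(min_le_left _ _).trans h, h'.trans (le_max_right _ _)⟩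

/-- The uniform distance `sup_{0 ≤ r ≤ T} |x (r ∧ t) - y (r ∧ s)|` of the path `x` stopped at `t`
and the path `y` stopped at `s`. -/
def stopDist (t : ℝ) (x : CadlagPath T d) (s : ℝ) (y : CadlagPath T d) : ℝ :=
  ⨆ r : Icc (0 : ℝ) T, ‖x (min (r : ℝ) t) - y (min (r : ℝ) s)‖

theorem bddAbove_diff (x y : CadlagPath T d) {ι : Type*} (a b : ι → ℝ) :
    BddAbove (range fun i => ‖x (a i) - y (b i)‖) := by
  obtain ⟨C, hC⟩ := x.bounded
  obtain ⟨D, hD⟩ := y.bounded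
  refine ⟨C + D, ?_⟩
  rintro _ ⟨i, rfl⟩
  exact (norm_sub_le _ _).trans (add_le_add (hC _) (hD _))

theorem stopDist_self (t : ℝ) (x : CadlagPath T d) : stopDist t x t x = 0 := by
  simp [stopDist]

theorem stopDist_comm (t : ℝ) (x : CadlagPath T d) (s : ℝ) (y : CadlagPath T d) :
    stopDist t x s y = stopDist s y t x := by
  simp only [stopDist, norm_sub_rev]

theorem stopDist_triangle (t : ℝ) (x : CadlagPath T d) (s : ℝ) (y : CadlagPath T d) (r : ℝ)
    (z : CadlagPath T d) : stopDist t x r z ≤ stopDist t x s y + stopDist s y r z := by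
  rcases isEmpty_or_nonempty (Icc (0 : ℝ) T) with h | h
  · simp [stopDist]
  · refine ciSup_le fun q => ?_
    have h1 : ‖x (min (q : ℝ) t) - y (min (q : ℝ) s)‖ ≤ stopDist t x s y :=
      le_ciSup (bddAbove_diff x y (fun q : Icc (0 : ℝ) T => min (q : ℝ) t)
        (fun q => min (q : ℝ) s)) q
    have h2 : ‖y (min (q : ℝ) s) - z (min (q : ℝ) r)‖ ≤ stopDist s y r z :=
      le_ciSup (bddAbove_diff y z (fun q : Icc (0 : ℝ) T => min (q : ℝ) s)
        (fun q => min (q : ℝ) r)) q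
    exact (norm_sub_le_norm_sub_add_norm_sub _ _ _).trans (add_le_add h1 h2)

/-- `Ω` carries the metric `‖x - y‖_∞` of the supremum norm over `[0,T]`. -/
instance : PseudoMetricSpace (CadlagPath T d) where
  dist x y := ⨆ r : Icc (0 : ℝ) T, ‖x r - y r‖
  dist_self x := by simp
  dist_comm x y := by simp only [norm_sub_rev]
  dist_triangle x y z := by
    rcases isEmpty_or_nonempty (Icc (0 : ℝ) T) with h | h
    · simp
    · refine ciSup_le fun q => ?_
      refine (norm_sub_le_norm_sub_add_norm_sub _ (y q) _).trans (add_le_add ?_ ?_)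
      · exact le_ciSup (bddAbove_diff x y (fun q : Icc (0 : ℝ) T => (q : ℝ)) (fun q => q)) q
      · exact le_ciSup (bddAbove_diff y z (fun q : Icc (0 : ℝ) T => (q : ℝ)) (fun q => q)) q

/-- `sup_{s ≤ t} |x s|`. -/
def supNorm (x : CadlagPath T d) (t : ℝ) : ℝ := ⨆ s : Icc (0 : ℝ) t, ‖x s‖

/-- `sup_{s ≤ t} |x s - y s|`. -/
def supDiff (x y : CadlagPath T d) (t : ℝ) : ℝ := ⨆ s : Icc (0 : ℝ) t, ‖x s - y s‖

end CadlagPath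

/-- Points `(t, x)` of time and path. Functions on `[0,T] × Ω` are represented by functions on
this type of which only the values at `t ∈ [0,T]` are used. -/
structure TimePath (T : ℝ) (d : ℕ) where
  time : ℝ
  path : CadlagPath T d

/-- Points `(t, x, x')` of time and two paths. -/
structure TimePath₂ (T : ℝ) (d : ℕ) where
  time : ℝ
  left : CadlagPath T d
  right : CadlagPath T d

/-- The pseudo-metric
`𝐝_∞((t,x),(s,y)) = |t - s| + sup_{0 ≤ r ≤ T} |x (r ∧ t) - y (r ∧ s)|`. -/
instance {T : ℝ} {d : ℕ} : PseudoMetricSpace (TimePath T d) where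
  dist p q := |p.time - q.time| + CadlagPath.stopDist p.time p.path q.time q.path
  dist_self p := by simp [CadlagPath.stopDist_self]
  dist_comm p q := by rw [abs_sub_comm, CadlagPath.stopDist_comm]
  dist_triangle p q r := by
    have h1 := abs_sub_le p.time q.time r.time
    have h2 := CadlagPath.stopDist_triangle p.time p.path q.time q.path r.time r.path
    linarith

/-- The analogous pseudo-metric for two paths. -/
instance {T : ℝ} {d : ℕ} : PseudoMetricSpace (TimePath₂ T d) where
  dist p q := |p.time - q.time| + CadlagPath.stopDist p.time p.left q.time q.left
    + CadlagPath.stopDist p.time p.right q.time q.right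
  dist_self p := by simp [CadlagPath.stopDist_self]
  dist_comm p q := by
    rw [abs_sub_comm, CadlagPath.stopDist_comm p.time p.left, CadlagPath.stopDist_comm p.time p.right]
  dist_triangle p q r := by
    have h1 := abs_sub_le p.time q.time r.time
    have h2 := CadlagPath.stopDist_triangle p.time p.left q.time q.left r.time r.left
    have h3 := CadlagPath.stopDist_triangle p.time p.right q.time q.right r.time r.right
    linarith

/-- The set `𝒳^L(s₀,x₀)` of Lipschitz-like continuations of `x₀` after time `s₀`. -/
def pathsX {T : ℝ} {d : ℕ} (L s₀ : ℝ) (x₀ : CadlagPath T d) : Set (CadlagPath T d) :=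
  {x | EqOn x x₀ (Icc 0 s₀) ∧ AbsolutelyContinuousOnInterval x s₀ T ∧
    ∀ᵐ t : ℝ, t ∈ Ioo s₀ T → ‖deriv x t‖ ≤ L * (1 + x.supNorm t)}

/-- The set `𝒴^L(s₀,x₀,y₀,z)` of pairs `(x,y)` with `x ∈ 𝒳^L(s₀,x₀)`, `y` continuous on `[s₀,T]`
and `y(t) = y₀ + ∫_{s₀}^t [(x'(s),z) - H(s,x,y(s),z)] ds` on `[s₀,T]`. -/
def pathsY {T : ℝ} {d : ℕ} (H : ℝ → CadlagPath T d → ℝ → State d → ℝ)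
    (L s₀ : ℝ) (x₀ : CadlagPath T d) (y₀ : ℝ) (z : State d) : Set (CadlagPath T d × (ℝ → ℝ)) :=
  {p | p.1 ∈ pathsX L s₀ x₀ ∧ ContinuousOn p.2 (Icc s₀ T) ∧
    IntervalIntegrable (fun s => inner ℝ (deriv p.1 s) z - H s p.1 (p.2 s) z) volume s₀ T ∧
    ∀ t ∈ Icc s₀ T,
      p.2 t = y₀ + ∫ s in s₀..t, (inner ℝ (deriv p.1 s) z - H s p.1 (p.2 s) z)}

/-- `u` is a minimax `L`-supersolution of `-∂ₜu - H(t,x,u,∂ₓu) = 0`, `u(T,·) = h`. -/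
def IsMinimaxSuper {T : ℝ} {d : ℕ} (H : ℝ → CadlagPath T d → ℝ → State d → ℝ) (h : CadlagPath T d → ℝ)
    (L : ℝ) (u : TimePath T d → ℝ) : Prop :=
  LowerSemicontinuousOn u {p | p.time ∈ Icc 0 T} ∧
  (∀ x, h x ≤ u ⟨T, x⟩) ∧
  ∀ s₀ ∈ Ico 0 T, ∀ (x₀ : CadlagPath T d) (z : State d) (y₀ : ℝ), u ⟨s₀, x₀⟩ ≤ y₀ →
    ∃ p ∈ pathsY H L s₀ x₀ y₀ z, ∀ t ∈ Icc s₀ T, u ⟨t, p.1⟩ ≤ p.2 t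

/-- `u` is a minimax `L`-subsolution of `-∂ₜu - H(t,x,u,∂ₓu) = 0`, `u(T,·) = h`. -/
def IsMinimaxSub {T : ℝ} {d : ℕ} (H : ℝ → CadlagPath T d → ℝ → State d → ℝ) (h : CadlagPath T d → ℝ)
    (L : ℝ) (u : TimePath T d → ℝ) : Prop :=
  UpperSemicontinuousOn u {p | p.time ∈ Icc 0 T} ∧
  (∀ x, u ⟨T, x⟩ ≤ h x) ∧
  ∀ s₀ ∈ Ico 0 T, ∀ (x₀ : CadlagPath T d) (z : State d) (y₀ : ℝ), y₀ ≤ u ⟨s₀, x₀⟩ →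
    ∃ p ∈ pathsY H L s₀ x₀ y₀ z, ∀ t ∈ Icc s₀ T, p.2 t ≤ u ⟨t, p.1⟩

/-- `φ ∈ C^{1,1,1}([s₀,T] × Ω × Ω)` with path derivatives `∂ₜφ = φt`, `∂ₓφ = φx`, `∂_{x'}φ = φy`. -/
structure HasPathDerivs {T : ℝ} {d : ℕ} (s₀ : ℝ) (φ φt : TimePath₂ T d → ℝ)
    (φx φy : TimePath₂ T d → State d) : Prop where
  cont : ContinuousOn φ {p | p.time ∈ Icc s₀ T}
  cont_t : ContinuousOn φt {p | p.time ∈ Icc s₀ T}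
  cont_x : ContinuousOn φx {p | p.time ∈ Icc s₀ T}
  cont_y : ContinuousOn φy {p | p.time ∈ Icc s₀ T}
  chain : ∀ t₀ ∈ Ico s₀ T, ∀ x₀ y₀ x y : CadlagPath T d,
    EqOn x x₀ (Icc 0 t₀) → EqOn y y₀ (Icc 0 t₀) →
    (∃ K, LipschitzOnWith K x (Icc t₀ T)) → (∃ K, LipschitzOnWith K y (Icc t₀ T)) →
    ∀ t ∈ Ioc t₀ T, φ ⟨t, x, y⟩ - φ ⟨t₀, x₀, y₀⟩ =
      ∫ s in t₀..t, (φt ⟨s, x, y⟩ + inner ℝ (deriv x s) (φx ⟨s, x, y⟩)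
        + inner ℝ (deriv y s) (φy ⟨s, x, y⟩))

/-- The condition by which a function `φ` of class `C^{1,1,1}([s₀,T] × Ω × Ω)` is a test function
for `w` at `(s₀,x₀,y₀)`: for some `T₀ ∈ (s₀,T]`, `φ - w` vanishes at the point and `0` is its
infimum over `[s₀,T₀] × 𝒳^L(s₀,x₀) × 𝒳^L(s₀,y₀)`. -/
def TouchesFromAbove {T : ℝ} {d : ℕ} (L : ℝ) (w : TimePath₂ T d → ℝ) (s₀ : ℝ) (x₀ y₀ : CadlagPath T d)
    (φ : TimePath₂ T d → ℝ) : Prop :=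
  ∃ T₀ ∈ Ioc s₀ T, φ ⟨s₀, x₀, y₀⟩ - w ⟨s₀, x₀, y₀⟩ = 0 ∧
    IsGLB {c | ∃ t ∈ Icc s₀ T₀, ∃ x ∈ pathsX L s₀ x₀, ∃ y ∈ pathsX L s₀ y₀,
      c = φ ⟨t, x, y⟩ - w ⟨t, x, y⟩} 0

/-- `w` is a viscosity `L`-subsolution, with parameter `Υ`, of the doubled equation
`max{w,0} · [∂ₜw + M (1 + |Υ| + |∂ₓw|) sup_{t ≤ s} |x(t) - x'(t)|
  + K (1 + sup_{t ≤ s} |x'(t)|) |∂ₓw + ∂_{x'}w|] = 0` on `[0,T) × Ω × Ω`. -/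
def IsViscositySubDoubled {T : ℝ} {d : ℕ} (M K L : ℝ) (Υ : TimePath T d → ℝ)
    (w : TimePath₂ T d → ℝ) : Prop :=
  UpperSemicontinuousOn w {p | p.time ∈ Icc 0 T} ∧
  ∀ s ∈ Ico 0 T, ∀ (x y : CadlagPath T d) (φ φt : TimePath₂ T d → ℝ) (φx φy : TimePath₂ T d → State d),
    HasPathDerivs s φ φt φx φy → TouchesFromAbove L w s x y φ → 0 < w ⟨s, x, y⟩ →
    0 ≤ φt ⟨s, x, y⟩ + M * (1 + |Υ ⟨s, x⟩| + ‖φx ⟨s, x, y⟩‖) * x.supDiff y s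
      + K * (1 + y.supNorm s) * ‖φx ⟨s, x, y⟩ + φy ⟨s, x, y⟩‖

/-- `M` is a constant of Lipschitz continuity of `H` in the path variable: for a.e. `t`,
`|H(t,x,y,z) - H(t,x',y,z)| ≤ M (1 + |y| + |z|) sup_{s ≤ t} |x(s) - x'(s)|`. -/
def IsPathLipConst {T : ℝ} {d : ℕ} (H : ℝ → CadlagPath T d → ℝ → State d → ℝ) (M : ℝ) : Prop :=
  ∀ᵐ t : ℝ, t ∈ Ioo 0 T → ∀ (x x' : CadlagPath T d) (y : ℝ) (z : State d),
    |H t x y z - H t x' y z| ≤ M * (1 + |y| + ‖z‖) * x.supDiff x' t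

/-- `K` is a constant of Lipschitz continuity of `H` in the gradient variable: for a.e. `t`,
`|H(t,x,y,z) - H(t,x,y,z')| ≤ K (1 + sup_{s ≤ t} |x(s)|) |z - z'|`. -/
def IsGradLipConst {T : ℝ} {d : ℕ} (H : ℝ → CadlagPath T d → ℝ → State d → ℝ) (K : ℝ) : Prop :=
  ∀ᵐ t : ℝ, t ∈ Ioo 0 T → ∀ (x : CadlagPath T d) (y : ℝ) (z z' : State d),
    |H t x y z - H t x y z'| ≤ K * (1 + x.supNorm t) * ‖z - z'‖

/-- Data `f`, `λ ≥ 0`, `ℓ` (on `[0,T] × Ω × A`) and `h` (on `Ω`) of the control problem. -/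
structure ControlData (T : ℝ) (d : ℕ) (A : Type*) where
  f : ℝ → CadlagPath T d → A → State d
  lam : ℝ → CadlagPath T d → A → ℝ
  ell : ℝ → CadlagPath T d → A → ℝ
  h : CadlagPath T d → ℝ

namespace ControlData

variable {T : ℝ} {d : ℕ} {A : Type*}

/-- The standing assumptions on the data, with constants `C_f`, `C_λ`, `L_f`. -/
structure Admissible [TopologicalSpace A] (D : ControlData T d A) (Cf Clam Lf : ℝ) : Prop where
  lam_nonneg : ∀ t ∈ Icc 0 T, ∀ x a, 0 ≤ D.lam t x a
  cont : ∀ᵐ t : ℝ, t ∈ Icc 0 T →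
    Continuous fun p : CadlagPath T d × A => (D.f t p.1 p.2, D.lam t p.1 p.2, D.ell t p.1 p.2)
  cont_h : Continuous D.h
  meas : ∀ x a,
    Measurable fun t : Icc (0 : ℝ) T => (D.f t x a, D.lam t x a, D.ell t x a)
  Cf_nonneg : 0 ≤ Cf
  Clam_nonneg : 0 ≤ Clam
  growth : ∀ᵐ t : ℝ, t ∈ Ioo 0 T → ∀ x a,
    ‖D.f t x a‖ + |D.ell t x a| ≤ Cf * (1 + x.supNorm t) ∧ |D.lam t x a| ≤ Clam
  Lf_nonneg : 0 ≤ Lf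
  lip : ∀ᵐ t : ℝ, t ∈ Ioo 0 T → ∀ x x' a,
    ‖D.f t x a - D.f t x' a‖ + |D.ell t x a - D.ell t x' a| + |D.lam t x a - D.lam t x' a|
      ≤ Lf * x.supDiff x' t

/-- `φ` is the solution `φ^{s,x,α}` of `φ'(t) = f(t,φ,α(t))` a.e. on `(s,T)`, `φ = x` on `[0,s]`
(absolutely continuous on `[s,T]`). -/
def IsTrajectory (D : ControlData T d A) (s : ℝ) (x : CadlagPath T d) (α : ℝ → A) (φ : CadlagPath T d) :
    Prop :=
  EqOn φ x (Icc 0 s) ∧ AbsolutelyContinuousOnInterval φ s T ∧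
    ∀ᵐ t : ℝ, t ∈ Ioo s T → HasDerivAt φ (D.f t φ (α t)) t

/-- The discount factor `χ(t) = exp(-∫_s^t λ(r,φ,α(r)) dr)`. -/
def discount (D : ControlData T d A) (s : ℝ) (α : ℝ → A) (φ : CadlagPath T d) (t : ℝ) : ℝ :=
  Real.exp (-∫ r in s..t, D.lam r φ (α r))

/-- The cost `∫_s^T χ(t) ℓ(t,φ,α(t)) dt + χ(T) h(φ)`. -/
def cost (D : ControlData T d A) (s : ℝ) (α : ℝ → A) (φ : CadlagPath T d) : ℝ :=
  (∫ t in s..T, D.discount s α φ t * D.ell t φ (α t)) + D.discount s α φ T * D.h φ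

/-- The value function `v(s,x)`: the infimum of the cost of `φ^{s,x,α}` over all Borel controls
`α : [0,T] → A`. -/
def value [MeasurableSpace A] (D : ControlData T d A) (p : TimePath T d) : ℝ :=
  sInf {c | ∃ (α : ℝ → A) (φ : CadlagPath T d), Measurable (fun t : Icc (0 : ℝ) T => α t) ∧
    D.IsTrajectory p.time p.path α φ ∧ c = D.cost p.time α φ}

/-- The Hamiltonian `H(t,x,y,z) = inf_{a ∈ A} [ℓ(t,x,a) + (f(t,x,a),z) - λ(t,x,a) y]`. For fixed
`(x,y,z)` the pointwise infimum is a version of the essential infimum of this family of functions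
of `t`, because `A` is separable and the data are continuous in `a`. -/
def hamiltonian (D : ControlData T d A) (t : ℝ) (x : CadlagPath T d) (y : ℝ) (z : State d) : ℝ :=
  ⨅ a : A, (D.ell t x a + inner ℝ (D.f t x a) z - D.lam t x a * y)

end ControlData

end

/-!
The Lipschitz bounds for `H` hold because an infimum of functions of `a` inherits their moduli of
continuity. The rest of the theorem is a comparison, to first order in time, of `w` with a test
function `φ` touching it from above at `(s, x₀, y₀)`. Put `p = ∂ₓφ`, `q = ∂_{x'}φ` at this point.
Suppose that, up to `o(t - s)`, there are continuations `x, y` of the two paths in `𝒳` with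
`w(t,x,y) - w(s,x₀,y₀) ≥ ∫_s^t [(x',p) + (y',q) - E(r,x,y)] dr`, where `E` collects the terms with
`M` and `K` in the doubled equation. Since `φ - w ≥ 0` along `(x,y)`, the chain rule for `φ` and
the continuity of its derivatives give `∂ₜφ + E ≥ 0`, which is the assertion
(`HasPathDerivs.bracket_nonneg`). The estimates are uniform in `x, y`, as all paths in `𝒳` are
Lipschitz with one constant (`pathsX_subset_lipPaths`).

For `w = u - v` with a minimax subsolution `u`, the path `x` is the characteristic of `u` in
direction `p`, along which `u` grows at least by `∫ [(x',p) - H(r,x,·,p)]`, and `y` is a trajectory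
of a nearly optimal control, along which `v` grows at most by `∫ [λv - ℓ]`, by dynamic programming
(`exists_integral_add_value_lt`); moreover `λv - ℓ ≤ (y',-q) - H(r,y,v,-q)`. For `w = v - u` with a
supersolution `u`, the path `y` is the characteristic in direction `-q`, and `x` is a trajectory
of a control that nearly attains the infimum in `H(r,x,v,p)`; here `v` grows at least by
`∫ [λv - ℓ]` for every control (`value_le_integral_add_value`). Such a control is selected
measurably along the path stopped at `s`, from which its trajectory departs slowly. In both cases
what remains is a difference of two values of `H`; it is at most `E` because of the constants
`M`, `K` and because `H` decreases in `y`, while `w > 0` orders the two values of `y`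
(`ControlData.Admissible.hamiltonian_le_hamiltonian_add`).

Two facts on the control problem are needed. Data are integrable along Borel controls, although the
compact pieces of `A` need not be Borel sets (`measurable_superposition`). The value function is
continuous (`continuousOn_value`), although `h` is not uniformly continuous: the trajectories from
one initial point lie in a compact set (`exists_isCompact_lipPaths_subset`), and nearby initial
points give nearby trajectories (`IsTrajectory.dist_le`).
-/

noncomputable section

/-! ### Measurability along a control -/

/-- A family of continuous maps on a compact metrizable space is Borel measurable as soon as all
its evaluations are. -/
theorem ContinuousMap.measurable_of_forall_apply {X K E : Type*} [MeasurableSpace X]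
    [TopologicalSpace K] [SecondCountableTopology K] [LocallyCompactSpace K]
    [MetricSpace E] [SecondCountableTopology E] [MeasurableSpace E] [BorelSpace E]
    (Φ : X → C(K, E)) (hΦ : ∀ k, Measurable fun x => Φ x k) :
    @Measurable _ _ _ (borel C(K, E)) Φ := by
  rw [borel_eq_generateFrom_of_subbasis ContinuousMap.compactOpen_eq]
  refine measurable_generateFrom ?_
  rintro _ ⟨C, hC, U, hU, rfl⟩
  obtain ⟨D, hDc, hDd⟩ := TopologicalSpace.exists_countable_dense C
  -- `V n` is the closed set of the points of `U` at distance at least `1 / (n + 1)` from `Uᶜ`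
  let V : ℕ → Set E := fun n => {e | Metric.ball e (1 / (n + 1 : ℝ)) ⊆ U}
  have hVclosed : ∀ n, IsClosed (V n) := by
    intro n
    rw [← isOpen_compl_iff, Metric.isOpen_iff]
    intro e he
    obtain ⟨y, hy, hyU⟩ := not_subset.1 he
    rw [Metric.mem_ball] at hy
    refine ⟨1 / (n + 1 : ℝ) - dist y e, by linarith, fun e' he' hcon => hyU (hcon ?_)⟩
    rw [Metric.mem_ball] at he' ⊢
    linarith [dist_triangle y e e', dist_comm e e']
  have hVU : ∀ n, V n ⊆ U := fun n e he => he (Metric.mem_ball_self (by positivity))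
  have key : Φ ⁻¹' {f | MapsTo f C U} = ⋃ n, ⋂ a ∈ D, {x | Φ x a ∈ V n} := by
    ext x
    simp only [mem_preimage, mem_ofPred_eq, mem_iUnion, mem_iInter]
    constructor
    · intro h
      obtain ⟨δ, hδ, hsub⟩ := (hC.image (Φ x).continuous).exists_thickening_subset_open hU
        h.image_subset
      obtain ⟨n, hn⟩ := exists_nat_one_div_lt hδ
      refine ⟨n, fun a _ e he => hsub ?_⟩
      rw [Metric.mem_thickening_iff]
      exact ⟨Φ x a, mem_image_of_mem _ a.2, (Metric.mem_ball.1 he).trans hn⟩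
    · rintro ⟨n, hn⟩ a ha
      apply hVU n
      have hcl : IsClosed {c : C | Φ x c ∈ V n} :=
        (hVclosed n).preimage ((Φ x).continuous.comp continuous_subtype_val)
      have := hcl.closure_subset_iff.2 (fun c hc => hn c hc : D ⊆ {c : C | Φ x c ∈ V n})
      rw [hDd.closure_eq] at this
      exact this (mem_univ ⟨a, ha⟩)
  rw [key]
  refine MeasurableSet.iUnion fun n => MeasurableSet.biInter hDc fun a _ => ?_
  exact hΦ a (hVclosed n).measurableSet

/-- `A` is a countable union of compact metrizable subspaces; it need not be Hausdorff. -/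
def IsSigmaCompactMetrizable (A : Type*) [TopologicalSpace A] : Prop :=
  ∃ S : ℕ → Set A, (⋃ n, S n) = univ ∧
    ∀ n, IsCompact (S n) ∧ TopologicalSpace.MetrizableSpace (S n)

theorem IsSigmaCompactMetrizable.exists_secondCountable {A : Type*} [TopologicalSpace A]
    (hA : IsSigmaCompactMetrizable A) : ∃ S : ℕ → Set A, (⋃ n, S n) = univ ∧
      ∀ n, CompactSpace (S n) ∧ SecondCountableTopology (S n) ∧ LocallyCompactSpace (S n) := by
  obtain ⟨S, hS, h⟩ := hA
  refine ⟨S, hS, fun n => ?_⟩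
  have h1 : CompactSpace (S n) := isCompact_iff_compactSpace.1 (h n).1
  have := (h n).2
  let := TopologicalSpace.metrizableSpaceMetric (S n)
  exact ⟨h1, inferInstance, inferInstance⟩

theorem IsSigmaCompactMetrizable.separableSpace {A : Type*} [TopologicalSpace A]
    (hA : IsSigmaCompactMetrizable A) : TopologicalSpace.SeparableSpace A := by
  obtain ⟨S, hS, h⟩ := hA.exists_secondCountable
  rw [← TopologicalSpace.isSeparable_univ_iff, ← hS]
  refine TopologicalSpace.IsSeparable.iUnion fun n => ?_
  have := (h n).2.1
  exact TopologicalSpace.IsSeparable.of_subtype (S n)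

/-- Superposition of a Carathéodory function with a Borel control. The compact pieces of `A` need
not be Borel sets, so `A` is not cut into pieces: instead `x ↦ g x` is approximated by simple
functions whose values are among the continuous functions `g x'`. -/
theorem measurable_superposition {X A E : Type*} [MeasurableSpace X] [TopologicalSpace A]
    [MeasurableSpace A] [BorelSpace A] (hA : IsSigmaCompactMetrizable A)
    [MetricSpace E] [SecondCountableTopology E] [MeasurableSpace E] [BorelSpace E]
    {g : X → A → E} (hc : ∀ x, Continuous (g x)) (hm : ∀ a, Measurable fun x => g x a)
    {α : X → A} (hα : Measurable α) : Measurable fun x => g x (α x) := by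
  obtain ⟨S, hS, hS'⟩ := hA.exists_secondCountable
  have i1 : ∀ n, CompactSpace (S n) := fun n => (hS' n).1
  have i2 : ∀ n, SecondCountableTopology (S n) := fun n => (hS' n).2.1
  have i3 : ∀ n, LocallyCompactSpace (S n) := fun n => (hS' n).2.2
  let : ∀ n, MeasurableSpace C(S n, E) := fun n => borel _
  have i4 : ∀ n, BorelSpace C(S n, E) := fun n => ⟨rfl⟩
  let Φ : X → ∀ n, C(S n, E) := fun x n => ⟨fun a => g x a, (hc x).comp continuous_subtype_val⟩
  have hΦ : Measurable Φ := measurable_pi_lambda _ fun n =>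
    ContinuousMap.measurable_of_forall_apply _ fun k => hm k
  let R := range Φ
  let Ψ : X → R := fun x => ⟨Φ x, mem_range_self x⟩
  have hΨ : Measurable Ψ := hΦ.subtype_mk
  have hΨs : StronglyMeasurable Ψ := hΨ.stronglyMeasurable
  let ev : R → A → E := fun r => g r.2.choose
  have hev : ∀ (r : R) (n : ℕ) (a : S n), ev r a = r.1 n a := by
    intro r n a
    conv_rhs => rw [← r.2.choose_spec]
    rfl
  refine measurable_of_tendsto_metrizable (f := fun k x => ev (hΨs.approx k x) (α x)) ?_ ?_
  · exact fun k => (hΨs.approx k).measurable_bind (fun r x => ev r (α x)) fun r =>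
      (hc _).measurable.comp hα
  · rw [tendsto_pi_nhds]
    intro x
    have hx : α x ∈ ⋃ n, S n := hS ▸ mem_univ _
    obtain ⟨n, hn⟩ := mem_iUnion.1 hx
    have hcont : Continuous fun r : R => r.1 n ⟨α x, hn⟩ := by
      have h1 : Continuous fun r : R => r.1 n := (continuous_apply n).comp continuous_subtype_val
      exact (continuous_eval_const _).comp h1
    have := (hcont.tendsto _).comp (hΨs.tendsto_approx x)
    refine (this.congr fun k => ?_)
    exact (hev _ n ⟨α x, hn⟩).symm

theorem aemeasurable_superposition {X A E : Type*} [MeasurableSpace X] [TopologicalSpace A]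
    [MeasurableSpace A] [BorelSpace A] (hA : IsSigmaCompactMetrizable A)
    [MetricSpace E] [SecondCountableTopology E] [MeasurableSpace E] [BorelSpace E]
    {μ : Measure X} {g : X → A → E} (hc : ∀ᵐ x ∂μ, Continuous (g x))
    (hm : ∀ a, Measurable fun x => g x a) {α : X → A} (hα : Measurable α) :
    AEMeasurable (fun x => g x (α x)) μ := by
  classical
  rcases isEmpty_or_nonempty X with hX | ⟨⟨x₀⟩⟩
  · exact (measurable_of_empty _).aemeasurable
  let e : E := g x₀ (α x₀)
  obtain ⟨N, hN, hNm, hN0⟩ := exists_measurable_superset_of_null (ae_iff.1 hc)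
  refine ⟨fun x => (if x ∈ N then fun _ => e else g x) (α x),
    measurable_superposition hA (g := fun x => if x ∈ N then fun _ => e else g x)
      (fun x => ?_) (fun a => ?_) hα, ?_⟩
  · by_cases hx : x ∈ N
    · simpa [hx] using continuous_const
    · simpa [hx] using (not_not.1 fun h => hx (hN h) : Continuous (g x))
  · have : (fun x => (if x ∈ N then fun _ => e else g x) a) =
        fun x => if x ∈ N then e else g x a := by
      ext x; split_ifs <;> rfl
    rw [this]
    exact Measurable.ite hNm measurable_const (hm a)
  · have : ∀ᵐ x ∂μ, x ∉ N := measure_eq_zero_iff_ae_notMem.1 hN0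
    filter_upwards [this] with x hx
    simp [hx]

/-- Measurable selection of an `ε`-minimizer: it takes its values in a countable dense set. -/
theorem exists_measurable_lt_iInf_add {X A : Type*} [MeasurableSpace X] [TopologicalSpace A]
    [MeasurableSpace A] [Nonempty A] [TopologicalSpace.SeparableSpace A] {μ : Measure X}
    {F : X → A → ℝ} (hc : ∀ᵐ x ∂μ, Continuous (F x)) (hb : ∀ᵐ x ∂μ, BddBelow (range (F x)))
    (hm : ∀ a, Measurable fun x => F x a) {ε : ℝ} (hε : 0 < ε) :
    ∃ α : X → A, Measurable α ∧ ∀ᵐ x ∂μ, F x (α x) < (⨅ a, F x a) + ε := by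
  classical
  let a := TopologicalSpace.denseSeq A
  have hex : ∀ x, ∃ n, F x (a n) < (⨅ n, F x (a n)) + ε := by
    intro x
    by_cases hbx : BddBelow (range fun n => F x (a n))
    · exact exists_lt_of_ciInf_lt (lt_add_of_pos_right _ hε)
    · -- an infimum that is not bounded below has the junk value `0`
      rw [Real.iInf_of_not_bddBelow hbx]
      simp only [BddBelow, Set.Nonempty, not_exists, lowerBounds, mem_ofPred_eq] at hbx
      have := hbx 0
      push Not at this
      obtain ⟨_, ⟨n, rfl⟩, hn⟩ := this
      exact ⟨n, by simp only at hn; linarith⟩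
  refine ⟨fun x => a (Nat.find (hex x)), ?_, ?_⟩
  · refine (measurable_from_nat (f := a)).comp (measurable_find hex fun k => ?_)
    exact measurableSet_lt (hm _) ((Measurable.iInf fun n => hm _).add_const ε)
  · filter_upwards [hc, hb] with x hx hbx
    refine (Nat.find_spec (hex x)).trans_le ?_
    gcongr
    refine le_ciInf fun b => ?_
    have hcl : IsClosed {b | (⨅ n, F x (a n)) ≤ F x b} := isClosed_le continuous_const hx
    have hsub : range a ⊆ {b | (⨅ n, F x (a n)) ≤ F x b} := by
      rintro _ ⟨n, rfl⟩
      exact ciInf_le (hbx.mono (by rintro _ ⟨n, rfl⟩; exact ⟨_, rfl⟩)) n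
    have := hcl.closure_subset_iff.2 hsub
    rw [(TopologicalSpace.denseRange_denseSeq A).closure_range] at this
    exact this (mem_univ b)

/-! ### Suprema of paths -/

namespace CadlagPath

variable {T : ℝ} {d : ℕ} {x y z x' y' : CadlagPath T d} {s t t' B : ℝ}

theorem bddAbove_norm (x : CadlagPath T d) (t : ℝ) :
    BddAbove (range fun s : Icc (0 : ℝ) t => ‖x s‖) := by
  obtain ⟨C, hC⟩ := x.bounded
  exact ⟨C, by rintro _ ⟨i, rfl⟩; exact hC _⟩

theorem norm_le_supNorm (x : CadlagPath T d) (hs : s ∈ Icc 0 t) : ‖x s‖ ≤ x.supNorm t :=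
  le_ciSup (x.bddAbove_norm t) (⟨s, hs⟩ : Icc (0 : ℝ) t)

theorem supNorm_nonneg (x : CadlagPath T d) (t : ℝ) : 0 ≤ x.supNorm t :=
  Real.iSup_nonneg fun _ => norm_nonneg _

theorem supNorm_le (hB : 0 ≤ B) (h : ∀ s ∈ Icc 0 t, ‖x s‖ ≤ B) : x.supNorm t ≤ B :=
  Real.iSup_le (fun s => h s s.2) hB

theorem supNorm_mono (x : CadlagPath T d) : Monotone x.supNorm := fun _ _ h =>
  supNorm_le (x.supNorm_nonneg _) fun _ hs => x.norm_le_supNorm ⟨hs.1, hs.2.trans h⟩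

theorem norm_sub_le_supDiff (x y : CadlagPath T d) (hs : s ∈ Icc 0 t) :
    ‖x s - y s‖ ≤ x.supDiff y t :=
  le_ciSup (bddAbove_diff x y (fun s : Icc (0 : ℝ) t => (s : ℝ)) (fun s => s))
    (⟨s, hs⟩ : Icc (0 : ℝ) t)

theorem supDiff_nonneg (x y : CadlagPath T d) (t : ℝ) : 0 ≤ x.supDiff y t :=
  Real.iSup_nonneg fun _ => norm_nonneg _

theorem supDiff_le (hB : 0 ≤ B) (h : ∀ s ∈ Icc 0 t, ‖x s - y s‖ ≤ B) : x.supDiff y t ≤ B :=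
  Real.iSup_le (fun s => h s s.2) hB

theorem supDiff_mono (x y : CadlagPath T d) : Monotone (x.supDiff y) := fun _ _ h =>
  supDiff_le (supDiff_nonneg _ _ _) fun _ hs => norm_sub_le_supDiff x y ⟨hs.1, hs.2.trans h⟩

theorem supDiff_eq_zero (h : EqOn x y (Icc 0 t)) : x.supDiff y t = 0 :=
  le_antisymm (supDiff_le le_rfl fun s hs => by simp [h hs]) (supDiff_nonneg _ _ _)

theorem norm_sub_le_stopDist (x y : CadlagPath T d) (t t' : ℝ) {r : ℝ} (hr : r ∈ Icc 0 T) :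
    ‖x (min r t) - y (min r t')‖ ≤ stopDist t x t' y :=
  le_ciSup (bddAbove_diff x y (fun r : Icc (0 : ℝ) T => min (r : ℝ) t)
    (fun r => min (r : ℝ) t')) (⟨r, hr⟩ : Icc (0 : ℝ) T)

theorem stopDist_le (hB : 0 ≤ B) (h : ∀ r ∈ Icc 0 T, ‖x (min r t) - y (min r t')‖ ≤ B) :
    stopDist t x t' y ≤ B :=
  Real.iSup_le (fun s => h s s.2) hB

theorem stopDist_nonneg (t : ℝ) (x : CadlagPath T d) (t' : ℝ) (y : CadlagPath T d) :
    0 ≤ stopDist t x t' y := Real.iSup_nonneg fun _ => norm_nonneg _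

theorem dist_le_of_forall (hB : 0 ≤ B) (h : ∀ r ∈ Icc 0 T, ‖x r - y r‖ ≤ B) : dist x y ≤ B :=
  Real.iSup_le (fun s => h s s.2) hB

/-- A path is determined by its values on `[0,T]`. -/
theorem eq_of_eqOn (hT : 0 ≤ T) (h : EqOn x y (Icc 0 T)) : x = y := by
  ext1
  funext t
  rcases le_total t 0 with h0 | h0
  · rw [x.const_left t h0, y.const_left t h0]
    exact h ⟨le_rfl, hT⟩
  · rcases le_total T t with h1 | h1
    · rw [x.const_right t h1, y.const_right t h1]
      exact h ⟨hT, le_rfl⟩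
    · exact h ⟨h0, h1⟩

end CadlagPath

/-! ### A Gronwall inequality -/

/-- Gronwall's inequality in integral form for monotone functions, with non-sharp constants. -/
theorem MonotoneOn.le_two_mul_exp_of_le_add_integral {D : ℝ → ℝ} {a b c L : ℝ}
    (hD : MonotoneOn D (Icc a b)) (hc : 0 ≤ c) (hL : 0 ≤ L)
    (h : ∀ t ∈ Icc a b, D t ≤ c + L * ∫ r in a..t, D r) {t : ℝ} (ht : t ∈ Icc a b) :
    D t ≤ 2 * c * Real.exp ((2 * L + 1) * (t - a)) := by
  set κ := 2 * L + 1 with hκ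
  have hκ0 : 0 < κ := by positivity
  have hab : a ≤ b := ht.1.trans ht.2
  have : Nonempty (Icc a b) := ⟨⟨t, ht⟩⟩
  -- the weight `exp (-κ (r - a))` turns the integral into a contraction with factor `1/2`
  let W : Icc a b → ℝ := fun r => D r * Real.exp (-(κ * (r - a)))
  have hW : BddAbove (range W) := by
    refine ⟨max (D b) 0, ?_⟩
    rintro _ ⟨r, rfl⟩
    have h1 : D r ≤ max (D b) 0 := (hD r.2 ⟨hab, le_rfl⟩ r.2.2).trans (le_max_left _ _)
    have h2 : Real.exp (-(κ * (r - a))) ≤ 1 := by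
      rw [Real.exp_le_one_iff]
      have : 0 ≤ κ * (r - a) := mul_nonneg hκ0.le (sub_nonneg.2 r.2.1)
      linarith
    calc D r * Real.exp (-(κ * (r - a)))
        ≤ max (D b) 0 * Real.exp (-(κ * (r - a))) := by gcongr
      _ ≤ max (D b) 0 * 1 := mul_le_mul_of_nonneg_left h2 (le_max_right _ _)
      _ = _ := mul_one _
  set S := max (⨆ r, W r) 0 with hS
  have hS0 : 0 ≤ S := le_max_right _ _
  have hDS : ∀ r ∈ Icc a b, D r ≤ S * Real.exp (κ * (r - a)) := by
    intro r hr
    have h1 : W ⟨r, hr⟩ ≤ S := (le_ciSup hW _).trans (le_max_left _ _)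
    calc D r = W ⟨r, hr⟩ * Real.exp (κ * (r - a)) := by
          simp only [W]; rw [mul_assoc, ← Real.exp_add]; simp
      _ ≤ _ := by gcongr
  have hint : ∀ t ∈ Icc a b, ∫ r in a..t, S * Real.exp (κ * (r - a)) =
      S * ((Real.exp (κ * (t - a)) - 1) / κ) := by
    intro t _
    rw [intervalIntegral.integral_const_mul]
    congr 1
    have hd : ∀ r ∈ uIcc a t, HasDerivAt (fun r => Real.exp (κ * (r - a)) / κ)
        (Real.exp (κ * (r - a))) r := by
      intro r _
      have h1 : HasDerivAt (fun r : ℝ => κ * (r - a)) κ r := by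
        simpa using ((hasDerivAt_id r).sub_const a).const_mul κ
      have h2 := h1.exp.div_const κ
      rwa [mul_div_assoc, div_self hκ0.ne', mul_one] at h2
    rw [intervalIntegral.integral_eq_sub_of_hasDerivAt hd
      (Continuous.intervalIntegrable (by fun_prop) _ _)]
    simp
    ring
  have hstep : ∀ t ∈ Icc a b, D t ≤ (c + S / 2) * Real.exp (κ * (t - a)) := by
    intro t ht
    have hmono : MonotoneOn D (uIcc a t) := by
      rw [uIcc_of_le ht.1]; exact hD.mono (Icc_subset_Icc_right ht.2)
    have h1 : ∫ r in a..t, D r ≤ ∫ r in a..t, S * Real.exp (κ * (r - a)) :=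
      intervalIntegral.integral_mono_on ht.1 hmono.intervalIntegrable
        (Continuous.intervalIntegrable (by fun_prop) _ _)
        fun r hr => hDS r ⟨hr.1, hr.2.trans ht.2⟩
    rw [hint t ht] at h1
    have hE : 1 ≤ Real.exp (κ * (t - a)) :=
      Real.one_le_exp (mul_nonneg hκ0.le (sub_nonneg.2 ht.1))
    have h2 : L * (S * ((Real.exp (κ * (t - a)) - 1) / κ)) ≤ S / 2 * Real.exp (κ * (t - a)) := by
      have h3 : L / κ ≤ 1 / 2 := by rw [div_le_div_iff₀ hκ0 two_pos]; linarith
      have h4 : 0 ≤ S * (Real.exp (κ * (t - a)) - 1) := mul_nonneg hS0 (by linarith)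
      calc L * (S * ((Real.exp (κ * (t - a)) - 1) / κ))
          = (L / κ) * (S * (Real.exp (κ * (t - a)) - 1)) := by ring
        _ ≤ 1 / 2 * (S * (Real.exp (κ * (t - a)) - 1)) := by gcongr
        _ ≤ _ := by linarith
    have h5 := mul_le_mul_of_nonneg_left h1 hL
    have h6 := mul_le_mul_of_nonneg_left hE hc
    linarith [h t ht]
  have hSle : S ≤ c + S / 2 := by
    refine max_le (ciSup_le fun r => ?_) (by linarith)
    calc W r ≤ (c + S / 2) * Real.exp (κ * (r - a)) * Real.exp (-(κ * (r - a))) := by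
          simp only [W]; gcongr; exact hstep r r.2
      _ = c + S / 2 := by rw [mul_assoc, ← Real.exp_add]; simp
  calc D t ≤ S * Real.exp (κ * (t - a)) := hDS t ht
    _ ≤ 2 * c * Real.exp (κ * (t - a)) := by gcongr; linarith

/-! ### Absolutely continuous paths with bounded derivative -/

theorem AbsolutelyContinuousOnInterval.ae_differentiableAt_euclidean {d : ℕ} {x : ℝ → State d}
    {a b : ℝ} (hx : AbsolutelyContinuousOnInterval x a b) :
    ∀ᵐ t, t ∈ uIcc a b → DifferentiableAt ℝ x t := by
  have h : ∀ i : Fin d, ∀ᵐ t, t ∈ uIcc a b → DifferentiableAt ℝ (fun r => x r i) t := by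
    intro i
    refine AbsolutelyContinuousOnInterval.ae_differentiableAt ?_
    rw [absolutelyContinuousOnInterval_iff] at hx ⊢
    intro ε hε
    obtain ⟨δ, hδ, h⟩ := hx ε hε
    refine ⟨δ, hδ, fun E hE hlt => (Finset.sum_le_sum fun k _ => ?_).trans_lt (h E hE hlt)⟩
    rw [dist_eq_norm, dist_eq_norm]
    exact PiLp.norm_apply_le (x (E.2 k).1 - x (E.2 k).2) i
  filter_upwards [ae_all_iff.2 h] with t ht hmem
  exact differentiableAt_euclidean.2 fun i => ht i hmem

theorem AbsolutelyContinuousOnInterval.intervalIntegrable_deriv_of_le {d : ℕ} {x : ℝ → State d}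
    {a b C : ℝ} (hab : a ≤ b) (hC : ∀ᵐ t, t ∈ Ioo a b → ‖deriv x t‖ ≤ C) :
    IntervalIntegrable (deriv x) volume a b := by
  rw [intervalIntegrable_iff_integrableOn_Ioo_of_le hab]
  refine Measure.integrableOn_of_bounded (M := C) (by simp)
    (stronglyMeasurable_deriv x).aestronglyMeasurable ?_
  rw [ae_restrict_iff' measurableSet_Ioo]
  exact hC

/-- An absolutely continuous function with bounded derivative is the integral of its derivative. -/
theorem AbsolutelyContinuousOnInterval.integral_deriv_eq_sub_of_le {d : ℕ} {x : ℝ → State d}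
    {a b C : ℝ} (hab : a ≤ b) (hx : AbsolutelyContinuousOnInterval x a b)
    (hC : ∀ᵐ t, t ∈ Ioo a b → ‖deriv x t‖ ≤ C) {s t : ℝ} (hs : s ∈ Icc a b) (ht : t ∈ Icc a b) :
    ∫ r in s..t, deriv x r = x t - x s := by
  have hint := AbsolutelyContinuousOnInterval.intervalIntegrable_deriv_of_le hab hC
  have hsub : ∀ {p q}, p ∈ Icc a b → q ∈ Icc a b → IntervalIntegrable (deriv x) volume p q := by
    intro p q hp hq
    refine hint.mono_set ?_
    rw [uIcc_of_le hab]
    exact ordConnected_Icc.uIcc_subset hp hq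
  have hae : ∀ᵐ t : ℝ, t ∈ uIcc a b → t ∈ Ioo a b := by
    filter_upwards [Measure.ae_ne volume a, Measure.ae_ne volume b] with t h1 h2 h3
    rw [uIcc_of_le hab] at h3
    exact ⟨lt_of_le_of_ne h3.1 (Ne.symm h1), lt_of_le_of_ne h3.2 h2⟩
  have hlip : LipschitzOnWith C.toNNReal (fun t => ∫ r in a..t, deriv x r) (uIcc a b) := by
    refine LipschitzOnWith.of_dist_le_mul fun p hp q hq => ?_
    rw [uIcc_of_le hab] at hp hq
    rw [dist_eq_norm, intervalIntegral.integral_interval_sub_left (hsub ⟨le_rfl, hab⟩ hp)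
      (hsub ⟨le_rfl, hab⟩ hq), Real.dist_eq]
    refine intervalIntegral.norm_integral_le_of_norm_le_const_ae ?_
    filter_upwards [hC, hae] with t h1 h2 h3
    refine (h1 (h2 ?_)).trans (Real.le_coe_toNNReal C)
    rw [uIcc_of_le hab]
    exact ordConnected_Icc.uIcc_subset hq hp (uIoc_subset_uIcc h3)
  have hg := hx.sub hlip.absolutelyContinuousOnInterval
  obtain ⟨c, hc⟩ := hg.const_of_ae_hasDerivAt_zero (by
    filter_upwards [hx.ae_differentiableAt_euclidean, hint.ae_hasDerivAt_integral] with t h1 h2 h3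
    convert! (h1 h3).hasDerivAt.sub (h2 h3 a (by simp))
    abel)
  rw [uIcc_of_le hab] at hc
  have h1 := hc s hs
  have h2 := hc t ht
  rw [← intervalIntegral.integral_interval_sub_left (hsub ⟨le_rfl, hab⟩ ht)
    (hsub ⟨le_rfl, hab⟩ hs)]
  simp only [Pi.sub_apply] at h1 h2
  have h3 := h1.trans h2.symm
  rw [sub_eq_sub_iff_add_eq_add] at h3 ⊢
  rw [add_comm, ← h3, add_comm]

/-! ### Lipschitz continuations -/

/-- The continuations of `x₀` after time `s` that are Lipschitz with constant `R` on `[s,T]`. -/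
def lipPaths {T : ℝ} {d : ℕ} (R s : ℝ) (x₀ : CadlagPath T d) : Set (CadlagPath T d) :=
  {x | EqOn x x₀ (Icc 0 s) ∧ ∀ t ∈ Icc s T, ∀ t' ∈ Icc s T, ‖x t - x t'‖ ≤ R * |t - t'|}

/-- The a priori bound for `1 + sup |x|` over `𝒳^L(s,x₀)`, where `N` bounds `x₀` up to `s`. -/
def growthBound (T L N : ℝ) : ℝ := 2 * (1 + N) * Real.exp ((2 * L + 1) * T)

theorem growthBound_pos {T L N : ℝ} (hN : 0 ≤ N) : 0 < growthBound T L N := by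
  unfold growthBound; positivity

theorem growthBound_mono {T L N N' : ℝ} (h : N ≤ N') : growthBound T L N ≤ growthBound T L N' := by
  unfold growthBound; gcongr

section Paths

variable {T : ℝ} {d : ℕ} {x x₀ y y₀ : CadlagPath T d} {L R s t t' : ℝ}

theorem one_add_supNorm_le_growthBound (hL : 0 ≤ L) (hs : s ∈ Icc 0 T) (hx : x ∈ pathsX L s x₀) :
    1 + x.supNorm T ≤ growthBound T L (x₀.supNorm s) := by
  obtain ⟨h0, hac, hder⟩ := hx
  have hC : ∀ᵐ t, t ∈ Ioo s T → ‖deriv x t‖ ≤ L * (1 + x.supNorm T) := by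
    filter_upwards [hder] with t ht hmem
    refine (ht hmem).trans ?_
    gcongr
    exact x.supNorm_mono hmem.2.le
  have hmono : MonotoneOn (fun t => 1 + x.supNorm t) (Icc s T) :=
    fun _ _ _ _ h => add_le_add_right (x.supNorm_mono h) 1
  have key : ∀ t ∈ Icc s T, 1 + x.supNorm t ≤
      (1 + x₀.supNorm s) + L * ∫ r in s..t, (1 + x.supNorm r) := by
    intro t ht
    have hI : ∀ q ∈ Icc s t, ∫ r in s..q, (1 + x.supNorm r) ≤ ∫ r in s..t, (1 + x.supNorm r) := by
      intro q hq
      refine intervalIntegral.integral_mono_interval le_rfl hq.1 hq.2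
        (Eventually.of_forall fun r => by
          have := x.supNorm_nonneg r
          simp only [Pi.zero_apply]; linarith) ?_
      exact MonotoneOn.intervalIntegrable (hmono.mono (by
        rw [uIcc_of_le ht.1]; exact Icc_subset_Icc_right ht.2))
    have hI0 : 0 ≤ ∫ r in s..t, (1 + x.supNorm r) := by
      simpa using hI s ⟨le_rfl, ht.1⟩
    have h2 : x.supNorm t ≤ x₀.supNorm s + L * ∫ r in s..t, (1 + x.supNorm r) := by
      refine CadlagPath.supNorm_le (add_nonneg (x₀.supNorm_nonneg s) (mul_nonneg hL hI0)) ?_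
      intro q hq
      rcases le_total q s with h | h
      · rw [h0 ⟨hq.1, h⟩]
        have := x₀.norm_le_supNorm (s := q) (t := s) ⟨hq.1, h⟩
        have := mul_nonneg hL hI0
        linarith
      · have hqT : q ∈ Icc s T := ⟨h, hq.2.trans ht.2⟩
        have e1 := hac.integral_deriv_eq_sub_of_le hs.2 hC ⟨le_rfl, hs.2⟩ hqT
        have e2 : ‖∫ r in s..q, deriv x r‖ ≤ ∫ r in s..q, L * (1 + x.supNorm r) := by
          refine intervalIntegral.norm_integral_le_of_norm_le h ?_ ?_
          · filter_upwards [hder, Measure.ae_ne volume T] with r hr hne hmem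
            exact hr ⟨hmem.1, lt_of_le_of_ne (hmem.2.trans hqT.2) hne⟩
          · refine (MonotoneOn.intervalIntegrable (hmono.mono ?_)).const_mul L
            rw [uIcc_of_le h]; exact Icc_subset_Icc_right hqT.2
        rw [intervalIntegral.integral_const_mul] at e2
        have e3 := mul_le_mul_of_nonneg_left (hI q ⟨h, hq.2⟩) hL
        have e4 : ‖x q‖ ≤ ‖x s‖ + ‖x q - x s‖ := by
          simpa using norm_add_le (x s) (x q - x s)
        rw [← e1] at e4
        have e5 : ‖x s‖ ≤ x₀.supNorm s := by
          rw [h0 ⟨hs.1, le_rfl⟩]; exact x₀.norm_le_supNorm ⟨hs.1, le_rfl⟩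
        linarith
    linarith
  have hN := x₀.supNorm_nonneg s
  refine (hmono.le_two_mul_exp_of_le_add_integral (by positivity) hL key ⟨hs.2, le_rfl⟩).trans ?_
  unfold growthBound
  gcongr
  linarith [hs.1]

theorem ae_norm_deriv_le_of_mem_pathsX (hL : 0 ≤ L) (hs : s ∈ Icc 0 T) (hx : x ∈ pathsX L s x₀) :
    ∀ᵐ t, t ∈ Ioo s T → ‖deriv x t‖ ≤ L * growthBound T L (x₀.supNorm s) := by
  filter_upwards [hx.2.2] with t ht hmem
  refine (ht hmem).trans ?_
  gcongr
  exact (add_le_add_right (x.supNorm_mono hmem.2.le) 1).trans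
    (one_add_supNorm_le_growthBound hL hs hx)

theorem pathsX_subset_lipPaths (hL : 0 ≤ L) (hs : s ∈ Icc 0 T) :
    pathsX L s x₀ ⊆ lipPaths (L * growthBound T L (x₀.supNorm s)) s x₀ := by
  intro x hx
  refine ⟨hx.1, fun t ht t' ht' => ?_⟩
  have hC := ae_norm_deriv_le_of_mem_pathsX hL hs hx
  rw [← hx.2.1.integral_deriv_eq_sub_of_le hs.2 hC ht' ht]
  refine intervalIntegral.norm_integral_le_of_norm_le_const_ae ?_
  filter_upwards [hC, Measure.ae_ne volume s, Measure.ae_ne volume T] with r hr h1 h2 hmem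
  have hmem' := ordConnected_Icc.uIcc_subset ht' ht (uIoc_subset_uIcc hmem)
  exact hr ⟨lt_of_le_of_ne hmem'.1 (Ne.symm h1), lt_of_le_of_ne hmem'.2 h2⟩

theorem lipPaths.lipschitzOnWith (hx : x ∈ lipPaths R s x₀) :
    LipschitzOnWith R.toNNReal x (Icc s T) :=
  LipschitzOnWith.of_dist_le_mul fun t ht t' ht' => by
    rw [dist_eq_norm, Real.dist_eq]
    refine (hx.2 t ht t' ht').trans ?_
    gcongr
    exact Real.le_coe_toNNReal R

/-- Along a Lipschitz continuation, stopping at different times changes the path little. -/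
theorem stopDist_le_of_mem_lipPaths (hR : 0 ≤ R) (hs : 0 ≤ s) (hx : x ∈ lipPaths R s x₀)
    (ht : t ∈ Icc s T) (ht' : t' ∈ Icc s T) (hy : EqOn x y (Icc 0 t')) :
    CadlagPath.stopDist t x t' y ≤ R * |t - t'| := by
  refine CadlagPath.stopDist_le (by positivity) fun q hq => ?_
  rw [← hy ⟨le_min hq.1 (hs.trans ht'.1), min_le_right _ _⟩]
  rcases le_total q s with h | h
  · rw [min_eq_left (h.trans ht.1), min_eq_left (h.trans ht'.1), sub_self, norm_zero]
    positivity
  · refine (hx.2 _ ⟨le_min h ht.1, (min_le_left _ _).trans hq.2⟩ _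
      ⟨le_min h ht'.1, (min_le_left _ _).trans hq.2⟩).trans ?_
    exact mul_le_mul_of_nonneg_left
      ((abs_min_sub_min_le_max q t q t').trans (max_le (by simp) le_rfl)) hR

end Paths

/-! ### Data along a control -/

namespace ControlData

variable {T : ℝ} {d : ℕ} {A : Type*}

/-- `α` restricts to a Borel function on `[0,T]`. -/
def IsControl [MeasurableSpace A] (T : ℝ) (α : ℝ → A) : Prop :=
  Measurable fun t : Icc (0 : ℝ) T => α t

/-- A bounded measurable function on `[0,T]` is integrable over every subinterval. -/
theorem intervalIntegrable_of_aemeasurable {E : Type*} [NormedAddCommGroup E]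
    [SecondCountableTopology E] [MeasurableSpace E] [BorelSpace E] {g : ℝ → E} {C a b : ℝ}
    (hg : AEMeasurable g (volume.restrict (Icc 0 T))) (hC : ∀ᵐ t, t ∈ Ioo 0 T → ‖g t‖ ≤ C)
    (ha : a ∈ Icc 0 T) (hb : b ∈ Icc 0 T) : IntervalIntegrable g volume a b := by
  have hT : 0 ≤ T := ha.1.trans ha.2
  have h : IntervalIntegrable g volume 0 T := by
    rw [intervalIntegrable_iff_integrableOn_Ioo_of_le hT]
    refine Integrable.of_bound
      (hg.mono_measure (Measure.restrict_mono Ioo_subset_Icc_self le_rfl)).aestronglyMeasurable C ?_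
    rw [ae_restrict_iff' measurableSet_Ioo]
    exact hC
  refine h.mono_set ?_
  rw [uIcc_of_le hT]
  exact ordConnected_Icc.uIcc_subset ha hb

theorem ae_mem_Ioo_of_mem_uIoc {s T a b : ℝ} (ha : a ∈ Icc s T) (hb : b ∈ Icc s T) :
    ∀ᵐ t : ℝ, t ∈ uIoc a b → t ∈ Ioo s T := by
  filter_upwards [Measure.ae_ne volume s, Measure.ae_ne volume T] with r h1 h2 hmem
  have hmem' := ordConnected_Icc.uIcc_subset ha hb (uIoc_subset_uIcc hmem)
  exact ⟨lt_of_le_of_ne hmem'.1 (Ne.symm h1), lt_of_le_of_ne hmem'.2 h2⟩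

variable {D : ControlData T d A} {α : ℝ → A} {s t : ℝ} {x φ : CadlagPath T d}

theorem IsControl.concat [MeasurableSpace A] {α' : ℝ → A} (hα : IsControl T α)
    (hα' : IsControl T α') (t : ℝ) : IsControl T fun r => if r < t then α r else α' r :=
  Measurable.ite (measurableSet_lt measurable_subtype_coe measurable_const) hα hα'

theorem IsTrajectory.ae_deriv_eq (hφ : D.IsTrajectory s x α φ) :
    ∀ᵐ t : ℝ, t ∈ Ioo s T → deriv φ t = D.f t φ (α t) := by
  filter_upwards [hφ.2.2] with t ht hmem using (ht hmem).deriv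

theorem IsTrajectory.restrict (hφ : D.IsTrajectory s x α φ) (ht : t ∈ Icc s T) :
    D.IsTrajectory t φ α φ := by
  refine ⟨fun _ _ => rfl, hφ.2.1.mono ?_, ?_⟩
  · rw [uIcc_of_le ht.2, uIcc_of_le (ht.1.trans ht.2)]
    exact Icc_subset_Icc_left ht.1
  · filter_upwards [hφ.2.2] with r hr hmem using hr ⟨ht.1.trans_lt hmem.1, hmem.2⟩

variable [TopologicalSpace A] {Cf Clam Lf : ℝ}

namespace Admissible

/-- The data depend on the past of the path only. -/
theorem causal (hD : D.Admissible Cf Clam Lf) : ∀ᵐ t : ℝ, t ∈ Ioo 0 T →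
    ∀ x x' : CadlagPath T d, EqOn x x' (Icc 0 t) → ∀ a,
      D.f t x a = D.f t x' a ∧ D.lam t x a = D.lam t x' a ∧ D.ell t x a = D.ell t x' a := by
  filter_upwards [hD.lip] with t ht hmem x x' hx a
  have h := ht hmem x x' a
  rw [CadlagPath.supDiff_eq_zero hx, mul_zero] at h
  have h1 := norm_nonneg (D.f t x a - D.f t x' a)
  have h2 := abs_nonneg (D.lam t x a - D.lam t x' a)
  have h3 := abs_nonneg (D.ell t x a - D.ell t x' a)
  refine ⟨sub_eq_zero.1 (norm_le_zero_iff.1 (by linarith)),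
    sub_eq_zero.1 (abs_nonpos_iff.1 (by linarith)), sub_eq_zero.1 (abs_nonpos_iff.1 (by linarith))⟩

theorem norm_f_le (hD : D.Admissible Cf Clam Lf) : ∀ᵐ t : ℝ, t ∈ Ioo 0 T →
    ∀ (x : CadlagPath T d) (a : A), ‖D.f t x a‖ ≤ Cf * (1 + x.supNorm t) := by
  filter_upwards [hD.growth] with t ht hmem x a
  have := (ht hmem x a).1
  have := abs_nonneg (D.ell t x a)
  linarith

theorem abs_ell_le (hD : D.Admissible Cf Clam Lf) : ∀ᵐ t : ℝ, t ∈ Ioo 0 T →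
    ∀ (x : CadlagPath T d) (a : A), |D.ell t x a| ≤ Cf * (1 + x.supNorm t) := by
  filter_upwards [hD.growth] with t ht hmem x a
  have := (ht hmem x a).1
  have := norm_nonneg (D.f t x a)
  linarith

theorem one_add_supNorm_mono (hD : D.Admissible Cf Clam Lf) {x : CadlagPath T d} {t B : ℝ}
    (ht : t ∈ Ioo 0 T) (hB : 1 + x.supNorm T ≤ B) : Cf * (1 + x.supNorm t) ≤ Cf * B :=
  mul_le_mul_of_nonneg_left ((add_le_add_right (x.supNorm_mono ht.2.le) 1).trans hB) hD.Cf_nonneg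

variable [MeasurableSpace A] [BorelSpace A]

theorem aemeasurable_along (hD : D.Admissible Cf Clam Lf) (hA : IsSigmaCompactMetrizable A)
    (hα : IsControl T α) (x : CadlagPath T d) :
    AEMeasurable (fun t => (D.f t x (α t), D.lam t x (α t), D.ell t x (α t)))
      (volume.restrict (Icc 0 T)) := by
  rw [aemeasurable_restrict_iff_comap_subtype measurableSet_Icc]
  refine aemeasurable_superposition hA
    (g := fun (t : Icc (0 : ℝ) T) a => (D.f t x a, D.lam t x a, D.ell t x a)) ?_
    (fun a => hD.meas x a) hα
  have h := hD.cont
  rw [← ae_restrict_iff' measurableSet_Icc, ae_restrict_iff_subtype measurableSet_Icc] at h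
  filter_upwards [h] with t ht
  exact ht.comp (Continuous.prodMk_right x)

theorem intervalIntegrable_f (hD : D.Admissible Cf Clam Lf) (hA : IsSigmaCompactMetrizable A)
    (hα : IsControl T α) (x : CadlagPath T d) {a b : ℝ} (ha : a ∈ Icc 0 T) (hb : b ∈ Icc 0 T) :
    IntervalIntegrable (fun t => D.f t x (α t)) volume a b := by
  refine intervalIntegrable_of_aemeasurable (C := Cf * (1 + x.supNorm T))
    (hD.aemeasurable_along hA hα x).fst ?_ ha hb
  filter_upwards [hD.norm_f_le] with t ht hmem
  exact (ht hmem x _).trans (hD.one_add_supNorm_mono hmem le_rfl)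

theorem intervalIntegrable_lam (hD : D.Admissible Cf Clam Lf) (hA : IsSigmaCompactMetrizable A)
    (hα : IsControl T α) (x : CadlagPath T d) {a b : ℝ} (ha : a ∈ Icc 0 T) (hb : b ∈ Icc 0 T) :
    IntervalIntegrable (fun t => D.lam t x (α t)) volume a b := by
  refine intervalIntegrable_of_aemeasurable (C := Clam)
    (hD.aemeasurable_along hA hα x).snd.fst ?_ ha hb
  filter_upwards [hD.growth] with t ht hmem
  exact (ht hmem x _).2

theorem intervalIntegrable_ell (hD : D.Admissible Cf Clam Lf) (hA : IsSigmaCompactMetrizable A)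
    (hα : IsControl T α) (x : CadlagPath T d) {a b : ℝ} (ha : a ∈ Icc 0 T) (hb : b ∈ Icc 0 T) :
    IntervalIntegrable (fun t => D.ell t x (α t)) volume a b := by
  refine intervalIntegrable_of_aemeasurable (C := Cf * (1 + x.supNorm T))
    (hD.aemeasurable_along hA hα x).snd.snd ?_ ha hb
  filter_upwards [hD.abs_ell_le] with t ht hmem
  exact (ht hmem x _).trans (hD.one_add_supNorm_mono hmem le_rfl)

end Admissible

/-! ### Trajectories -/

theorem IsTrajectory.mem_pathsX (hD : D.Admissible Cf Clam Lf) (hs : 0 ≤ s)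
    (hφ : D.IsTrajectory s x α φ) : φ ∈ pathsX Cf s x := by
  refine ⟨hφ.1, hφ.2.1, ?_⟩
  filter_upwards [hφ.ae_deriv_eq, hD.norm_f_le] with t h1 h2 hmem
  rw [h1 hmem]
  exact h2 ⟨hs.trans_lt hmem.1, hmem.2⟩ _ _

theorem IsTrajectory.integral_eq (hD : D.Admissible Cf Clam Lf) (hs : s ∈ Icc 0 T)
    (hφ : D.IsTrajectory s x α φ) {a b : ℝ} (ha : a ∈ Icc s T) (hb : b ∈ Icc s T) :
    ∫ r in a..b, D.f r φ (α r) = φ b - φ a := by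
  rw [← hφ.2.1.integral_deriv_eq_sub_of_le hs.2
    (ae_norm_deriv_le_of_mem_pathsX hD.Cf_nonneg hs (hφ.mem_pathsX hD hs.1)) ha hb]
  refine intervalIntegral.integral_congr_ae ?_
  filter_upwards [hφ.ae_deriv_eq, ae_mem_Ioo_of_mem_uIoc ha hb] with r h1 h2 h3
  exact (h1 (h2 h3)).symm

/-- Trajectories can be concatenated, because the dynamics depend on the past only. -/
theorem IsTrajectory.concat (hD : D.Admissible Cf Clam Lf) (hs : 0 ≤ s) {α' : ℝ → A}
    {φ' : CadlagPath T d} (hφ : D.IsTrajectory s x α φ) (ht : t ∈ Icc s T)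
    (hφ' : D.IsTrajectory t φ α' φ') :
    D.IsTrajectory s x (fun r => if r < t then α r else α' r) φ' := by
  have ht0 : t ∈ Icc 0 T := ⟨hs.trans ht.1, ht.2⟩
  have hsT : s ∈ Icc 0 T := ⟨hs, ht.1.trans ht.2⟩
  have h1 := pathsX_subset_lipPaths hD.Cf_nonneg hsT (hφ.mem_pathsX hD hs)
  have h2 := pathsX_subset_lipPaths hD.Cf_nonneg ht0 (hφ'.mem_pathsX hD ht0.1)
  refine ⟨fun r hr => (hφ'.1 ⟨hr.1, hr.2.trans ht.1⟩).trans (hφ.1 hr), ?_, ?_⟩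
  · set R := max (Cf * growthBound T Cf (x.supNorm s)) (Cf * growthBound T Cf (φ.supNorm t))
    have hlip : ∀ p ∈ Icc s T, ∀ q ∈ Icc s T, p ≤ q → ‖φ' q - φ' p‖ ≤ R * (q - p) := by
      have hl : ∀ p q, s ≤ p → p ≤ q → q ≤ t → ‖φ' q - φ' p‖ ≤ R * (q - p) := by
        intro p q hp hpq hq
        rw [hφ'.1 ⟨hs.trans (hp.trans hpq), hq⟩, hφ'.1 ⟨hs.trans hp, hpq.trans hq⟩]
        refine (h1.2 q ⟨hp.trans hpq, hq.trans ht.2⟩ p ⟨hp, (hpq.trans hq).trans ht.2⟩).trans ?_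
        rw [abs_of_nonneg (sub_nonneg.2 hpq)]
        exact mul_le_mul_of_nonneg_right (le_max_left _ _) (sub_nonneg.2 hpq)
      have hr : ∀ p q, t ≤ p → p ≤ q → q ≤ T → ‖φ' q - φ' p‖ ≤ R * (q - p) := by
        intro p q hp hpq hq
        refine (h2.2 q ⟨hp.trans hpq, hq⟩ p ⟨hp, hpq.trans hq⟩).trans ?_
        rw [abs_of_nonneg (sub_nonneg.2 hpq)]
        exact mul_le_mul_of_nonneg_right (le_max_right _ _) (sub_nonneg.2 hpq)
      intro p hp q hq hpq
      rcases le_total q t with h | h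
      · exact hl p q hp.1 hpq h
      · rcases le_total t p with h' | h'
        · exact hr p q h' hpq hq.2
        · have e1 := hl p t hp.1 h' le_rfl
          have e2 := hr t q le_rfl h hq.2
          have e3 := norm_sub_le_norm_sub_add_norm_sub (φ' q) (φ' t) (φ' p)
          linarith
    have hmem : φ' ∈ lipPaths R s φ' := by
      refine ⟨fun _ _ => rfl, fun p hp q hq => ?_⟩
      rcases le_total p q with h | h
      · rw [norm_sub_rev, abs_sub_comm, abs_of_nonneg (sub_nonneg.2 h)]
        exact hlip p hp q hq h
      · rw [abs_of_nonneg (sub_nonneg.2 h)]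
        exact hlip q hq p hp h
    refine LipschitzOnWith.absolutelyContinuousOnInterval (K := R.toNNReal) ?_
    rw [uIcc_of_le hsT.2]
    exact lipPaths.lipschitzOnWith hmem
  · filter_upwards [hφ.2.2, hφ'.2.2, hD.causal, Measure.ae_ne volume t] with r e1 e2 e3 hne hmem
    rcases lt_or_gt_of_ne hne with h | h
    · simp only [h, if_true]
      rw [(e3 ⟨hs.trans_lt hmem.1, hmem.2⟩ φ' φ (hφ'.1.mono (Icc_subset_Icc_right h.le)) _).1]
      refine (e1 hmem).congr_of_eventuallyEq ?_
      filter_upwards [Ioo_mem_nhds hmem.1 h] with q hq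
      exact hφ'.1 ⟨hs.trans hq.1.le, hq.2.le⟩
    · simp only [not_lt.2 h.le, if_false]
      exact e2 ⟨h, hmem.2⟩

/-- Solutions of the integral equation are trajectories. -/
theorem isTrajectory_of_integral_eq [MeasurableSpace A] [BorelSpace A]
    (hD : D.Admissible Cf Clam Lf) (hA : IsSigmaCompactMetrizable A) (hα : IsControl T α)
    (hs : s ∈ Icc 0 T) (h0 : EqOn φ x (Icc 0 s))
    (h : ∀ t ∈ Icc s T, φ t = x s + ∫ r in s..t, D.f r φ (α r)) : D.IsTrajectory s x α φ := by
  have hT : T ∈ Icc 0 T := ⟨hs.1.trans hs.2, le_rfl⟩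
  have hint : ∀ {p q}, p ∈ Icc s T → q ∈ Icc s T →
      IntervalIntegrable (fun r => D.f r φ (α r)) volume p q := fun hp hq =>
    hD.intervalIntegrable_f hA hα φ ⟨hs.1.trans hp.1, hp.2⟩ ⟨hs.1.trans hq.1, hq.2⟩
  have hsm : s ∈ Icc s T := ⟨le_rfl, hs.2⟩
  refine ⟨h0, ?_, ?_⟩
  · have hmem : φ ∈ lipPaths (Cf * (1 + φ.supNorm T)) s φ := by
      refine ⟨fun _ _ => rfl, fun p hp q hq => ?_⟩
      rw [h p hp, h q hq, add_sub_add_left_eq_sub,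
        intervalIntegral.integral_interval_sub_left (hint hsm hp) (hint hsm hq)]
      refine intervalIntegral.norm_integral_le_of_norm_le_const_ae ?_
      filter_upwards [ae_mem_Ioo_of_mem_uIoc hq hp, hD.norm_f_le] with r h1 h2 h3
      have h4 : r ∈ Ioo 0 T := ⟨hs.1.trans_lt (h1 h3).1, (h1 h3).2⟩
      exact (h2 h4 φ _).trans (hD.one_add_supNorm_mono h4 le_rfl)
    refine LipschitzOnWith.absolutelyContinuousOnInterval
      (K := (Cf * (1 + φ.supNorm T)).toNNReal) ?_
    rw [uIcc_of_le hs.2]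
    exact lipPaths.lipschitzOnWith hmem
  · filter_upwards [(hint hsm ⟨hs.2, le_rfl⟩).ae_hasDerivAt_integral] with t ht hmem
    have h1 := (ht (by rw [uIcc_of_le hs.2]; exact Ioo_subset_Icc_self hmem) s
      left_mem_uIcc).const_add (x s)
    refine h1.congr_of_eventuallyEq ?_
    filter_upwards [Ioo_mem_nhds hmem.1 hmem.2] with q hq
    exact h q (Ioo_subset_Icc_self hq)

end ControlData

/-! ### Existence and stability of trajectories -/

/-- The path `x₀` stopped at time `s`, plus the continuous function `G`. -/
def CadlagPath.stopAdd {T : ℝ} {d : ℕ} (hT : 0 ≤ T) (x₀ : CadlagPath T d) (s : ℝ)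
    (G : C(Icc (0 : ℝ) T, State d)) : CadlagPath T d where
  toFun t := x₀ (min t s) + IccExtend hT G t
  const_left t ht := by
    rw [x₀.const_left (min t s) ((min_le_left _ _).trans ht),
      x₀.const_left (min 0 s) (min_le_left _ _), IccExtend_of_le_left _ _ ht, IccExtend_left]
  const_right t ht := by
    rw [IccExtend_of_right_le _ _ ht, IccExtend_right]
    rcases le_total s T with h | h
    · rw [min_eq_right (h.trans ht), min_eq_right h]
    · rw [min_eq_left h, x₀.const_right (min t s) (le_min ht h)]
  right_cont t := by
    refine ContinuousWithinAt.add ?_ (G.continuous.Icc_extend' (h := hT)).continuousWithinAt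
    exact ContinuousWithinAt.comp (f := fun r => min r s) (x₀.right_cont (min t s))
      (by fun_prop) fun r hr => min_le_min_right s hr
  left_lim t := by
    have hG : Tendsto (IccExtend hT G) (𝓝[<] t) (𝓝 (IccExtend hT G t)) :=
      (G.continuous.Icc_extend' (h := hT)).continuousAt.mono_left nhdsWithin_le_nhds
    rcases le_or_gt t s with h | h
    · obtain ⟨l, hl⟩ := x₀.left_lim t
      refine ⟨l + IccExtend hT G t, (hl.congr' ?_).add hG⟩
      filter_upwards [self_mem_nhdsWithin] with r hr
      rw [min_eq_left (le_of_lt (lt_of_lt_of_le hr h))]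
    · refine ⟨x₀ s + IccExtend hT G t, (tendsto_const_nhds.congr' ?_).add hG⟩
      filter_upwards [nhdsWithin_le_nhds (lt_mem_nhds h)] with r hr
      rw [min_eq_right (le_of_lt hr)]

theorem CadlagPath.stopAdd_sub_stopAdd {T : ℝ} {d : ℕ} (hT : 0 ≤ T) (x₀ : CadlagPath T d) (s : ℝ)
    (G G' : C(Icc (0 : ℝ) T, State d)) {t : ℝ} (ht : t ∈ Icc 0 T) :
    stopAdd hT x₀ s G t - stopAdd hT x₀ s G' t = G ⟨t, ht⟩ - G' ⟨t, ht⟩ := by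
  simp only [stopAdd, add_sub_add_left_eq_sub]
  rw [IccExtend_of_mem hT _ ht, IccExtend_of_mem hT _ ht]

namespace ControlData

variable {T : ℝ} {d : ℕ} {A : Type*} [TopologicalSpace A]
  {D : ControlData T d A} {Cf Clam Lf : ℝ}

theorem Admissible.norm_integral_f_sub_le (hD : D.Admissible Cf Clam Lf) {α : ℝ → A} {a b : ℝ}
    (hab : a ≤ b) (ha : 0 ≤ a) (hb : b ≤ T) {φ ψ : CadlagPath T d} {B : ℝ → ℝ}
    (hB : IntervalIntegrable B volume a b)
    (h : ∀ r ∈ Ioo a b, φ.supDiff ψ r ≤ B r) :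
    ‖∫ r in a..b, (D.f r φ (α r) - D.f r ψ (α r))‖ ≤ Lf * ∫ r in a..b, B r := by
  rw [← intervalIntegral.integral_const_mul]
  refine intervalIntegral.norm_integral_le_of_norm_le hab ?_ (hB.const_mul Lf)
  filter_upwards [hD.lip, Measure.ae_ne volume b] with r hr hne hmem
  have hlt : r < b := lt_of_le_of_ne hmem.2 hne
  have h1 := hr ⟨ha.trans_lt hmem.1, hlt.trans_le hb⟩ φ ψ (α r)
  have h2 := abs_nonneg (D.ell r φ (α r) - D.ell r ψ (α r))
  have h3 := abs_nonneg (D.lam r φ (α r) - D.lam r ψ (α r))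
  have h4 := mul_le_mul_of_nonneg_left (h r ⟨hmem.1, hlt⟩) hD.Lf_nonneg
  linarith

variable [MeasurableSpace A] [BorelSpace A]

/-- Existence of trajectories, by contraction in the norm weighted with `exp (-κ t)`. -/
theorem exists_isTrajectory (hD : D.Admissible Cf Clam Lf) (hA : IsSigmaCompactMetrizable A)
    {α : ℝ → A} (hα : IsControl T α) {s : ℝ} (hs : s ∈ Icc 0 T) (x : CadlagPath T d) :
    ∃ φ, D.IsTrajectory s x α φ := by
  have hT : 0 ≤ T := hs.1.trans hs.2
  set κ := 2 * Lf + 1 with hκ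
  have hLf := hD.Lf_nonneg
  have hκ0 : 0 < κ := by positivity
  -- the path of a rescaled unknown `g`
  let W : C(Icc (0 : ℝ) T, State d) → C(Icc (0 : ℝ) T, State d) := fun g =>
    ⟨fun t => Real.exp (κ * t) • g t, by fun_prop⟩
  let P : C(Icc (0 : ℝ) T, State d) → CadlagPath T d := fun g => x.stopAdd hT s (W g)
  have hint : ∀ (φ : CadlagPath T d) {a b : ℝ}, a ∈ Icc 0 T → b ∈ Icc 0 T →
      IntervalIntegrable (fun r => D.f r φ (α r)) volume a b := fun φ _ _ ha hb =>
    hD.intervalIntegrable_f hA hα φ ha hb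
  have hmax : ∀ t : Icc (0 : ℝ) T, max s t ∈ Icc s T := fun t =>
    ⟨le_max_left _ _, max_le hs.2 t.2.2⟩
  have hcont : ∀ φ : CadlagPath T d,
      Continuous fun t : Icc (0 : ℝ) T => ∫ r in s..max s t, D.f r φ (α r) := by
    intro φ
    have h1 : ContinuousOn (fun t => ∫ r in s..t, D.f r φ (α r)) (uIcc s T) :=
      intervalIntegral.continuousOn_primitive_interval'
        (hint φ hs ⟨hT, le_rfl⟩) left_mem_uIcc
    rw [uIcc_of_le hs.2] at h1
    exact h1.comp_continuous (by fun_prop) hmax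
  let Ψ : C(Icc (0 : ℝ) T, State d) → C(Icc (0 : ℝ) T, State d) := fun g =>
    ⟨fun t => Real.exp (-(κ * t)) • ∫ r in s..max s t, D.f r (P g) (α r), by
      have := hcont (P g)
      fun_prop⟩
  have hΨ : ContractingWith (1 / 2) Ψ := by
    refine ⟨by
      rw [← NNReal.coe_lt_coe]; norm_num, LipschitzWith.of_dist_le_mul fun g g' => ?_⟩
    rw [ContinuousMap.dist_le (by positivity)]
    intro t
    have hm := hmax t
    have hm0 : max s (t : ℝ) ∈ Icc 0 T := ⟨hs.1.trans hm.1, hm.2⟩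
    have hsup : ∀ r ∈ Ioo s (max s (t : ℝ)),
        (P g).supDiff (P g') r ≤ dist g g' * Real.exp (κ * r) := by
      intro r hr
      refine CadlagPath.supDiff_le (by positivity) fun q hq => ?_
      have hqT : q ∈ Icc 0 T := ⟨hq.1, hq.2.trans (hr.2.le.trans hm.2)⟩
      rw [CadlagPath.stopAdd_sub_stopAdd hT x s _ _ hqT]
      simp only [W, ContinuousMap.coe_mk]
      rw [← smul_sub, norm_smul, Real.norm_of_nonneg (Real.exp_pos _).le, mul_comm]
      gcongr
      · rw [← dist_eq_norm]; exact ContinuousMap.dist_apply_le_dist _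
      · exact hq.2
    have h1 := hD.norm_integral_f_sub_le (α := α) hm.1 hs.1 hm.2
      (B := fun r => dist g g' * Real.exp (κ * r))
      (Continuous.intervalIntegrable (by fun_prop) _ _) hsup
    rw [intervalIntegral.integral_sub (hint _ hs hm0) (hint _ hs hm0)] at h1
    have h2 : ∫ r in s..max s (t : ℝ), dist g g' * Real.exp (κ * r) =
        dist g g' * ((Real.exp (κ * max s (t : ℝ)) - Real.exp (κ * s)) / κ) := by
      rw [intervalIntegral.integral_const_mul,
        intervalIntegral.integral_comp_mul_left (fun r => Real.exp r) hκ0.ne',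
        integral_exp, smul_eq_mul]
      ring
    rw [h2] at h1
    simp only [Ψ, ContinuousMap.coe_mk, dist_eq_norm (Real.exp _ • _)]
    rw [← smul_sub, norm_smul, Real.norm_of_nonneg (Real.exp_pos _).le]
    rcases le_total (t : ℝ) s with h | h
    · rw [max_eq_left h]
      simp
    · rw [max_eq_right h] at h1 ⊢
      have h3 : Lf / κ ≤ 1 / 2 := by rw [div_le_div_iff₀ hκ0 two_pos]; linarith
      have hd := dist_nonneg (x := g) (y := g')
      have hE : 0 < Real.exp (κ * s) := Real.exp_pos _
      calc _ ≤ Real.exp (-(κ * t)) *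
            (Lf * (dist g g' * ((Real.exp (κ * t) - Real.exp (κ * s)) / κ))) := by gcongr
        _ ≤ Real.exp (-(κ * t)) * (Lf * (dist g g' * (Real.exp (κ * t) / κ))) := by
            gcongr; linarith
        _ = (Lf / κ) * dist g g' * (Real.exp (-(κ * t)) * Real.exp (κ * t)) := by ring
        _ = (Lf / κ) * dist g g' := by rw [← Real.exp_add]; simp
        _ ≤ (1 / 2) * dist g g' := by gcongr
        _ = _ := by simp
  obtain ⟨g, hg⟩ : ∃ g, Ψ g = g := ⟨_, hΨ.fixedPoint_isFixedPt⟩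
  have hPg : ∀ t (ht : t ∈ Icc 0 T),
      P g t = x (min t s) + ∫ r in s..max s t, D.f r (P g) (α r) := by
    intro t ht
    have h1 : P g t = x (min t s) + Real.exp (κ * t) • g ⟨t, ht⟩ := by
      simp only [P, CadlagPath.stopAdd, W]
      rw [IccExtend_of_mem hT _ ht]
      rfl
    have h2 : g ⟨t, ht⟩ = Real.exp (-(κ * t)) • ∫ r in s..max s t, D.f r (P g) (α r) := by
      conv_lhs => rw [← hg]
      rfl
    rw [h1, h2, smul_smul, ← Real.exp_add]
    simp
  refine ⟨P g, isTrajectory_of_integral_eq hD hA hα hs (fun t ht => ?_) fun t ht => ?_⟩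
  · rw [hPg t ⟨ht.1, ht.2.trans hs.2⟩, min_eq_left ht.2, max_eq_left ht.2]
    simp
  · rw [hPg t ⟨hs.1.trans ht.1, ht.2⟩, min_eq_right ht.1, max_eq_right ht.1]

/-- A Lipschitz constant of the trajectories in the initial point, where `N` bounds the initial
paths. -/
def stabilityConst (T Cf Lf N : ℝ) : ℝ :=
  2 * (1 + Cf * growthBound T Cf N) * Real.exp ((2 * Lf + 1) * T)

theorem IsTrajectory.dist_le_of_le (hD : D.Admissible Cf Clam Lf) (hA : IsSigmaCompactMetrizable A)
    {α : ℝ → A} (hα : IsControl T α) {s s' N : ℝ} (hs : s ∈ Icc 0 T) (hs' : s' ∈ Icc 0 T)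
    (hss : s ≤ s') {x x' φ φ' : CadlagPath T d} (hx : x.supNorm s ≤ N)
    (hφ : D.IsTrajectory s x α φ) (hφ' : D.IsTrajectory s' x' α φ') :
    dist φ φ' ≤ stabilityConst T Cf Lf N * dist (⟨s, x⟩ : TimePath T d) ⟨s', x'⟩ := by
  have hCf := hD.Cf_nonneg
  have hN : 0 ≤ N := (x.supNorm_nonneg s).trans hx
  set δ := dist (⟨s, x⟩ : TimePath T d) ⟨s', x'⟩ with hδ
  have hδ0 : 0 ≤ δ := dist_nonneg
  have hδ' : δ = |s - s'| + CadlagPath.stopDist s x s' x' := rfl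
  set R := Cf * growthBound T Cf N with hR
  have hG := growthBound_pos (T := T) (L := Cf) hN
  have hR0 : 0 ≤ R := by positivity
  have hlip : φ ∈ lipPaths R s x := by
    obtain ⟨h1, h2⟩ := pathsX_subset_lipPaths hCf hs (hφ.mem_pathsX hD hs.1)
    refine ⟨h1, fun p hp q hq => (h2 p hp q hq).trans ?_⟩
    have := growthBound_mono (T := T) (L := Cf) hx
    rw [hR]
    gcongr
  have hstopped : ∀ q ∈ Icc 0 T, ‖x (min q s) - x' (min q s')‖ ≤ CadlagPath.stopDist s x s' x' :=
    fun q hq => CadlagPath.norm_sub_le_stopDist x x' s s' hq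
  -- up to time `s'` the trajectories differ by a multiple of the distance of the initial points
  have hinit : ∀ q ∈ Icc 0 s', ‖φ q - φ' q‖ ≤ (1 + R) * δ := by
    intro q hq
    have hqT : q ∈ Icc 0 T := ⟨hq.1, hq.2.trans hs'.2⟩
    have h1 := hstopped q hqT
    rw [min_eq_left hq.2] at h1
    rw [hφ'.1 hq]
    rcases le_total q s with h | h
    · rw [min_eq_left h] at h1
      rw [hφ.1 ⟨hq.1, h⟩]
      have := mul_nonneg hR0 hδ0
      have := abs_nonneg (s - s')
      linarith
    · rw [min_eq_right h] at h1
      have h2 := hlip.2 q ⟨h, hqT.2⟩ s ⟨le_rfl, hs.2⟩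
      rw [hφ.1 ⟨hs.1, le_rfl⟩] at h2
      have h3 : |q - s| ≤ δ := by
        rw [hδ', abs_of_nonneg (sub_nonneg.2 h), abs_sub_comm, abs_of_nonneg (sub_nonneg.2 hss)]
        have := CadlagPath.stopDist_nonneg s x s' x'
        linarith [hq.2]
      have h4 := norm_sub_le_norm_sub_add_norm_sub (φ q) (x s) (x' q)
      have h5 := mul_le_mul_of_nonneg_left h3 hR0
      have := abs_nonneg (s - s')
      linarith
  have hmono : MonotoneOn (φ.supDiff φ') (Icc s' T) := (CadlagPath.supDiff_mono φ φ').monotoneOn _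
  have hI : ∀ {q t}, s' ≤ q → q ≤ t → ∫ r in s'..q, φ.supDiff φ' r ≤ ∫ r in s'..t, φ.supDiff φ' r :=
    fun {q t} h1 h2 => intervalIntegral.integral_mono_interval le_rfl h1 h2
      (Eventually.of_forall fun r => CadlagPath.supDiff_nonneg _ _ _)
      (CadlagPath.supDiff_mono φ φ').intervalIntegrable
  have key : ∀ t ∈ Icc s' T, φ.supDiff φ' t ≤
      (1 + R) * δ + Lf * ∫ r in s'..t, φ.supDiff φ' r := by
    intro t ht
    have hI0 : 0 ≤ Lf * ∫ r in s'..t, φ.supDiff φ' r :=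
      mul_nonneg hD.Lf_nonneg (by simpa using hI le_rfl ht.1)
    refine CadlagPath.supDiff_le (by positivity) fun q hq => ?_
    rcases le_total q s' with h | h
    · linarith [hinit q ⟨hq.1, h⟩]
    · have hqT : q ∈ Icc s' T := ⟨h, hq.2.trans ht.2⟩
      have hq0 : q ∈ Icc 0 T := ⟨hq.1, hqT.2⟩
      have h1 := hφ.integral_eq hD hs (a := s') (b := q) ⟨hss, hs'.2⟩ ⟨hss.trans h, hqT.2⟩
      have h2 := hφ'.integral_eq hD hs' (a := s') (b := q) ⟨le_rfl, hs'.2⟩ hqT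
      have h3 := hD.norm_integral_f_sub_le (α := α) (φ := φ) (ψ := φ') h hs'.1 hqT.2
        (CadlagPath.supDiff_mono φ φ').intervalIntegrable fun r _ => le_rfl
      rw [intervalIntegral.integral_sub (hD.intervalIntegrable_f hA hα _ hs' hq0)
        (hD.intervalIntegrable_f hA hα _ hs' hq0), h1, h2] at h3
      have h4 := mul_le_mul_of_nonneg_left (hI h hq.2) hD.Lf_nonneg
      have h5 := hinit s' ⟨hs'.1, le_rfl⟩
      have h6 : φ q - φ' q = (φ s' - φ' s') + (φ q - φ s' - (φ' q - φ' s')) := by abel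
      rw [h6]
      exact (norm_add_le _ _).trans (by linarith)
  have h1 := hmono.le_two_mul_exp_of_le_add_integral (by positivity) hD.Lf_nonneg key
    ⟨hs'.2, le_rfl⟩
  have hLf := hD.Lf_nonneg
  calc dist φ φ' ≤ 2 * ((1 + R) * δ) * Real.exp ((2 * Lf + 1) * (T - s')) := h1
    _ ≤ 2 * ((1 + R) * δ) * Real.exp ((2 * Lf + 1) * T) := by gcongr; linarith [hs'.1]
    _ = _ := by rw [stabilityConst]; ring

/-- Trajectories of the same control depend in a Lipschitz way on the initial point. -/
theorem IsTrajectory.dist_le (hD : D.Admissible Cf Clam Lf) (hA : IsSigmaCompactMetrizable A)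
    {α : ℝ → A} (hα : IsControl T α) {s s' N : ℝ} (hs : s ∈ Icc 0 T) (hs' : s' ∈ Icc 0 T)
    {x x' φ φ' : CadlagPath T d} (hx : x.supNorm s ≤ N) (hx' : x'.supNorm s' ≤ N)
    (hφ : D.IsTrajectory s x α φ) (hφ' : D.IsTrajectory s' x' α φ') :
    dist φ φ' ≤ stabilityConst T Cf Lf N * dist (⟨s, x⟩ : TimePath T d) ⟨s', x'⟩ := by
  rcases le_total s s' with h | h
  · exact hφ.dist_le_of_le hD hA hα hs hs' h hx hφ'
  · rw [dist_comm, dist_comm (⟨s, x⟩ : TimePath T d)]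
    exact hφ'.dist_le_of_le hD hA hα hs' hs h hx' hφ

end ControlData

/-! ### Compactness of Lipschitz continuations -/

/-- The Lipschitz continuations of a path lie in a compact set, although `Ω` is not even
separable: by Arzelà–Ascoli, because the path before time `s` is prescribed. -/
theorem exists_isCompact_lipPaths_subset {T : ℝ} {d : ℕ} {R s : ℝ} (hR : 0 ≤ R)
    (hs : s ∈ Icc 0 T) (x : CadlagPath T d) :
    ∃ 𝒦 : Set (CadlagPath T d), IsCompact 𝒦 ∧ lipPaths R s x ⊆ 𝒦 := by
  have hT : 0 ≤ T := hs.1.trans hs.2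
  let 𝒢 : Set C(Icc (0 : ℝ) T, State d) :=
    {G | (∀ t, G t ∈ Metric.closedBall (0 : State d) (R * T)) ∧
      ∀ t t', ‖G t - G t'‖ ≤ R * |(t : ℝ) - t'|}
  have h𝒢 : IsCompact 𝒢 := by
    have hlip : ∀ f : Icc (0 : ℝ) T → State d, (∀ t t', ‖f t - f t'‖ ≤ R * |(t : ℝ) - t'|) →
        LipschitzWith R.toNNReal f := fun f hf => LipschitzWith.of_dist_le_mul fun t t' => by
      rw [dist_eq_norm, Subtype.dist_eq, Real.dist_eq, Real.coe_toNNReal R hR]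
      exact hf t t'
    refine ArzelaAscoli.isCompact_of_equicontinuous 𝒢 ?_ ?_
    · have : ContinuousMap.toFun '' 𝒢 =
          (univ.pi fun _ => Metric.closedBall (0 : State d) (R * T)) ∩
          ⋂ t : Icc (0 : ℝ) T, ⋂ t' : Icc (0 : ℝ) T, {f | ‖f t - f t'‖ ≤ R * |(t : ℝ) - t'|} := by
        ext f
        simp only [mem_image, mem_inter_iff, mem_univ_pi, mem_iInter, mem_ofPred_eq]
        constructor
        · rintro ⟨G, ⟨h1, h2⟩, rfl⟩
          exact ⟨h1, h2⟩
        · rintro ⟨h1, h2⟩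
          exact ⟨⟨f, (hlip f h2).continuous⟩, ⟨h1, h2⟩, rfl⟩
      rw [this]
      refine (isCompact_univ_pi fun _ => isCompact_closedBall _ _).inter_right ?_
      exact isClosed_iInter fun t => isClosed_iInter fun t' =>
        isClosed_le (by fun_prop) continuous_const
    · refine (LipschitzWith.uniformEquicontinuous _ R.toNNReal fun G => ?_).equicontinuous
      exact hlip _ G.2.2
  have hcont : Continuous (x.stopAdd hT s) := by
    refine (LipschitzWith.of_dist_le_mul (K := 1) fun G G' => ?_).continuous
    rw [NNReal.coe_one, one_mul]
    refine CadlagPath.dist_le_of_forall dist_nonneg fun r hr => ?_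
    rw [CadlagPath.stopAdd_sub_stopAdd hT x s G G' hr, ← dist_eq_norm]
    exact ContinuousMap.dist_apply_le_dist _
  refine ⟨_, h𝒢.image hcont, fun φ hφ => ?_⟩
  have hG : ∀ t ∈ Icc 0 T, ∀ t' ∈ Icc 0 T,
      ‖(φ (max t s) - x s) - (φ (max t' s) - x s)‖ ≤ R * |t - t'| := by
    intro t ht t' ht'
    rw [sub_sub_sub_cancel_right]
    refine (hφ.2 _ ⟨le_max_right _ _, max_le ht.2 hs.2⟩ _
      ⟨le_max_right _ _, max_le ht'.2 hs.2⟩).trans (mul_le_mul_of_nonneg_left ?_ hR)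
    exact (abs_max_sub_max_le_max t s t' s).trans (max_le le_rfl (by simp))
  have hlipG : LipschitzWith R.toNNReal fun t : Icc (0 : ℝ) T => φ (max (t : ℝ) s) - x s :=
    LipschitzWith.of_dist_le_mul fun t t' => by
      rw [dist_eq_norm, Subtype.dist_eq, Real.dist_eq, Real.coe_toNNReal R hR]
      exact hG t t.2 t' t'.2
  refine ⟨⟨_, hlipG.continuous⟩, ⟨fun t => ?_, fun t t' => hG t t.2 t' t'.2⟩, ?_⟩
  · rw [mem_closedBall_zero_iff]
    have h1 := hG t t.2 0 ⟨le_rfl, hT⟩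
    rw [max_eq_right hs.1, hφ.1 ⟨hs.1, le_rfl⟩, sub_self, sub_zero, sub_zero,
      abs_of_nonneg t.2.1] at h1
    exact h1.trans (mul_le_mul_of_nonneg_left t.2.2 hR)
  · refine CadlagPath.eq_of_eqOn hT fun t ht => ?_
    simp only [CadlagPath.stopAdd]
    rw [IccExtend_of_mem hT _ ht]
    simp only [ContinuousMap.coe_mk]
    rcases le_total t s with h | h
    · rw [min_eq_left h, max_eq_right h, hφ.1 ⟨hs.1, le_rfl⟩, hφ.1 ⟨ht.1, h⟩]
      simp
    · rw [min_eq_right h, max_eq_left h]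
      simp

/-! ### The discount factor and the cost -/

theorem Real.abs_exp_neg_sub_exp_neg_le {a b : ℝ} (ha : 0 ≤ a) (hb : 0 ≤ b) :
    |Real.exp (-a) - Real.exp (-b)| ≤ |a - b| := by
  wlog h : a ≤ b generalizing a b
  · rw [abs_sub_comm, abs_sub_comm a]
    exact this hb ha (le_of_not_ge h)
  have h1 : Real.exp (-b) = Real.exp (-a) * Real.exp (-(b - a)) := by
    rw [← Real.exp_add]; ring_nf
  have h2 := Real.add_one_le_exp (-(b - a))
  have h3 : Real.exp (-a) ≤ 1 := Real.exp_le_one_iff.2 (by linarith)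
  have h4 : Real.exp (-(b - a)) ≤ 1 := Real.exp_le_one_iff.2 (by linarith)
  have h5 := Real.exp_pos (-a)
  rw [abs_sub_comm a, abs_of_nonneg (sub_nonneg.2 h), h1, abs_of_nonneg (by nlinarith)]
  nlinarith

/-- Comparison of integrals of two functions over intervals with a common right end. -/
theorem intervalIntegral.abs_integral_sub_integral_le {F G : ℝ → ℝ} {s s' b B η : ℝ}
    (hs : s ≤ b) (hs' : s' ≤ b) (hη : 0 ≤ η)
    (hF : IntervalIntegrable F volume s b) (hG : IntervalIntegrable G volume s' b)
    (hFB : ∀ᵐ t, t ∈ Ioo s b → |F t| ≤ B) (hGB : ∀ᵐ t, t ∈ Ioo s' b → |G t| ≤ B)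
    (hFG : ∀ᵐ t, t ∈ Ioo (max s s') b → |F t - G t| ≤ η) :
    |(∫ t in s..b, F t) - ∫ t in s'..b, G t| ≤ B * |s - s'| + η * (b - min s s') := by
  wlog h : s ≤ s' generalizing s s' F G
  · rw [abs_sub_comm, abs_sub_comm s, min_comm]
    refine this hs' hs hG hF hGB hFB ?_ (le_of_not_ge h)
    rw [max_comm]
    filter_upwards [hFG] with t ht hmem
    rw [abs_sub_comm]
    exact ht hmem
  rw [max_eq_right h] at hFG
  have h1 : IntervalIntegrable F volume s s' := hF.mono_set (by
    rw [uIcc_of_le h, uIcc_of_le hs]; exact Icc_subset_Icc_right hs')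
  have h2 : IntervalIntegrable F volume s' b := hF.mono_set (by
    rw [uIcc_of_le hs', uIcc_of_le hs]; exact Icc_subset_Icc_left h)
  rw [← intervalIntegral.integral_add_adjacent_intervals h1 h2, add_sub_assoc,
    ← intervalIntegral.integral_sub h2 hG]
  refine (abs_add_le _ _).trans (add_le_add ?_ ?_)
  · rw [abs_sub_comm s, ← Real.norm_eq_abs]
    refine intervalIntegral.norm_integral_le_of_norm_le_const_ae ?_
    filter_upwards [hFB, ControlData.ae_mem_Ioo_of_mem_uIoc (s := s) (T := b) ⟨le_rfl, hs⟩ ⟨h, hs'⟩]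
      with t e1 e2 e3 using e1 (e2 e3)
  · have h3 : |∫ t in s'..b, F t - G t| ≤ η * |b - s'| := by
      rw [← Real.norm_eq_abs]
      refine intervalIntegral.norm_integral_le_of_norm_le_const_ae ?_
      filter_upwards [hFG, ControlData.ae_mem_Ioo_of_mem_uIoc (s := s') (T := b) ⟨le_rfl, hs'⟩
        ⟨hs', le_rfl⟩] with t e1 e2 e3 using e1 (e2 e3)
    refine h3.trans ?_
    rw [abs_of_nonneg (sub_nonneg.2 hs'), min_eq_left h]
    gcongr

namespace ControlData

variable {T : ℝ} {d : ℕ} {A : Type*} {D : ControlData T d A} {Cf Clam Lf : ℝ}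
  {α : ℝ → A} {s t : ℝ} {x φ : CadlagPath T d}

theorem discount_pos (D : ControlData T d A) (s : ℝ) (α : ℝ → A) (φ : CadlagPath T d) (t : ℝ) :
    0 < D.discount s α φ t := Real.exp_pos _

theorem discount_congr {α' : ℝ → A} {φ' : CadlagPath T d} (hst : s ≤ t)
    (h : ∀ᵐ r : ℝ, r ∈ Ioo s t → D.lam r φ (α r) = D.lam r φ' (α' r)) :
    D.discount s α φ t = D.discount s α' φ' t := by
  rw [discount, discount]
  congr 2
  refine intervalIntegral.integral_congr_ae ?_
  filter_upwards [h, ae_mem_Ioo_of_mem_uIoc (s := s) (T := t) ⟨le_rfl, hst⟩ ⟨hst, le_rfl⟩]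
    with r h1 h2 h3 using h1 (h2 h3)

theorem integral_discount_mul_congr {α' : ℝ → A} {φ' : CadlagPath T d} (hst : s ≤ t)
    (h : ∀ᵐ r : ℝ, r ∈ Ioo s t →
      D.lam r φ (α r) = D.lam r φ' (α' r) ∧ D.ell r φ (α r) = D.ell r φ' (α' r)) :
    ∫ r in s..t, D.discount s α φ r * D.ell r φ (α r) =
      ∫ r in s..t, D.discount s α' φ' r * D.ell r φ' (α' r) := by
  refine intervalIntegral.integral_congr_ae ?_
  filter_upwards [h, ae_mem_Ioo_of_mem_uIoc (s := s) (T := t) ⟨le_rfl, hst⟩ ⟨hst, le_rfl⟩]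
    with r h1 h2 h3
  rw [(h1 (h2 h3)).2, discount_congr (h2 h3).1.le (φ' := φ') (α' := α')]
  filter_upwards [h] with q hq hmem using (hq ⟨hmem.1, hmem.2.trans (h2 h3).2⟩).1

variable [TopologicalSpace A]

theorem Admissible.integral_lam_nonneg (hD : D.Admissible Cf Clam Lf) (hs : 0 ≤ s)
    (ht : t ∈ Icc s T) : 0 ≤ ∫ r in s..t, D.lam r φ (α r) :=
  intervalIntegral.integral_nonneg ht.1 fun _ hr =>
    hD.lam_nonneg _ ⟨hs.trans hr.1, hr.2.trans ht.2⟩ _ _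

theorem Admissible.integral_lam_le (hD : D.Admissible Cf Clam Lf) (hs : 0 ≤ s)
    (ht : t ∈ Icc s T) : ∫ r in s..t, D.lam r φ (α r) ≤ Clam * (t - s) := by
  have h : |∫ r in s..t, D.lam r φ (α r)| ≤ Clam * |t - s| := by
    rw [← Real.norm_eq_abs]
    refine intervalIntegral.norm_integral_le_of_norm_le_const_ae ?_
    filter_upwards [hD.growth,
      ae_mem_Ioo_of_mem_uIoc (s := s) (T := T) ⟨le_rfl, ht.1.trans ht.2⟩ ht]
      with r h1 h2 h3
    exact (h1 ⟨hs.trans_lt (h2 h3).1, (h2 h3).2⟩ φ _).2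
  rw [abs_of_nonneg (sub_nonneg.2 ht.1)] at h
  exact (le_abs_self _).trans h

theorem Admissible.discount_le_one (hD : D.Admissible Cf Clam Lf) (hs : 0 ≤ s)
    (ht : t ∈ Icc s T) : D.discount s α φ t ≤ 1 :=
  Real.exp_le_one_iff.2 (neg_nonpos.2 (hD.integral_lam_nonneg hs ht))

variable [MeasurableSpace A] [BorelSpace A]

theorem Admissible.discount_mul (hD : D.Admissible Cf Clam Lf) (hA : IsSigmaCompactMetrizable A)
    (hα : IsControl T α) {r : ℝ} (hs : s ∈ Icc 0 T) (ht : t ∈ Icc 0 T) (hr : r ∈ Icc 0 T) :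
    D.discount s α φ t * D.discount t α φ r = D.discount s α φ r := by
  rw [discount, discount, discount, ← Real.exp_add, ← neg_add,
    intervalIntegral.integral_add_adjacent_intervals (hD.intervalIntegrable_lam hA hα φ hs ht)
      (hD.intervalIntegrable_lam hA hα φ ht hr)]

theorem Admissible.continuousOn_discount (hD : D.Admissible Cf Clam Lf)
    (hA : IsSigmaCompactMetrizable A) (hα : IsControl T α) (hs : s ∈ Icc 0 T) :
    ContinuousOn (D.discount s α φ) (Icc 0 T) := by
  have hT : 0 ≤ T := hs.1.trans hs.2
  have h := intervalIntegral.continuousOn_primitive_interval' (a := s)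
    (hD.intervalIntegrable_lam hA hα φ ⟨le_rfl, hT⟩ ⟨hT, le_rfl⟩) (by rwa [uIcc_of_le hT])
  rw [uIcc_of_le hT] at h
  exact h.neg.rexp

theorem Admissible.intervalIntegrable_discount_mul (hD : D.Admissible Cf Clam Lf)
    (hA : IsSigmaCompactMetrizable A) (hα : IsControl T α) (hs : s ∈ Icc 0 T) {a b : ℝ}
    (ha : a ∈ Icc 0 T) (hb : b ∈ Icc 0 T) :
    IntervalIntegrable (fun r => D.discount s α φ r * D.ell r φ (α r)) volume a b :=
  (hD.intervalIntegrable_ell hA hα φ ha hb).continuousOn_mul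
    ((hD.continuousOn_discount hA hα hs).mono (ordConnected_Icc.uIcc_subset ha hb))

theorem Admissible.cost_eq_add (hD : D.Admissible Cf Clam Lf) (hA : IsSigmaCompactMetrizable A)
    (hα : IsControl T α) (hs : s ∈ Icc 0 T) (ht : t ∈ Icc 0 T) :
    D.cost s α φ = (∫ r in s..t, D.discount s α φ r * D.ell r φ (α r))
      + D.discount s α φ t * D.cost t α φ := by
  have hT : T ∈ Icc 0 T := ⟨hs.1.trans hs.2, le_rfl⟩
  rw [cost, ← intervalIntegral.integral_add_adjacent_intervals
    (hD.intervalIntegrable_discount_mul hA hα hs hs ht)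
    (hD.intervalIntegrable_discount_mul hA hα hs ht hT), cost, mul_add, ← mul_assoc,
    hD.discount_mul hA hα hs ht hT, ← intervalIntegral.integral_const_mul, add_assoc]
  congr 2
  refine intervalIntegral.integral_congr fun r hr => ?_
  rw [← mul_assoc, hD.discount_mul hA hα hs ht (ordConnected_Icc.uIcc_subset ht hT hr)]

end ControlData

/-! ### The value function -/

namespace ControlData

variable {T : ℝ} {d : ℕ} {A : Type*} [TopologicalSpace A] {D : ControlData T d A}
  {Cf Clam Lf : ℝ} {α : ℝ → A} {s t : ℝ} {x φ : CadlagPath T d}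

theorem IsTrajectory.ae_abs_ell_le (hD : D.Admissible Cf Clam Lf) (hs : s ∈ Icc 0 T) {N : ℝ}
    (hx : x.supNorm s ≤ N) (hφ : D.IsTrajectory s x α φ) :
    ∀ᵐ r : ℝ, r ∈ Ioo 0 T → |D.ell r φ (α r)| ≤ Cf * growthBound T Cf N := by
  filter_upwards [hD.abs_ell_le] with r hr hmem
  exact (hr hmem φ _).trans (hD.one_add_supNorm_mono hmem
    ((one_add_supNorm_le_growthBound hD.Cf_nonneg hs (hφ.mem_pathsX hD hs.1)).trans
      (growthBound_mono hx)))

theorem IsTrajectory.ae_abs_discount_mul_le (hD : D.Admissible Cf Clam Lf) (hs : s ∈ Icc 0 T)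
    {N : ℝ} (hx : x.supNorm s ≤ N) (hφ : D.IsTrajectory s x α φ) :
    ∀ᵐ r : ℝ, r ∈ Ioo s T →
      |D.discount s α φ r * D.ell r φ (α r)| ≤ Cf * growthBound T Cf N := by
  filter_upwards [hφ.ae_abs_ell_le hD hs hx] with r hr hmem
  have h1 := hr ⟨hs.1.trans_lt hmem.1, hmem.2⟩
  rw [abs_mul, abs_of_pos (D.discount_pos s α φ r)]
  exact (mul_le_of_le_one_left (abs_nonneg _)
    (hD.discount_le_one hs.1 ⟨hmem.1.le, hmem.2.le⟩)).trans h1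

theorem Admissible.exists_abs_cost_le (hD : D.Admissible Cf Clam Lf) (hs : s ∈ Icc 0 T)
    (x : CadlagPath T d) :
    ∃ B, ∀ (α : ℝ → A) (φ : CadlagPath T d), D.IsTrajectory s x α φ → |D.cost s α φ| ≤ B := by
  have hN := x.supNorm_nonneg s
  have hG := growthBound_pos (T := T) (L := Cf) hN
  have hCf := hD.Cf_nonneg
  obtain ⟨𝒦, h𝒦, hsub⟩ := exists_isCompact_lipPaths_subset
    (R := Cf * growthBound T Cf (x.supNorm s)) (by positivity) hs x
  obtain ⟨Bh, hBh⟩ := h𝒦.exists_bound_of_continuousOn hD.cont_h.continuousOn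
  refine ⟨Cf * growthBound T Cf (x.supNorm s) * |T - s| + Bh, fun α φ hφ => ?_⟩
  rw [cost]
  refine (abs_add_le _ _).trans (add_le_add ?_ ?_)
  · rw [← Real.norm_eq_abs]
    refine intervalIntegral.norm_integral_le_of_norm_le_const_ae ?_
    filter_upwards [hφ.ae_abs_discount_mul_le hD hs le_rfl,
      ae_mem_Ioo_of_mem_uIoc (s := s) (T := T) ⟨le_rfl, hs.2⟩ ⟨hs.2, le_rfl⟩] with r h1 h2 h3
    exact h1 (h2 h3)
  · rw [abs_mul, abs_of_pos (D.discount_pos s α φ T)]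
    exact (mul_le_of_le_one_left (abs_nonneg _) (hD.discount_le_one hs.1 ⟨hs.2, le_rfl⟩)).trans
      (hBh φ (hsub (pathsX_subset_lipPaths hCf hs (hφ.mem_pathsX hD hs.1))))

variable [MeasurableSpace A]

theorem value_le_cost (hD : D.Admissible Cf Clam Lf) (hs : s ∈ Icc 0 T) (hα : IsControl T α)
    (hφ : D.IsTrajectory s x α φ) : D.value ⟨s, x⟩ ≤ D.cost s α φ := by
  obtain ⟨B, hB⟩ := hD.exists_abs_cost_le hs x
  refine csInf_le ⟨-B, ?_⟩ ⟨α, φ, hα, hφ, rfl⟩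
  rintro _ ⟨α', φ', -, hφ', rfl⟩
  exact (abs_le.1 (hB α' φ' hφ')).1

variable [BorelSpace A]

theorem exists_cost_lt_value_add [Nonempty A] (hD : D.Admissible Cf Clam Lf)
    (hA : IsSigmaCompactMetrizable A) (hs : s ∈ Icc 0 T) (x : CadlagPath T d) {ε : ℝ}
    (hε : 0 < ε) : ∃ α φ, IsControl T α ∧ D.IsTrajectory s x α φ ∧
      D.cost s α φ < D.value ⟨s, x⟩ + ε := by
  have hne : {c | ∃ (α : ℝ → A) (φ : CadlagPath T d), Measurable (fun t : Icc (0 : ℝ) T => α t) ∧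
      D.IsTrajectory s x α φ ∧ c = D.cost s α φ}.Nonempty := by
    have hα : IsControl T fun _ : ℝ => Classical.arbitrary A := measurable_const
    obtain ⟨φ, hφ⟩ := exists_isTrajectory hD hA hα hs x
    exact ⟨_, fun _ => Classical.arbitrary A, φ, hα, hφ, rfl⟩
  obtain ⟨_, ⟨α, φ, h1, h2, rfl⟩, h3⟩ := exists_lt_of_csInf_lt hne (lt_add_of_pos_right _ hε)
  exact ⟨α, φ, h1, h2, h3⟩

/-- Dynamic programming: near-optimal controls remain near-optimal along their trajectories. -/
theorem exists_integral_add_value_lt [Nonempty A] (hD : D.Admissible Cf Clam Lf)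
    (hA : IsSigmaCompactMetrizable A) (hs : s ∈ Icc 0 T) (x : CadlagPath T d) {ε : ℝ}
    (hε : 0 < ε) : ∃ α φ, IsControl T α ∧ D.IsTrajectory s x α φ ∧ ∀ t ∈ Icc s T,
      (∫ r in s..t, D.discount s α φ r * D.ell r φ (α r))
        + D.discount s α φ t * D.value ⟨t, φ⟩ < D.value ⟨s, x⟩ + ε := by
  obtain ⟨α, φ, hα, hφ, h⟩ := exists_cost_lt_value_add hD hA hs x hε
  refine ⟨α, φ, hα, hφ, fun t ht => ?_⟩
  have ht0 : t ∈ Icc 0 T := ⟨hs.1.trans ht.1, ht.2⟩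
  rw [hD.cost_eq_add hA hα hs ht0] at h
  have h1 := mul_le_mul_of_nonneg_left (value_le_cost hD ht0 hα (hφ.restrict ht))
    (D.discount_pos s α φ t).le
  linarith

/-- Dynamic programming: following any control and then an optimal one is not better than the
value. -/
theorem value_le_integral_add_value [Nonempty A] (hD : D.Admissible Cf Clam Lf)
    (hA : IsSigmaCompactMetrizable A) (hs : s ∈ Icc 0 T) (hα : IsControl T α)
    (hφ : D.IsTrajectory s x α φ) (ht : t ∈ Icc s T) :
    D.value ⟨s, x⟩ ≤ (∫ r in s..t, D.discount s α φ r * D.ell r φ (α r))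
      + D.discount s α φ t * D.value ⟨t, φ⟩ := by
  have ht0 : t ∈ Icc 0 T := ⟨hs.1.trans ht.1, ht.2⟩
  refine le_of_forall_pos_le_add fun ε hε => ?_
  obtain ⟨α', φ', hα', hφ', h⟩ := exists_cost_lt_value_add hD hA ht0 φ hε
  have hβ := hα.concat hα' t
  have hφ'' := hφ.concat hD hs.1 ht hφ'
  set β : ℝ → A := fun r => if r < t then α r else α' r with hβdef
  have h1 : ∀ᵐ r : ℝ, r ∈ Ioo s t →
      D.lam r φ' (β r) = D.lam r φ (α r) ∧ D.ell r φ' (β r) = D.ell r φ (α r) := by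
    filter_upwards [hD.causal] with r hr hmem
    have hβr : β r = α r := by simp [hβdef, hmem.2]
    rw [hβr]
    exact (hr ⟨hs.1.trans_lt hmem.1, hmem.2.trans_le ht.2⟩ φ' φ
      (hφ'.1.mono (Icc_subset_Icc_right hmem.2.le)) _).2
  have h2 : D.cost t β φ' = D.cost t α' φ' := by
    have h3 : ∀ᵐ r : ℝ, r ∈ Ioo t T →
        D.lam r φ' (β r) = D.lam r φ' (α' r) ∧ D.ell r φ' (β r) = D.ell r φ' (α' r) :=
      Eventually.of_forall fun r hr => by simp [hβdef, not_lt.2 hr.1.le]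
    rw [cost, cost, integral_discount_mul_congr ht.2 h3,
      discount_congr ht.2 (h3.mono fun r hr hm => (hr hm).1)]
  have h4 := value_le_cost hD hs hβ hφ''
  rw [hD.cost_eq_add hA hβ hs ht0, integral_discount_mul_congr ht.1 h1,
    discount_congr ht.1 (h1.mono fun r hr hm => (hr hm).1), h2] at h4
  have hχ := D.discount_pos s α φ t
  have hχ1 := hD.discount_le_one (φ := φ) (α := α) hs.1 ht
  have h5 := mul_le_mul_of_nonneg_left h.le hχ.le
  have h6 := mul_le_of_le_one_left hε.le hχ1
  rw [mul_add] at h5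
  linarith

/-! ### Continuity of the value function -/

theorem _root_.TimePath.supNorm_le_add_dist (hs : s ∈ Icc 0 T) {s' : ℝ} (hs' : s' ∈ Icc 0 T)
    (x x' : CadlagPath T d) :
    x'.supNorm s' ≤ x.supNorm s + dist (⟨s, x⟩ : TimePath T d) ⟨s', x'⟩ := by
  refine CadlagPath.supNorm_le (add_nonneg (x.supNorm_nonneg s) dist_nonneg) fun r hr => ?_
  have h1 := CadlagPath.norm_sub_le_stopDist x x' s s' (r := r) ⟨hr.1, hr.2.trans hs'.2⟩
  rw [min_eq_left hr.2] at h1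
  have h2 := x.norm_le_supNorm (s := min r s) (t := s) ⟨le_min hr.1 hs.1, min_le_right _ _⟩
  have h3 : CadlagPath.stopDist s x s' x' ≤ dist (⟨s, x⟩ : TimePath T d) ⟨s', x'⟩ :=
    le_add_of_nonneg_left (abs_nonneg _)
  have h4 := norm_sub_norm_le (x' r) (x (min r s))
  rw [norm_sub_rev] at h4
  linarith

/-- The costs of the trajectories of one control from two initial points. -/
theorem IsTrajectory.abs_cost_sub_cost_le (hD : D.Admissible Cf Clam Lf)
    (hA : IsSigmaCompactMetrizable A) (hα : IsControl T α) {s' N Bh : ℝ} (hs : s ∈ Icc 0 T)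
    (hs' : s' ∈ Icc 0 T) {x' φ' : CadlagPath T d} (hx : x.supNorm s ≤ N) (hx' : x'.supNorm s' ≤ N)
    (hφ : D.IsTrajectory s x α φ) (hφ' : D.IsTrajectory s' x' α φ') (hBh : |D.h φ| ≤ Bh) :
    |D.cost s α φ - D.cost s' α φ'| ≤
      (Cf * growthBound T Cf N + ((Clam + Lf * stabilityConst T Cf Lf N * T) *
        (Cf * growthBound T Cf N) + Lf * stabilityConst T Cf Lf N) * T
        + (Clam + Lf * stabilityConst T Cf Lf N * T) * Bh)
        * dist (⟨s, x⟩ : TimePath T d) ⟨s', x'⟩ + |D.h φ - D.h φ'| := by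
  have hT0 : 0 ≤ T := hs.1.trans hs.2
  have hT : T ∈ Icc 0 T := ⟨hT0, le_rfl⟩
  have hLf := hD.Lf_nonneg
  have hN : 0 ≤ N := (x.supNorm_nonneg s).trans hx
  have hCf := hD.Cf_nonneg
  have hClam := hD.Clam_nonneg
  have hG := growthBound_pos (T := T) (L := Cf) hN
  set B := Cf * growthBound T Cf N with hB
  have hB0 : 0 ≤ B := by positivity
  have hdist := hφ.dist_le hD hA hα hs hs' hx hx' hφ'
  set c := stabilityConst T Cf Lf N with hc
  have hc0 : 0 ≤ c := by rw [hc, stabilityConst]; positivity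
  set δ := dist (⟨s, x⟩ : TimePath T d) ⟨s', x'⟩ with hδ
  have hδ0 : 0 ≤ δ := dist_nonneg
  have hss : |s - s'| ≤ δ := le_add_of_nonneg_right (CadlagPath.stopDist_nonneg s x s' x')
  have hdata : ∀ᵐ r : ℝ, r ∈ Ioo 0 T → |D.lam r φ (α r) - D.lam r φ' (α r)| ≤ Lf * c * δ ∧
      |D.ell r φ (α r) - D.ell r φ' (α r)| ≤ Lf * c * δ := by
    filter_upwards [hD.lip] with r hr hmem
    have h1 := hr hmem φ φ' (α r)
    have h2 : Lf * φ.supDiff φ' r ≤ Lf * c * δ := by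
      rw [mul_assoc]
      exact mul_le_mul_of_nonneg_left ((CadlagPath.supDiff_mono φ φ' hmem.2.le).trans hdist) hLf
    have h3 := norm_nonneg (D.f r φ (α r) - D.f r φ' (α r))
    have h4 := abs_nonneg (D.ell r φ (α r) - D.ell r φ' (α r))
    have h5 := abs_nonneg (D.lam r φ (α r) - D.lam r φ' (α r))
    constructor <;> linarith
  set η := (Clam + Lf * c * T) * δ with hη
  have hη0 : 0 ≤ η := by positivity
  -- the discount factors
  have hdisc : ∀ r ∈ Icc (max s s') T, |D.discount s α φ r - D.discount s' α φ' r| ≤ η := by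
    intro r hr
    have hrs : r ∈ Icc s T := ⟨(le_max_left _ _).trans hr.1, hr.2⟩
    have hrs' : r ∈ Icc s' T := ⟨(le_max_right _ _).trans hr.1, hr.2⟩
    have hr0 : r ∈ Icc 0 T := ⟨hs.1.trans hrs.1, hr.2⟩
    refine (Real.abs_exp_neg_sub_exp_neg_le (hD.integral_lam_nonneg hs.1 hrs)
      (hD.integral_lam_nonneg hs'.1 hrs')).trans ?_
    refine (intervalIntegral.abs_integral_sub_integral_le (B := Clam) (η := Lf * c * δ) hrs.1
      hrs'.1 (by positivity) (hD.intervalIntegrable_lam hA hα φ hs hr0)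
      (hD.intervalIntegrable_lam hA hα φ' hs' hr0) ?_ ?_ ?_).trans ?_
    · filter_upwards [hD.growth] with q hq hmem
      exact (hq ⟨hs.1.trans_lt hmem.1, hmem.2.trans_le hr.2⟩ _ _).2
    · filter_upwards [hD.growth] with q hq hmem
      exact (hq ⟨hs'.1.trans_lt hmem.1, hmem.2.trans_le hr.2⟩ _ _).2
    · filter_upwards [hdata] with q hq hmem
      exact (hq ⟨hs.1.trans_lt ((le_max_left _ _).trans_lt hmem.1), hmem.2.trans_le hr.2⟩).1
    · have h1 : r - min s s' ≤ T := by
        have := le_min hs.1 hs'.1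
        linarith [hr.2]
      calc Clam * |s - s'| + Lf * c * δ * (r - min s s')
          ≤ Clam * δ + Lf * c * δ * T := by gcongr
        _ = η := by rw [hη]; ring
  have hrun : |(∫ r in s..T, D.discount s α φ r * D.ell r φ (α r)) -
      ∫ r in s'..T, D.discount s' α φ' r * D.ell r φ' (α r)| ≤
      B * |s - s'| + (η * B + Lf * c * δ) * (T - min s s') := by
    refine intervalIntegral.abs_integral_sub_integral_le hs.2 hs'.2 (by positivity)
      (hD.intervalIntegrable_discount_mul hA hα hs hs hT)
      (hD.intervalIntegrable_discount_mul hA hα hs' hs' hT)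
      (hφ.ae_abs_discount_mul_le hD hs hx) (hφ'.ae_abs_discount_mul_le hD hs' hx') ?_
    filter_upwards [hdata, hφ.ae_abs_ell_le hD hs hx] with r h1 h2 hmem
    have hr0 : r ∈ Ioo 0 T := ⟨hs.1.trans_lt ((le_max_left _ _).trans_lt hmem.1), hmem.2⟩
    have hrs' : r ∈ Icc s' T := ⟨(le_max_right _ _).trans hmem.1.le, hmem.2.le⟩
    have e1 : D.discount s α φ r * D.ell r φ (α r) - D.discount s' α φ' r * D.ell r φ' (α r) =
        (D.discount s α φ r - D.discount s' α φ' r) * D.ell r φ (α r) +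
          D.discount s' α φ' r * (D.ell r φ (α r) - D.ell r φ' (α r)) := by ring
    rw [e1]
    refine (abs_add_le _ _).trans (add_le_add ?_ ?_)
    · rw [abs_mul]
      exact mul_le_mul (hdisc r ⟨hmem.1.le, hmem.2.le⟩) (h2 hr0) (abs_nonneg _) hη0
    · rw [abs_mul, abs_of_pos (D.discount_pos s' α φ' r)]
      exact (mul_le_of_le_one_left (abs_nonneg _) (hD.discount_le_one hs'.1 hrs')).trans (h1 hr0).2
  have hterm : |D.discount s α φ T * D.h φ - D.discount s' α φ' T * D.h φ'| ≤
      η * Bh + |D.h φ - D.h φ'| := by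
    have e1 : D.discount s α φ T * D.h φ - D.discount s' α φ' T * D.h φ' =
        (D.discount s α φ T - D.discount s' α φ' T) * D.h φ +
          D.discount s' α φ' T * (D.h φ - D.h φ') := by ring
    rw [e1]
    refine (abs_add_le _ _).trans (add_le_add ?_ ?_)
    · rw [abs_mul]
      exact mul_le_mul (hdisc T ⟨max_le hs.2 hs'.2, le_rfl⟩) hBh (abs_nonneg _) hη0
    · rw [abs_mul, abs_of_pos (D.discount_pos s' α φ' T)]
      exact mul_le_of_le_one_left (abs_nonneg _) (hD.discount_le_one hs'.1 ⟨hs'.2, le_rfl⟩)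
  have hmin : T - min s s' ≤ T := by
    have := le_min hs.1 hs'.1
    linarith
  have e2 : D.cost s α φ - D.cost s' α φ' =
      ((∫ r in s..T, D.discount s α φ r * D.ell r φ (α r)) -
        ∫ r in s'..T, D.discount s' α φ' r * D.ell r φ' (α r)) +
      (D.discount s α φ T * D.h φ - D.discount s' α φ' T * D.h φ') := by
    rw [cost, cost]; ring
  rw [e2]
  calc _ ≤ (B * |s - s'| + (η * B + Lf * c * δ) * (T - min s s')) +
        (η * Bh + |D.h φ - D.h φ'|) := (abs_add_le _ _).trans (add_le_add hrun hterm)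
    _ ≤ (B * δ + (η * B + Lf * c * δ) * T) + (η * Bh + |D.h φ - D.h φ'|) := by gcongr
    _ = _ := by rw [hη]; ring

/-- The value function is continuous. The terminal cost `h` is merely continuous, but it is
uniformly continuous near the compact set of trajectories from a given initial point. -/
theorem continuousOn_value [Nonempty A] (hD : D.Admissible Cf Clam Lf)
    (hA : IsSigmaCompactMetrizable A) : ContinuousOn D.value {p | p.time ∈ Icc 0 T} := by
  rintro ⟨s, x⟩ (hs : s ∈ Icc 0 T)
  rw [Metric.continuousWithinAt_iff]
  intro ε hε
  have hN0 := x.supNorm_nonneg s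
  have hCf := hD.Cf_nonneg
  have hG0 := growthBound_pos (T := T) (L := Cf) hN0
  obtain ⟨𝒦, h𝒦, hsub⟩ := exists_isCompact_lipPaths_subset
    (R := Cf * growthBound T Cf (x.supNorm s)) (by positivity) hs x
  obtain ⟨Bh, hBh⟩ := h𝒦.exists_bound_of_continuousOn hD.cont_h.continuousOn
  have hunif := h𝒦.uniformContinuousAt_of_continuousAt D.h
    (fun a _ => hD.cont_h.continuousAt) (Metric.dist_mem_uniformity (show 0 < ε / 4 by positivity))
  obtain ⟨δ₁, hδ₁, hunif⟩ := Metric.mem_uniformity_dist.1 hunif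
  set N := x.supNorm s + 1 with hN
  set c := stabilityConst T Cf Lf N with hc
  set C := (Cf * growthBound T Cf N + ((Clam + Lf * c * T) *
        (Cf * growthBound T Cf N) + Lf * c) * T + (Clam + Lf * c * T) * Bh) with hC
  refine ⟨min 1 (min (δ₁ / (|c| + 1)) (ε / 4 / (|C| + 1))), by positivity, ?_⟩
  rintro ⟨s', x'⟩ (hs' : s' ∈ Icc 0 T) hd
  rw [dist_comm] at hd
  have hd1 := hd.trans_le (min_le_left _ _)
  have hd2 := hd.trans_le ((min_le_right _ _).trans (min_le_left _ _))
  have hd3 := hd.trans_le ((min_le_right _ _).trans (min_le_right _ _))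
  have hx : x.supNorm s ≤ N := by linarith
  have hx' : x'.supNorm s' ≤ N := by
    have := TimePath.supNorm_le_add_dist hs hs' x x'
    linarith
  set δ := dist (⟨s, x⟩ : TimePath T d) ⟨s', x'⟩ with hδ
  have hδ0 : 0 ≤ δ := dist_nonneg
  have key : ∀ α φ φ', IsControl T α → D.IsTrajectory s x α φ → D.IsTrajectory s' x' α φ' →
      |D.cost s α φ - D.cost s' α φ'| ≤ ε / 2 := by
    intro α φ φ' hα hφ hφ'
    have hφ𝒦 := hsub (pathsX_subset_lipPaths hCf hs (hφ.mem_pathsX hD hs.1))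
    have h1 := hφ.abs_cost_sub_cost_le hD hA hα hs hs' hx hx' hφ' (hBh φ hφ𝒦)
    have h2 : dist φ φ' < δ₁ := by
      refine (hφ.dist_le hD hA hα hs hs' hx hx' hφ').trans_lt ?_
      rw [lt_div_iff₀ (by positivity)] at hd2
      have := mul_le_mul_of_nonneg_right (le_abs_self c) hδ0
      linarith
    have h3 : |D.h φ - D.h φ'| < ε / 4 := hunif h2 hφ𝒦
    have h4 : C * δ ≤ ε / 4 := by
      rw [lt_div_iff₀ (by positivity)] at hd3
      have := mul_le_mul_of_nonneg_right (le_abs_self C) hδ0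
      linarith
    linarith
  have h1 : D.value ⟨s, x⟩ ≤ D.value ⟨s', x'⟩ + ε / 4 + ε / 2 := by
    obtain ⟨α, φ', hα, hφ', h⟩ := exists_cost_lt_value_add hD hA hs' x' (ε := ε / 4) (by positivity)
    obtain ⟨φ, hφ⟩ := exists_isTrajectory hD hA hα hs x
    have := value_le_cost hD hs hα hφ
    have := (abs_le.1 (key α φ φ' hα hφ hφ')).2
    linarith
  have h2 : D.value ⟨s', x'⟩ ≤ D.value ⟨s, x⟩ + ε / 4 + ε / 2 := by
    obtain ⟨α, φ, hα, hφ, h⟩ := exists_cost_lt_value_add hD hA hs x (ε := ε / 4) (by positivity)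
    obtain ⟨φ', hφ'⟩ := exists_isTrajectory hD hA hα hs' x'
    have := value_le_cost hD hs' hα hφ'
    have := (abs_le.1 (key α φ φ' hα hφ hφ')).1
    linarith
  rw [Real.dist_eq, abs_lt]
  constructor <;> linarith

end ControlData

/-! ### The Hamiltonian -/

theorem ciInf_le_ciInf_add {A : Type*} [Nonempty A] {F G : A → ℝ} {c : ℝ}
    (hF : BddBelow (range F)) (h : ∀ a, F a ≤ G a + c) : ⨅ a, F a ≤ (⨅ a, G a) + c := by
  rw [← sub_le_iff_le_add]
  exact le_ciInf fun a => by linarith [ciInf_le hF a, h a]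

namespace ControlData

variable {T : ℝ} {d : ℕ} {A : Type*} {D : ControlData T d A} {Cf Clam Lf : ℝ}

/-- The function of which the Hamiltonian is the infimum over `A`. -/
def preHamiltonian (D : ControlData T d A) (t : ℝ) (x : CadlagPath T d) (y : ℝ) (z : State d)
    (a : A) : ℝ := D.ell t x a + inner ℝ (D.f t x a) z - D.lam t x a * y

theorem hamiltonian_eq (D : ControlData T d A) (t : ℝ) (x : CadlagPath T d) (y : ℝ) (z : State d) :
    D.hamiltonian t x y z = ⨅ a, D.preHamiltonian t x y z a := rfl

variable [TopologicalSpace A]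

theorem Admissible.bddBelow_preHamiltonian (hD : D.Admissible Cf Clam Lf) :
    ∀ᵐ t : ℝ, t ∈ Ioo 0 T → ∀ (x : CadlagPath T d) (y : ℝ) (z : State d),
      BddBelow (range (D.preHamiltonian t x y z)) := by
  filter_upwards [hD.growth] with t ht hmem x y z
  refine ⟨-(Cf * (1 + x.supNorm t)) * (1 + ‖z‖) - Clam * |y|, ?_⟩
  rintro _ ⟨a, rfl⟩
  obtain ⟨h1, h2⟩ := ht hmem x a
  have h3 := (abs_le.1 (abs_real_inner_le_norm (D.f t x a) z)).1
  have h4 := neg_abs_le (D.ell t x a)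
  have h5 : D.lam t x a * y ≤ Clam * |y| := by
    refine (le_abs_self _).trans ?_
    rw [abs_mul]
    gcongr
  have h6 := norm_nonneg (D.f t x a)
  have h7 := abs_nonneg (D.ell t x a)
  have h8 : ‖D.f t x a‖ * ‖z‖ ≤ Cf * (1 + x.supNorm t) * ‖z‖ :=
    mul_le_mul_of_nonneg_right (by linarith) (norm_nonneg z)
  simp only [preHamiltonian]
  linarith

theorem Admissible.preHamiltonian_le_add (hD : D.Admissible Cf Clam Lf) :
    ∀ᵐ t : ℝ, t ∈ Ioo 0 T → ∀ (x x' : CadlagPath T d) (y : ℝ) (z : State d) (a : A),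
      D.preHamiltonian t x y z a ≤
        D.preHamiltonian t x' y z a + Lf * (1 + |y| + ‖z‖) * x.supDiff x' t := by
  filter_upwards [hD.lip] with t ht hmem x x' y z a
  have h1 := ht hmem x x' a
  have h2 := (abs_le.1 (abs_real_inner_le_norm (D.f t x a - D.f t x' a) z)).2
  rw [inner_sub_left] at h2
  have h3 : -((D.lam t x a - D.lam t x' a) * y) ≤ |D.lam t x a - D.lam t x' a| * |y| := by
    rw [← abs_mul]; exact neg_le_abs _
  have h4 := le_abs_self (D.ell t x a - D.ell t x' a)
  set F := ‖D.f t x a - D.f t x' a‖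
  set E := |D.ell t x a - D.ell t x' a|
  set Λ := |D.lam t x a - D.lam t x' a|
  have hF : 0 ≤ F := norm_nonneg _
  have hE : 0 ≤ E := abs_nonneg _
  have hΛ : 0 ≤ Λ := abs_nonneg _
  have h5 : E + F * ‖z‖ + Λ * |y| ≤ (F + E + Λ) * (1 + |y| + ‖z‖) := by
    have e1 := mul_nonneg hE (norm_nonneg z)
    have e2 := mul_nonneg hΛ (norm_nonneg z)
    have e3 := mul_nonneg hE (abs_nonneg y)
    have e4 := mul_nonneg hF (abs_nonneg y)
    linarith
  have h6 : (F + E + Λ) * (1 + |y| + ‖z‖) ≤ Lf * x.supDiff x' t * (1 + |y| + ‖z‖) := by gcongr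
  simp only [preHamiltonian]
  linarith

theorem Admissible.isPathLipConst [Nonempty A] (hD : D.Admissible Cf Clam Lf) :
    IsPathLipConst D.hamiltonian Lf := by
  filter_upwards [hD.bddBelow_preHamiltonian, hD.preHamiltonian_le_add] with t h1 h2 hmem x x' y z
  have e1 := ciInf_le_ciInf_add (h1 hmem x y z) (h2 hmem x x' y z)
  have e2 := ciInf_le_ciInf_add (h1 hmem x' y z) (h2 hmem x' x y z)
  have e3 : x'.supDiff x t = x.supDiff x' t := by
    simp only [CadlagPath.supDiff, norm_sub_rev]
  rw [e3] at e2
  rw [hamiltonian_eq, hamiltonian_eq, abs_le]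
  constructor <;> linarith

theorem Admissible.isGradLipConst [Nonempty A] (hD : D.Admissible Cf Clam Lf) :
    IsGradLipConst D.hamiltonian Cf := by
  filter_upwards [hD.bddBelow_preHamiltonian, hD.norm_f_le] with t h1 h2 hmem x y z z'
  have key : ∀ z z' : State d, ∀ a, D.preHamiltonian t x y z a ≤
      D.preHamiltonian t x y z' a + Cf * (1 + x.supNorm t) * ‖z - z'‖ := by
    intro z z' a
    have e1 := (abs_le.1 (abs_real_inner_le_norm (D.f t x a) (z - z'))).2
    rw [inner_sub_right] at e1
    have e2 := mul_le_mul_of_nonneg_right (h2 hmem x a) (norm_nonneg (z - z'))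
    simp only [preHamiltonian]
    linarith
  have e1 := ciInf_le_ciInf_add (h1 hmem x y z) (key z z')
  have e2 := ciInf_le_ciInf_add (h1 hmem x y z') (key z' z)
  rw [norm_sub_rev] at e2
  rw [hamiltonian_eq, hamiltonian_eq, abs_le]
  constructor <;> linarith

/-- Because `0 ≤ λ ≤ C_λ`, the Hamiltonian is nonincreasing and Lipschitz in `y`. -/
theorem Admissible.hamiltonian_le_add [Nonempty A] (hD : D.Admissible Cf Clam Lf) :
    ∀ᵐ t : ℝ, t ∈ Ioo 0 T → ∀ (x : CadlagPath T d) (y y' ζ : ℝ) (z : State d), 0 ≤ ζ → y' ≤ y + ζ →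
      D.hamiltonian t x y z ≤ D.hamiltonian t x y' z + Clam * ζ := by
  filter_upwards [hD.bddBelow_preHamiltonian, hD.growth] with t h1 h2 hmem x y y' ζ z hζ hy
  refine ciInf_le_ciInf_add (h1 hmem x y z) fun a => ?_
  have e0 := hD.lam_nonneg t (Ioo_subset_Icc_self hmem) x a
  have e1 : D.lam t x a * y' ≤ D.lam t x a * (y + ζ) := mul_le_mul_of_nonneg_left hy e0
  have e2 : D.lam t x a * ζ ≤ Clam * ζ :=
    mul_le_mul_of_nonneg_right ((le_abs_self _).trans (h2 hmem x a).2) hζ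
  linarith

/-- Measurable selection of nearly optimal controls in the Hamiltonian along a fixed path. -/
theorem Admissible.exists_preHamiltonian_lt [MeasurableSpace A] [Nonempty A]
    (hD : D.Admissible Cf Clam Lf) (hA : IsSigmaCompactMetrizable A) (hT : 0 ≤ T)
    (x : CadlagPath T d) (y : ℝ) (z : State d) {ε : ℝ} (hε : 0 < ε) :
    ∃ α : ℝ → A, IsControl T α ∧ ∀ᵐ t : ℝ, t ∈ Ioo 0 T →
      D.preHamiltonian t x y z (α t) < D.hamiltonian t x y z + ε := by
  have := hA.separableSpace
  let μ : Measure (Icc (0 : ℝ) T) := Measure.comap Subtype.val volume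
  have hae : ∀ {p : ℝ → Prop}, (∀ᵐ t : ℝ, t ∈ Icc 0 T → p t) →
      ∀ᵐ t : Icc (0 : ℝ) T ∂μ, p (t : ℝ) := by
    intro p hp
    rwa [← ae_restrict_iff' measurableSet_Icc, ae_restrict_iff_subtype measurableSet_Icc] at hp
  have hIoo : ∀ᵐ t : Icc (0 : ℝ) T ∂μ, (t : ℝ) ∈ Ioo 0 T := by
    refine hae ?_
    filter_upwards [Measure.ae_ne volume (0 : ℝ), Measure.ae_ne volume T] with t h1 h2 h3
    exact ⟨lt_of_le_of_ne h3.1 (Ne.symm h1), lt_of_le_of_ne h3.2 h2⟩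
  have hc : ∀ᵐ t : Icc (0 : ℝ) T ∂μ, Continuous (D.preHamiltonian t x y z) := by
    filter_upwards [hae hD.cont] with t ht
    have h1 := ht.comp (Continuous.prodMk_right x)
    exact (h1.snd.snd.add (h1.fst.inner continuous_const)).sub (h1.snd.fst.mul continuous_const)
  have hb : ∀ᵐ t : Icc (0 : ℝ) T ∂μ, BddBelow (range (D.preHamiltonian t x y z)) := by
    have h1 := hae (p := fun t => t ∈ Ioo 0 T → BddBelow (range (D.preHamiltonian t x y z))) (by
      filter_upwards [hD.bddBelow_preHamiltonian] with t ht _ hmem using ht hmem x y z)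
    filter_upwards [h1, hIoo] with t h1 h2 using h1 h2
  have hm : ∀ a, Measurable fun t : Icc (0 : ℝ) T => D.preHamiltonian t x y z a := by
    intro a
    have h1 := hD.meas x a
    exact (h1.snd.snd.add (h1.fst.inner measurable_const)).sub (h1.snd.fst.mul measurable_const)
  obtain ⟨α, hα, h⟩ := exists_measurable_lt_iInf_add hc hb hm hε
  have hproj : ∀ t : Icc (0 : ℝ) T, α (projIcc 0 T hT t) = α t := fun t => by
    rw [projIcc_val]
  refine ⟨fun t => α (projIcc 0 T hT t), ?_, ?_⟩
  · simp only [IsControl, hproj]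
    exact hα
  · have h' : ∀ᵐ t : Icc (0 : ℝ) T ∂μ, D.preHamiltonian t x y z (α (projIcc 0 T hT t)) <
        D.hamiltonian t x y z + ε := by
      filter_upwards [h] with t ht
      rw [hproj, hamiltonian_eq]
      exact ht
    rw [← ae_restrict_iff_subtype measurableSet_Icc (p := fun t : ℝ =>
      D.preHamiltonian t x y z (α (projIcc 0 T hT t)) < D.hamiltonian t x y z + ε),
      ae_restrict_iff' measurableSet_Icc] at h'
    filter_upwards [h'] with t ht hmem using ht (Ioo_subset_Icc_self hmem)

end ControlData

/-! ### Test functions of the doubled equation -/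

section Doubled

variable {T : ℝ} {d : ℕ} {M K Υ : ℝ} {p q : State d}

/-- The last two terms of the bracket in the doubled equation, for values `Υ`, `p`, `q` of the
parameter and of the two path derivatives. -/
def doubledTerm (M K Υ : ℝ) (p q : State d) (P : TimePath₂ T d) : ℝ :=
  M * (1 + |Υ| + ‖p‖) * P.left.supDiff P.right P.time
    + K * (1 + P.right.supNorm P.time) * ‖p + q‖

theorem continuousOn_doubledTerm (M K Υ : ℝ) (p q : State d) :
    ContinuousOn (doubledTerm (T := T) M K Υ p q) {P | P.time ∈ Icc 0 T} := by
  have hL : LipschitzOnWith 1 (fun P : TimePath₂ T d => P.left.supDiff P.right P.time)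
      {P | P.time ∈ Icc 0 T} := by
    have key : ∀ P Q : TimePath₂ T d, P.time ∈ Icc 0 T → Q.time ∈ Icc 0 T →
        P.left.supDiff P.right P.time ≤ Q.left.supDiff Q.right Q.time + dist P Q := by
      rintro ⟨t, x, y⟩ ⟨t', x', y'⟩ ht ht'
      refine CadlagPath.supDiff_le (add_nonneg (CadlagPath.supDiff_nonneg _ _ _) dist_nonneg)
        fun r hr => ?_
      have hr0 : r ∈ Icc 0 T := ⟨hr.1, hr.2.trans ht.2⟩
      have h1 := CadlagPath.norm_sub_le_stopDist x x' t t' hr0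
      have h2 := CadlagPath.norm_sub_le_stopDist y y' t t' hr0
      have h3 := CadlagPath.norm_sub_le_supDiff x' y' (s := min r t') (t := t')
        ⟨le_min hr.1 ht'.1, min_le_right _ _⟩
      simp only at hr
      rw [min_eq_left hr.2] at h1 h2
      have h4 : dist (⟨t, x, y⟩ : TimePath₂ T d) ⟨t', x', y'⟩ =
        |t - t'| + CadlagPath.stopDist t x t' x' + CadlagPath.stopDist t y t' y' := rfl
      have h5 := abs_nonneg (t - t')
      have h6 : x r - y r = (x r - x' (min r t')) + (x' (min r t') - y' (min r t'))
        - (y r - y' (min r t')) := by abel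
      rw [h6, h4]
      refine (norm_sub_le _ _).trans ?_
      have := norm_add_le (x r - x' (min r t')) (x' (min r t') - y' (min r t'))
      simp only
      linarith
    refine LipschitzOnWith.of_dist_le_mul fun P hP Q hQ => ?_
    rw [NNReal.coe_one, one_mul, Real.dist_eq, abs_sub_le_iff]
    have h1 := key P Q hP hQ
    have h2 := key Q P hQ hP
    rw [dist_comm] at h2
    constructor <;> linarith
  have hN : LipschitzOnWith 1 (fun P : TimePath₂ T d => P.right.supNorm P.time)
      {P | P.time ∈ Icc 0 T} := by
    have key : ∀ P Q : TimePath₂ T d, P.time ∈ Icc 0 T → Q.time ∈ Icc 0 T →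
        Q.right.supNorm Q.time ≤ P.right.supNorm P.time + dist P Q := by
      rintro ⟨t, x, y⟩ ⟨t', x', y'⟩ ht ht'
      refine (TimePath.supNorm_le_add_dist ht ht' y y').trans (add_le_add_right ?_ _)
      change |t - t'| + CadlagPath.stopDist t y t' y' ≤
        |t - t'| + CadlagPath.stopDist t x t' x' + CadlagPath.stopDist t y t' y'
      have := CadlagPath.stopDist_nonneg t x t' x'
      linarith
    refine LipschitzOnWith.of_dist_le_mul fun P hP Q hQ => ?_
    rw [NNReal.coe_one, one_mul, Real.dist_eq, abs_sub_le_iff]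
    have h1 := key P Q hP hQ
    have h2 := key Q P hQ hP
    rw [dist_comm] at h2
    constructor <;> linarith
  exact (continuousOn_const.mul hL.continuousOn).add
    ((continuousOn_const.mul (continuousOn_const.add hN.continuousOn)).mul continuousOn_const)

variable {s R : ℝ} {x₀ y₀ x y : CadlagPath T d}

/-- Lipschitz continuations of two paths move continuously, at a uniform speed. -/
theorem dist_timePath₂_le (hR : 0 ≤ R) (hs : 0 ≤ s) (hx : x ∈ lipPaths R s x₀)
    (hy : y ∈ lipPaths R s y₀) {t t' : ℝ} (ht : t ∈ Icc s T) (ht' : t' ∈ Icc s T)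
    {x' y' : CadlagPath T d} (hx' : EqOn x x' (Icc 0 t')) (hy' : EqOn y y' (Icc 0 t')) :
    dist (⟨t, x, y⟩ : TimePath₂ T d) ⟨t', x', y'⟩ ≤ (1 + 2 * R) * |t - t'| := by
  have h1 := stopDist_le_of_mem_lipPaths hR hs hx ht ht' hx'
  have h2 := stopDist_le_of_mem_lipPaths hR hs hy ht ht' hy'
  have h3 : dist (⟨t, x, y⟩ : TimePath₂ T d) ⟨t', x', y'⟩ =
        |t - t'| + CadlagPath.stopDist t x t' x' + CadlagPath.stopDist t y t' y' := rfl
  linarith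

theorem continuousOn_timePath₂ (hR : 0 ≤ R) (hs : 0 ≤ s) (hx : x ∈ lipPaths R s x₀)
    (hy : y ∈ lipPaths R s y₀) :
    ContinuousOn (fun t => (⟨t, x, y⟩ : TimePath₂ T d)) (Icc s T) := by
  refine (LipschitzOnWith.of_dist_le_mul (K := (1 + 2 * R).toNNReal)
    fun t ht t' ht' => ?_).continuousOn
  rw [Real.coe_toNNReal _ (by positivity), Real.dist_eq]
  exact dist_timePath₂_le hR hs hx hy ht ht' (fun _ _ => rfl) fun _ _ => rfl

theorem lipPaths_mono {R' : ℝ} (h : R ≤ R') : lipPaths R s x₀ ⊆ lipPaths R' s x₀ :=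
  fun _ hx => ⟨hx.1, fun t ht t' ht' => (hx.2 t ht t' ht').trans (by gcongr)⟩

end Doubled

/-! ### Increments of touched functions -/

theorem IntervalIntegrable.inner_continuousOn {d : ℕ} {g k : ℝ → State d} {a b : ℝ} (hab : a ≤ b)
    (hg : IntervalIntegrable g volume a b) (hk : ContinuousOn k (Icc a b)) :
    IntervalIntegrable (fun r => inner ℝ (g r) (k r)) volume a b := by
  obtain ⟨C, hC⟩ := isCompact_Icc.exists_bound_of_continuousOn hk
  rw [intervalIntegrable_iff_integrableOn_Icc_of_le hab] at hg ⊢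
  refine Integrable.mono' (hg.norm.mul_const C)
    (hg.aestronglyMeasurable.inner (hk.aestronglyMeasurable measurableSet_Icc)) ?_
  rw [ae_restrict_iff' measurableSet_Icc]
  refine Eventually.of_forall fun r hr => (norm_inner_le_norm _ _).trans ?_
  exact mul_le_mul_of_nonneg_left (hC r hr) (norm_nonneg _)

section

variable {T : ℝ} {d : ℕ} {M K L Υ s : ℝ} {x₀ y₀ : CadlagPath T d}

theorem intervalIntegrable_deriv_of_mem_pathsX (hL : 0 ≤ L) (hs : s ∈ Icc 0 T)
    {x : CadlagPath T d} (hx : x ∈ pathsX L s x₀) {t : ℝ} (ht : t ∈ Icc s T) :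
    IntervalIntegrable (deriv x) volume s t :=
  (AbsolutelyContinuousOnInterval.intervalIntegrable_deriv_of_le hs.2
    (ae_norm_deriv_le_of_mem_pathsX hL hs hx)).mono_set (by
      rw [uIcc_of_le ht.1, uIcc_of_le hs.2]; exact Icc_subset_Icc_right ht.2)

theorem intervalIntegrable_inner_add_inner_sub_doubledTerm (hL : 0 ≤ L) (hs : s ∈ Icc 0 T)
    {x y : CadlagPath T d} (hx : x ∈ pathsX L s x₀) (hy : y ∈ pathsX L s y₀) (M K Υ : ℝ)
    (p q : State d) {t : ℝ} (ht : t ∈ Icc s T) :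
    IntervalIntegrable (fun r => inner ℝ (deriv x r) p + inner ℝ (deriv y r) q
      - doubledTerm M K Υ p q ⟨r, x, y⟩) volume s t := by
  refine (((intervalIntegrable_deriv_of_mem_pathsX hL hs hx ht).inner_continuousOn ht.1
    continuousOn_const).add ((intervalIntegrable_deriv_of_mem_pathsX hL hs hy ht).inner_continuousOn
      ht.1 continuousOn_const)).sub (ContinuousOn.intervalIntegrable ?_)
  have hx' := lipPaths_mono (le_max_left _ (L * growthBound T L (y₀.supNorm s)))
    (pathsX_subset_lipPaths hL hs hx)
  have hy' := lipPaths_mono (le_max_right (L * growthBound T L (x₀.supNorm s)) _)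
    (pathsX_subset_lipPaths hL hs hy)
  have hR := mul_nonneg hL (growthBound_pos (T := T) (L := L) (x₀.supNorm_nonneg s)).le
  rw [uIcc_of_le ht.1]
  refine (continuousOn_doubledTerm M K Υ p q).comp
    ((continuousOn_timePath₂ (hR.trans (le_max_left _ _)) hs.1 hx' hy').mono
      (Icc_subset_Icc_right ht.2)) fun r hr => ?_
  exact ⟨hs.1.trans hr.1, hr.2.trans ht.2⟩

/-- If along suitable continuations of `(x₀, y₀)` the increments of `w` are, to first order, at
least those of a solution of the doubled equation with gradients frozen at the initial point, then
the bracket in the doubled equation is nonnegative for each function touching `w` from above. -/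
theorem HasPathDerivs.bracket_nonneg (hs : s ∈ Ico 0 T) (hL : 0 ≤ L) {w φ φt : TimePath₂ T d → ℝ}
    {φx φy : TimePath₂ T d → State d} (hφ : HasPathDerivs s φ φt φx φy)
    (htouch : TouchesFromAbove L w s x₀ y₀ φ) {p q : State d} (hp : φx ⟨s, x₀, y₀⟩ = p)
    (hq : φy ⟨s, x₀, y₀⟩ = q)
    (h : ∀ η > 0, ∃ δ > 0, ∀ t ∈ Ioc s T, t < s + δ →
      ∃ x ∈ pathsX L s x₀, ∃ y ∈ pathsX L s y₀,
        (∫ r in s..t, (inner ℝ (deriv x r) p + inner ℝ (deriv y r) q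
          - doubledTerm M K Υ p q ⟨r, x, y⟩)) - η * (t - s)
          ≤ w ⟨t, x, y⟩ - w ⟨s, x₀, y₀⟩) :
    0 ≤ φt ⟨s, x₀, y₀⟩ + doubledTerm M K Υ p q ⟨s, x₀, y₀⟩ := by
  have hs0 : s ∈ Icc 0 T := Ico_subset_Icc_self hs
  have hss : s ∈ Icc s T := ⟨le_rfl, hs.2.le⟩
  set X := φt ⟨s, x₀, y₀⟩ + doubledTerm M K Υ p q ⟨s, x₀, y₀⟩ with hX
  set Rx := L * growthBound T L (x₀.supNorm s)
  set Ry := L * growthBound T L (y₀.supNorm s)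
  set R := max Rx Ry with hRdef
  have hRx : 0 ≤ Rx := mul_nonneg hL (growthBound_pos (x₀.supNorm_nonneg s)).le
  have hR : 0 ≤ R := hRx.trans (le_max_left _ _)
  suffices hη : ∀ η > 0, 0 ≤ X + (3 + 2 * R) * η by
    refine le_of_forall_pos_le_add fun ε hε => ?_
    have := hη (ε / (3 + 2 * R)) (by positivity)
    rwa [mul_div_cancel₀ _ (by positivity)] at this
  intro η hη
  obtain ⟨δ, hδ, hδ'⟩ := h η hη
  obtain ⟨T₀, hT₀, h0, hglb⟩ := htouch
  -- a neighbourhood on which all derivatives are `η`-close to their initial values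
  obtain ⟨ρ, hρ, hclose⟩ : ∃ ρ > 0, ∀ P : TimePath₂ T d, P.time ∈ Icc s T →
      dist P ⟨s, x₀, y₀⟩ < ρ → φt P ≤ φt ⟨s, x₀, y₀⟩ + η ∧ ‖φx P - p‖ ≤ η ∧ ‖φy P - q‖ ≤ η ∧
        doubledTerm M K Υ p q P ≤ doubledTerm M K Υ p q ⟨s, x₀, y₀⟩ + η := by
    have hP0 : (⟨s, x₀, y₀⟩ : TimePath₂ T d) ∈ {P : TimePath₂ T d | P.time ∈ Icc s T} := hss
    have hE := (continuousOn_doubledTerm (T := T) M K Υ p q).mono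
      (fun P (hP : P.time ∈ Icc s T) => (⟨hs.1.trans hP.1, hP.2⟩ : P.time ∈ Icc 0 T))
    obtain ⟨ρ₁, hρ₁, h₁⟩ := Metric.continuousWithinAt_iff.1 (hφ.cont_t _ hP0) η hη
    obtain ⟨ρ₂, hρ₂, h₂⟩ := Metric.continuousWithinAt_iff.1 (hφ.cont_x _ hP0) η hη
    obtain ⟨ρ₃, hρ₃, h₃⟩ := Metric.continuousWithinAt_iff.1 (hφ.cont_y _ hP0) η hη
    obtain ⟨ρ₄, hρ₄, h₄⟩ := Metric.continuousWithinAt_iff.1 (hE _ hP0) η hη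
    refine ⟨min (min ρ₁ ρ₂) (min ρ₃ ρ₄), by positivity, fun P hP hd => ?_⟩
    rw [lt_min_iff, lt_min_iff, lt_min_iff] at hd
    have e1 := h₁ hP hd.1.1
    have e2 := h₂ hP hd.1.2
    have e3 := h₃ hP hd.2.1
    have e4 := h₄ hP hd.2.2
    rw [Real.dist_eq] at e1 e4
    rw [hp, dist_eq_norm] at e2
    rw [hq, dist_eq_norm] at e3
    exact ⟨by linarith [(abs_lt.1 e1).2], e2.le, e3.le, by linarith [(abs_lt.1 e4).2]⟩
  set τ := min (δ / 2) (min (T₀ - s) (ρ / (2 * (1 + 2 * R)))) with hτ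
  have hτ0 : 0 < τ := by
    have : 0 < T₀ - s := sub_pos.2 hT₀.1
    positivity
  have hτ1 : τ < δ := (min_le_left _ _).trans_lt (by linarith)
  have hτ2 : τ ≤ T₀ - s := (min_le_right _ _).trans (min_le_left _ _)
  have hτ3 : (1 + 2 * R) * τ < ρ := by
    have h1 : τ ≤ ρ / (2 * (1 + 2 * R)) := (min_le_right _ _).trans (min_le_right _ _)
    rw [le_div_iff₀ (by positivity)] at h1
    linarith
  set t := s + τ with ht
  have htT : t ∈ Ioc s T := ⟨by linarith, by linarith [hT₀.2]⟩
  have hsub : Icc s t ⊆ Icc s T := Icc_subset_Icc_right htT.2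
  obtain ⟨x, hx, y, hy, hw⟩ := hδ' t htT (by linarith)
  have hxl : x ∈ lipPaths R s x₀ :=
    lipPaths_mono (le_max_left _ _) (pathsX_subset_lipPaths hL hs0 hx)
  have hyl : y ∈ lipPaths R s y₀ :=
    lipPaths_mono (le_max_right _ _) (pathsX_subset_lipPaths hL hs0 hy)
  have hcurve := continuousOn_timePath₂ hR hs.1 hxl hyl
  have hnear : ∀ r ∈ Icc s t, dist (⟨r, x, y⟩ : TimePath₂ T d) ⟨s, x₀, y₀⟩ < ρ := by
    intro r hr
    refine (dist_timePath₂_le hR hs.1 hxl hyl (hsub hr) hss hxl.1 hyl.1).trans_lt ?_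
    rw [abs_of_nonneg (sub_nonneg.2 hr.1)]
    refine lt_of_le_of_lt (mul_le_mul_of_nonneg_left ?_ (by positivity)) hτ3
    linarith [hr.2]
  have hchain := hφ.chain s ⟨le_rfl, hs.2⟩ x₀ y₀ x y hx.1 hy.1 ⟨_, lipPaths.lipschitzOnWith hxl⟩
    ⟨_, lipPaths.lipschitzOnWith hyl⟩ t htT
  have hpos : 0 ≤ φ ⟨t, x, y⟩ - w ⟨t, x, y⟩ :=
    hglb.1 ⟨t, ⟨htT.1.le, by linarith⟩, x, hx, y, hy, rfl⟩
  have hdx := ae_norm_deriv_le_of_mem_pathsX hL hs0 hx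
  have hdy := ae_norm_deriv_le_of_mem_pathsX hL hs0 hy
  have hst := htT.1.le
  have hix := intervalIntegrable_deriv_of_mem_pathsX hL hs0 hx ⟨hst, htT.2⟩
  have hiy := intervalIntegrable_deriv_of_mem_pathsX hL hs0 hy ⟨hst, htT.2⟩
  have hcomp : ∀ {E : Type} [TopologicalSpace E] {g : TimePath₂ T d → E},
      ContinuousOn g {P | P.time ∈ Icc s T} → ContinuousOn (fun r => g ⟨r, x, y⟩) (Icc s t) :=
    fun hg => hg.comp (hcurve.mono hsub) fun r hr => hsub hr
  have hii : ∀ {g : ℝ → ℝ}, ContinuousOn g (Icc s t) → IntervalIntegrable g volume s t :=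
    fun hg => ContinuousOn.intervalIntegrable (by rwa [uIcc_of_le hst])
  have hbase := intervalIntegrable_inner_add_inner_sub_doubledTerm hL hs0 hx hy M K Υ p q
    ⟨hst, htT.2⟩
  have hmono : ∫ r in s..t, (φt ⟨r, x, y⟩ + inner ℝ (deriv x r) (φx ⟨r, x, y⟩)
        + inner ℝ (deriv y r) (φy ⟨r, x, y⟩)) ≤
      ∫ r in s..t, ((inner ℝ (deriv x r) p + inner ℝ (deriv y r) q
          - doubledTerm M K Υ p q ⟨r, x, y⟩) + (X + (2 + 2 * R) * η)) := by
    refine intervalIntegral.integral_mono_ae_restrict hst ?_ ?_ ?_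
    · exact ((hii (hcomp hφ.cont_t)).add (hix.inner_continuousOn hst (hcomp hφ.cont_x))).add
        (hiy.inner_continuousOn hst (hcomp hφ.cont_y))
    · exact hbase.add intervalIntegrable_const
    · rw [Filter.EventuallyLE, ae_restrict_iff' measurableSet_Icc]
      filter_upwards [hdx, hdy, Measure.ae_ne volume s, Measure.ae_ne volume T]
        with r h1 h2 h3 h4 hr
      have hr' : r ∈ Ioo s T := ⟨lt_of_le_of_ne hr.1 (Ne.symm h3), lt_of_le_of_ne (hsub hr).2 h4⟩
      obtain ⟨c1, c2, c3, c4⟩ := hclose ⟨r, x, y⟩ (hsub hr) (hnear r hr)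
      have b1 : inner ℝ (deriv x r) (φx ⟨r, x, y⟩) - inner ℝ (deriv x r) p ≤ R * η := by
        rw [← inner_sub_right]
        exact (real_inner_le_norm _ _).trans
          (mul_le_mul ((h1 hr').trans (le_max_left _ _)) c2 (norm_nonneg _) hR)
      have b2 : inner ℝ (deriv y r) (φy ⟨r, x, y⟩) - inner ℝ (deriv y r) q ≤ R * η := by
        rw [← inner_sub_right]
        exact (real_inner_le_norm _ _).trans
          (mul_le_mul ((h2 hr').trans (le_max_right _ _)) c3 (norm_nonneg _) hR)
      linarith
  have hts : t - s = τ := by rw [ht]; ring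
  rw [intervalIntegral.integral_add hbase intervalIntegrable_const,
    intervalIntegral.integral_const, smul_eq_mul, hts] at hmono
  rw [hts] at hw
  have hfin : 0 ≤ τ * (X + (3 + 2 * R) * η) := by linarith
  exact nonneg_of_mul_nonneg_right hfin hτ0

end

namespace ControlData

variable {T : ℝ} {d : ℕ} {A : Type*} [TopologicalSpace A] [Nonempty A] {D : ControlData T d A}
  {Cf Clam Lf : ℝ}

/-- Comparison of the Hamiltonians at two points. The monotonicity in `y` lets the values `y₁` and
`y₂` differ, up to an error `ζ`, as long as `Υ` lies between them. -/
theorem Admissible.hamiltonian_le_hamiltonian_add (hD : D.Admissible Cf Clam Lf) {M K : ℝ}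
    (hM : IsPathLipConst D.hamiltonian M) (hK : IsGradLipConst D.hamiltonian K) :
    ∀ᵐ t : ℝ, t ∈ Ioo 0 T → ∀ (x x' : CadlagPath T d) (y₁ y₂ Υ ζ : ℝ) (p q : State d),
      0 ≤ ζ → Υ ≤ y₁ + ζ → y₂ ≤ Υ + ζ →
      D.hamiltonian t x y₁ p ≤ D.hamiltonian t x' y₂ (-q)
        + doubledTerm M K Υ p q ⟨t, x, x'⟩ + 2 * Clam * ζ := by
  filter_upwards [hM, hK, hD.hamiltonian_le_add] with t h1 h2 h3 hmem x x' y₁ y₂ Υ ζ p q hζ hy₁ hy₂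
  have e1 := h3 hmem x y₁ Υ ζ p hζ hy₁
  have e2 := (abs_le.1 (h1 hmem x x' Υ p)).2
  have e3 := (abs_le.1 (h2 hmem x' Υ p (-q))).2
  have e4 := h3 hmem x' Υ y₂ ζ (-q) hζ hy₂
  rw [sub_neg_eq_add] at e3
  simp only [doubledTerm]
  linarith

variable [MeasurableSpace A] [BorelSpace A] {s : ℝ}

/-- First-order expansion of the discounting in the dynamic programming relations. -/
theorem Admissible.exists_abs_sub_integral_le (hD : D.Admissible Cf Clam Lf)
    (hA : IsSigmaCompactMetrizable A) (hs : s ∈ Icc 0 T) (x : CadlagPath T d) {η : ℝ} (hη : 0 < η) :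
    ∃ δ > 0, ∀ (α : ℝ → A) (φ : CadlagPath T d), IsControl T α → D.IsTrajectory s x α φ →
      ∀ t ∈ Ioc s T, t < s + δ →
        |(1 - D.discount s α φ t) * D.value ⟨t, φ⟩
          - (∫ r in s..t, D.discount s α φ r * D.ell r φ (α r))
          - ∫ r in s..t, (D.lam r φ (α r) * D.value ⟨s, x⟩ - D.ell r φ (α r))| ≤ η * (t - s) := by
  have hClam := hD.Clam_nonneg
  set R := Cf * growthBound T Cf (x.supNorm s) with hR
  have hR0 : 0 ≤ R := mul_nonneg hD.Cf_nonneg (growthBound_pos (x.supNorm_nonneg s)).le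
  set v₀ := D.value ⟨s, x⟩ with hv₀
  set η₁ := η / (2 * (Clam + 1)) with hη₁
  have hη₁0 : 0 < η₁ := by positivity
  obtain ⟨ρ, hρ, hv⟩ := Metric.continuousWithinAt_iff.1
    (continuousOn_value hD hA (⟨s, x⟩ : TimePath T d) hs) η₁ hη₁0
  set c := Clam ^ 2 * (|v₀| + η₁) + Clam * R with hc
  have hc0 : 0 ≤ c := by positivity
  refine ⟨min (ρ / (1 + R)) (min (1 / (Clam + 1)) (η / (2 * (c + 1)))), by positivity, ?_⟩
  intro α φ hα hφ t ht htδ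
  have hst := ht.1.le
  have htT : t ∈ Icc s T := ⟨hst, ht.2⟩
  have ht0 : t ∈ Icc 0 T := ⟨hs.1.trans hst, ht.2⟩
  set τ := t - s with hτ
  have hτ0 : 0 < τ := sub_pos.2 ht.1
  have hτδ : τ < min (ρ / (1 + R)) (min (1 / (Clam + 1)) (η / (2 * (c + 1)))) := by linarith
  rw [lt_min_iff, lt_min_iff, lt_div_iff₀ (by positivity), lt_div_iff₀ (by positivity),
    lt_div_iff₀ (by positivity)] at hτδ
  obtain ⟨hτ1, hτ2, hτ3⟩ := hτδ
  -- the value along the trajectory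
  have hvt : |D.value ⟨t, φ⟩ - v₀| ≤ η₁ := by
    have hl := pathsX_subset_lipPaths hD.Cf_nonneg hs (hφ.mem_pathsX hD hs.1)
    have h1 := stopDist_le_of_mem_lipPaths hR0 hs.1 hl htT ⟨le_rfl, hs.2⟩ hl.1
    have h2 : dist (⟨t, φ⟩ : TimePath T d) ⟨s, x⟩ = |t - s| + CadlagPath.stopDist t φ s x := rfl
    rw [abs_of_pos hτ0] at h1 h2
    exact (hv (show (⟨t, φ⟩ : TimePath T d) ∈ {p : TimePath T d | p.time ∈ Icc 0 T} from ht0)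
      (by rw [h2]; linarith)).le
  have hvt' : |D.value ⟨t, φ⟩| ≤ |v₀| + η₁ := by
    have := abs_sub_abs_le_abs_sub (D.value ⟨t, φ⟩) v₀
    linarith
  -- the discount factor
  set I := ∫ r in s..t, D.lam r φ (α r) with hI
  have hI0 : 0 ≤ I := hD.integral_lam_nonneg hs.1 htT
  have hI1 : I ≤ Clam * τ := hD.integral_lam_le hs.1 htT
  have hχ : |1 - D.discount s α φ t - I| ≤ (Clam * τ) ^ 2 := by
    have h1 : |(-I)| ≤ 1 := by
      rw [abs_neg, abs_of_nonneg hI0]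
      linarith
    have h2 := Real.abs_exp_sub_one_sub_id_le h1
    have h3 : 1 - D.discount s α φ t - I = -(Real.exp (-I) - 1 - -I) := by
      rw [discount]; ring
    rw [h3, abs_neg]
    refine h2.trans ?_
    rw [neg_sq]
    gcongr
  have hil := hD.intervalIntegrable_lam hA hα φ hs ht0
  have hie := hD.intervalIntegrable_ell hA hα φ hs ht0
  have hiχ := hD.intervalIntegrable_discount_mul (φ := φ) hA hα hs hs ht0
  have hrun : |∫ r in s..t, (D.ell r φ (α r) - D.discount s α φ r * D.ell r φ (α r))| ≤
      Clam * τ * R * τ := by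
    have h1 : ‖∫ r in s..t, (D.ell r φ (α r) - D.discount s α φ r * D.ell r φ (α r))‖ ≤
        Clam * τ * R * |t - s| := by
      refine intervalIntegral.norm_integral_le_of_norm_le_const_ae ?_
      filter_upwards [hφ.ae_abs_ell_le hD hs le_rfl,
        ae_mem_Ioo_of_mem_uIoc (s := s) (T := t) ⟨le_rfl, hst⟩ ⟨hst, le_rfl⟩] with r h1 h2 h3
      have hr := h2 h3
      have hrT : r ∈ Icc s T := ⟨hr.1.le, hr.2.le.trans ht.2⟩
      have h4 : |1 - D.discount s α φ r| ≤ Clam * τ := by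
        rw [abs_of_nonneg (sub_nonneg.2 (hD.discount_le_one hs.1 hrT))]
        have h5 := Real.add_one_le_exp (-∫ q in s..r, D.lam q φ (α q))
        have h6 := hD.integral_lam_le (φ := φ) (α := α) hs.1 hrT
        have h7 : Clam * (r - s) ≤ Clam * τ := by gcongr; linarith [hr.2]
        rw [discount]
        linarith
      have h5 : D.ell r φ (α r) - D.discount s α φ r * D.ell r φ (α r) =
          (1 - D.discount s α φ r) * D.ell r φ (α r) := by ring
      rw [h5, norm_mul, Real.norm_eq_abs, Real.norm_eq_abs]
      exact mul_le_mul h4 (h1 ⟨hs.1.trans_lt hr.1, hr.2.trans_le ht.2⟩) (abs_nonneg _)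
        (by positivity)
    rwa [abs_of_pos hτ0] at h1
  rw [intervalIntegral.integral_sub hie hiχ] at hrun
  have hsplit : ∫ r in s..t, (D.lam r φ (α r) * v₀ - D.ell r φ (α r)) =
      I * v₀ - ∫ r in s..t, D.ell r φ (α r) := by
    rw [intervalIntegral.integral_sub (hil.mul_const _) hie, intervalIntegral.integral_mul_const]
  rw [hsplit]
  set V := D.value ⟨t, φ⟩
  set J := ∫ r in s..t, D.ell r φ (α r)
  set Jχ := ∫ r in s..t, D.discount s α φ r * D.ell r φ (α r)
  have e1 : (1 - D.discount s α φ t) * V - Jχ - (I * v₀ - J) =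
      (1 - D.discount s α φ t - I) * V + I * (V - v₀) + (J - Jχ) := by ring
  rw [e1]
  have b1 : |(1 - D.discount s α φ t - I) * V| ≤ (Clam * τ) ^ 2 * (|v₀| + η₁) := by
    rw [abs_mul]
    exact mul_le_mul hχ hvt' (abs_nonneg _) (by positivity)
  have b2 : |I * (V - v₀)| ≤ Clam * τ * η₁ := by
    rw [abs_mul, abs_of_nonneg hI0]
    exact mul_le_mul hI1 hvt (abs_nonneg _) (by positivity)
  have b3 : Clam * η₁ ≤ η / 2 := by
    rw [hη₁, mul_div_assoc', div_le_div_iff₀ (by positivity) two_pos]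
    nlinarith
  have b4 : c * τ ≤ η / 2 := by linarith
  calc _ ≤ (Clam * τ) ^ 2 * (|v₀| + η₁) + Clam * τ * η₁ + Clam * τ * R * τ :=
        (abs_add_le _ _).trans (add_le_add ((abs_add_le _ _).trans (add_le_add b1 b2)) hrun)
    _ = (c * τ + Clam * η₁) * τ := by rw [hc]; ring
    _ ≤ η * τ := by gcongr; linarith

end ControlData

/-! ### The two viscosity properties -/

theorem LowerSemicontinuousOn.upperSemicontinuousOn_neg {X : Type*} [TopologicalSpace X] {f : X → ℝ}
    {S : Set X} (hf : LowerSemicontinuousOn f S) : UpperSemicontinuousOn (fun x => -f x) S := by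
  intro x hx c hc
  filter_upwards [hf x hx (-c) (by simp only at hc; linarith)] with y hy
  linarith

section

variable {T : ℝ} {d : ℕ}

theorem TimePath₂.lipschitzWith_left :
    LipschitzWith 1 fun P : TimePath₂ T d => (⟨P.time, P.left⟩ : TimePath T d) :=
  LipschitzWith.of_dist_le_mul fun P Q => by
    rw [NNReal.coe_one, one_mul]
    exact le_add_of_nonneg_right (CadlagPath.stopDist_nonneg _ _ _ _)

theorem TimePath₂.lipschitzWith_right :
    LipschitzWith 1 fun P : TimePath₂ T d => (⟨P.time, P.right⟩ : TimePath T d) :=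
  LipschitzWith.of_dist_le_mul fun P Q => by
    rw [NNReal.coe_one, one_mul]
    change |P.time - Q.time| + CadlagPath.stopDist P.time P.right Q.time Q.right ≤
      |P.time - Q.time| + CadlagPath.stopDist P.time P.left Q.time Q.left
        + CadlagPath.stopDist P.time P.right Q.time Q.right
    linarith [CadlagPath.stopDist_nonneg P.time P.left Q.time Q.left]

/-- A difference of an upper and a lower semicontinuous function of the two paths. -/
theorem upperSemicontinuousOn_doubled {u v : TimePath T d → ℝ}
    (hu : UpperSemicontinuousOn u {p | p.time ∈ Icc 0 T})
    (hv : LowerSemicontinuousOn v {p | p.time ∈ Icc 0 T}) :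
    UpperSemicontinuousOn (fun P : TimePath₂ T d => u ⟨P.time, P.left⟩ - v ⟨P.time, P.right⟩)
      {P | P.time ∈ Icc 0 T} := by
  have h1 := hu.comp (t := {P : TimePath₂ T d | P.time ∈ Icc 0 T})
    TimePath₂.lipschitzWith_left.continuous.continuousOn fun P hP => hP
  have h2 := hv.upperSemicontinuousOn_neg.comp (t := {P : TimePath₂ T d | P.time ∈ Icc 0 T})
    TimePath₂.lipschitzWith_right.continuous.continuousOn fun P hP => hP
  simpa only [sub_eq_add_neg, Function.comp_def] using h1.add h2

/-- A Lipschitz continuation stays close to the path stopped at the initial time. -/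
theorem supDiff_stopAdd_zero_le {R s r : ℝ} (hT : 0 ≤ T) (hR : 0 ≤ R) {x x₀ : CadlagPath T d}
    (hs : 0 ≤ s) (hx : x ∈ lipPaths R s x₀) (hr : r ∈ Icc s T) :
    x.supDiff (x₀.stopAdd hT s 0) r ≤ R * (r - s) := by
  refine CadlagPath.supDiff_le (mul_nonneg hR (sub_nonneg.2 hr.1)) fun q hq => ?_
  have h1 : x₀.stopAdd hT s 0 q = x₀ (min q s) := by
    simp only [CadlagPath.stopAdd]
    rw [IccExtend_of_mem hT _ ⟨hq.1, hq.2.trans hr.2⟩, ContinuousMap.zero_apply, add_zero]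
  rw [h1]
  rcases le_total q s with h | h
  · rw [min_eq_left h, hx.1 ⟨hq.1, h⟩, sub_self, norm_zero]
    exact mul_nonneg hR (sub_nonneg.2 hr.1)
  · rw [min_eq_right h, ← hx.1 ⟨hs, le_rfl⟩]
    refine (hx.2 q ⟨h, hq.2.trans hr.2⟩ s ⟨le_rfl, hr.1.trans hr.2⟩).trans ?_
    rw [abs_of_nonneg (sub_nonneg.2 h)]
    gcongr
    exact hq.2

/-- The second component of an element of `𝒴` starts at `y₀`, continuously. -/
theorem exists_abs_sub_le_of_mem_pathsY {H : ℝ → CadlagPath T d → ℝ → State d → ℝ} {L s y₀ ζ : ℝ}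
    {x₀ : CadlagPath T d} {z : State d} {p : CadlagPath T d × (ℝ → ℝ)}
    (hs : s ≤ T) (hp : p ∈ pathsY H L s x₀ y₀ z) (hζ : 0 < ζ) :
    ∃ δ > 0, ∀ r ∈ Icc s T, r < s + δ → |p.2 r - y₀| ≤ ζ := by
  have h0 : p.2 s = y₀ := by simpa using hp.2.2.2 s ⟨le_rfl, hs⟩
  obtain ⟨δ, hδ, h⟩ := Metric.continuousWithinAt_iff.1 (hp.2.1 s ⟨le_rfl, hs⟩) ζ hζ
  refine ⟨δ, hδ, fun r hr hrδ => ?_⟩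
  have := h hr (by rw [Real.dist_eq, abs_of_nonneg (sub_nonneg.2 hr.1)]; linarith)
  rw [h0, Real.dist_eq] at this
  exact this.le

end

namespace ControlData

variable {T : ℝ} {d : ℕ} {A : Type*} [TopologicalSpace A] [MeasurableSpace A] [BorelSpace A]
  [Nonempty A] {D : ControlData T d A} {Cf Clam Lf M K s : ℝ} {x₀ y₀ : CadlagPath T d}

/-- Along the characteristic of a minimax subsolution in direction `p` and a nearly optimal
trajectory of the control problem, the difference does not decrease faster than the doubled
equation allows. -/
theorem Admissible.exists_increment_of_isMinimaxSub (hD : D.Admissible Cf Clam Lf)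
    (hA : IsSigmaCompactMetrizable A) (hM : IsPathLipConst D.hamiltonian M)
    (hK : IsGradLipConst D.hamiltonian K) {u : TimePath T d → ℝ}
    (hu : IsMinimaxSub D.hamiltonian D.h Cf u) (hs : s ∈ Ico 0 T)
    (hw : 0 < u ⟨s, x₀⟩ - D.value ⟨s, y₀⟩) (p q : State d) {η : ℝ} (hη : 0 < η) :
    ∃ δ > 0, ∀ t ∈ Ioc s T, t < s + δ → ∃ x ∈ pathsX Cf s x₀, ∃ y ∈ pathsX Cf s y₀,
      (∫ r in s..t, (inner ℝ (deriv x r) p + inner ℝ (deriv y r) q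
        - doubledTerm M K (u ⟨s, x₀⟩) p q ⟨r, x, y⟩)) - η * (t - s)
        ≤ (u ⟨t, x⟩ - D.value ⟨t, y⟩) - (u ⟨s, x₀⟩ - D.value ⟨s, y₀⟩) := by
  have hs0 : s ∈ Icc 0 T := Ico_subset_Icc_self hs
  have hClam := hD.Clam_nonneg
  set u₀ := u ⟨s, x₀⟩ with hu₀
  set v₀ := D.value ⟨s, y₀⟩ with hv₀
  set ζ := η / (4 * (Clam + 1)) with hζ
  have hζ0 : 0 < ζ := by positivity
  have hζ1 : 2 * Clam * ζ ≤ η / 2 := by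
    rw [hζ, mul_div_assoc', div_le_div_iff₀ (by positivity) two_pos]
    nlinarith
  obtain ⟨⟨x, Y⟩, hY, huY⟩ := hu.2.2 s hs x₀ p u₀ le_rfl
  obtain ⟨δ₁, hδ₁, hYζ⟩ := exists_abs_sub_le_of_mem_pathsY hs.2.le hY hζ0
  obtain ⟨hx, -, hYint, hYeq⟩ := hY
  obtain ⟨δ₂, hδ₂, hval⟩ := hD.exists_abs_sub_integral_le hA hs0 y₀ (η := η / 4) (by positivity)
  refine ⟨min δ₁ δ₂, by positivity, fun t ht htδ => ?_⟩
  have hst := ht.1.le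
  have htT : t ∈ Icc s T := ⟨hst, ht.2⟩
  have ht0 : t ∈ Icc 0 T := ⟨hs.1.trans hst, ht.2⟩
  have htδ₁ : t < s + δ₁ := htδ.trans_le (by gcongr; exact min_le_left _ _)
  have htδ₂ : t < s + δ₂ := htδ.trans_le (by gcongr; exact min_le_right _ _)
  obtain ⟨α, y, hα, hy, hopt⟩ := exists_integral_add_value_lt hD hA hs0 y₀ (ε := η / 4 * (t - s))
    (mul_pos (by positivity) (sub_pos.2 ht.1))
  have hyX := hy.mem_pathsX hD hs.1
  refine ⟨x, hx, y, hyX, ?_⟩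
  have h1 := huY t htT
  rw [hYeq t htT] at h1
  have h2 := (abs_le.1 (hval α y hα hy t ht htδ₂)).2
  have h3 := hopt t htT
  have hYint' : IntervalIntegrable (fun r => inner ℝ (deriv x r) p - D.hamiltonian r x (Y r) p)
      volume s t := hYint.mono_set (by
    rw [uIcc_of_le hst, uIcc_of_le hs.2.le]; exact Icc_subset_Icc_right ht.2)
  have hℓint : IntervalIntegrable (fun r => D.lam r y (α r) * v₀ - D.ell r y (α r)) volume s t :=
    ((hD.intervalIntegrable_lam hA hα y hs0 ht0).mul_const _).sub
      (hD.intervalIntegrable_ell hA hα y hs0 ht0)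
  have h4 : ∫ r in s..t, (inner ℝ (deriv x r) p + inner ℝ (deriv y r) q
        - doubledTerm M K u₀ p q ⟨r, x, y⟩) ≤
      ∫ r in s..t, ((inner ℝ (deriv x r) p - D.hamiltonian r x (Y r) p)
        - (D.lam r y (α r) * v₀ - D.ell r y (α r)) + η / 2) := by
    refine intervalIntegral.integral_mono_ae_restrict hst
      (intervalIntegrable_inner_add_inner_sub_doubledTerm hD.Cf_nonneg hs0 hx hyX M K u₀ p q htT)
      ((hYint'.sub hℓint).add intervalIntegrable_const) ?_
    rw [Filter.EventuallyLE, ae_restrict_iff' measurableSet_Icc]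
    filter_upwards [hD.hamiltonian_le_hamiltonian_add hM hK, hD.bddBelow_preHamiltonian,
      hy.ae_deriv_eq, Measure.ae_ne volume s, Measure.ae_ne volume T] with r e1 e2 e3 hr1 hr2 hr
    have hr' : r ∈ Ioo s T :=
      ⟨lt_of_le_of_ne hr.1 (Ne.symm hr1), lt_of_le_of_ne (hr.2.trans ht.2) hr2⟩
    have hr0 : r ∈ Ioo 0 T := ⟨hs.1.trans_lt hr'.1, hr'.2⟩
    have hYr := (abs_le.1 (hYζ r ⟨hr.1, hr.2.trans ht.2⟩ (hr.2.trans_lt htδ₁))).1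
    simp only at hYr
    have f1 := e1 hr0 x y (Y r) v₀ u₀ ζ p q hζ0.le (by linarith) (by linarith)
    -- the infimum in the Hamiltonian is at most its value at the control
    have f2 : D.hamiltonian r y v₀ (-q) ≤ D.preHamiltonian r y v₀ (-q) (α r) :=
      ciInf_le (e2 hr0 y v₀ (-q)) (α r)
    rw [preHamiltonian, ← e3 hr', inner_neg_right] at f2
    linarith
  rw [intervalIntegral.integral_add (hYint'.sub hℓint) intervalIntegrable_const,
    intervalIntegral.integral_sub hYint' hℓint, intervalIntegral.integral_const, smul_eq_mul] at h4
  linarith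

/-- Along a trajectory whose control nearly attains the Hamiltonian at the initial data and the
characteristic of a minimax supersolution in direction `-q`, the difference does not decrease
faster than the doubled equation allows. -/
theorem Admissible.exists_increment_of_isMinimaxSuper (hD : D.Admissible Cf Clam Lf)
    (hA : IsSigmaCompactMetrizable A) (hM : IsPathLipConst D.hamiltonian M)
    (hK : IsGradLipConst D.hamiltonian K) {u : TimePath T d → ℝ}
    (hu : IsMinimaxSuper D.hamiltonian D.h Cf u) (hs : s ∈ Ico 0 T)
    (hw : 0 < D.value ⟨s, x₀⟩ - u ⟨s, y₀⟩) (p q : State d) {η : ℝ} (hη : 0 < η) :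
    ∃ δ > 0, ∀ t ∈ Ioc s T, t < s + δ → ∃ x ∈ pathsX Cf s x₀, ∃ y ∈ pathsX Cf s y₀,
      (∫ r in s..t, (inner ℝ (deriv x r) p + inner ℝ (deriv y r) q
        - doubledTerm M K (D.value ⟨s, x₀⟩) p q ⟨r, x, y⟩)) - η * (t - s)
        ≤ (D.value ⟨t, x⟩ - u ⟨t, y⟩) - (D.value ⟨s, x₀⟩ - u ⟨s, y₀⟩) := by
  have hs0 : s ∈ Icc 0 T := Ico_subset_Icc_self hs
  have hT : 0 ≤ T := hs0.1.trans hs0.2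
  have hClam := hD.Clam_nonneg
  set u₀ := u ⟨s, y₀⟩ with hu₀
  set v₀ := D.value ⟨s, x₀⟩ with hv₀
  set ζ := η / (4 * (Clam + 1)) with hζ
  have hζ0 : 0 < ζ := by positivity
  have hζ1 : 2 * Clam * ζ ≤ η / 2 := by
    rw [hζ, mul_div_assoc', div_le_div_iff₀ (by positivity) two_pos]
    nlinarith
  obtain ⟨⟨y, Y⟩, hY, huY⟩ := hu.2.2 s hs y₀ (-q) u₀ le_rfl
  obtain ⟨δ₁, hδ₁, hYζ⟩ := exists_abs_sub_le_of_mem_pathsY hs.2.le hY hζ0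
  obtain ⟨hyX, -, hYint, hYeq⟩ := hY
  obtain ⟨δ₂, hδ₂, hval⟩ := hD.exists_abs_sub_integral_le hA hs0 x₀ (η := η / 4) (by positivity)
  -- the control is chosen along the path frozen at time `s`, since its trajectory depends on it
  set xs := x₀.stopAdd hT s 0 with hxs
  obtain ⟨α, hα, hαH⟩ := hD.exists_preHamiltonian_lt hA hT xs v₀ p (ε := η / 8) (by positivity)
  obtain ⟨x, hx⟩ := exists_isTrajectory hD hA hα hs0 x₀
  have hxX := hx.mem_pathsX hD hs.1
  have hxl := pathsX_subset_lipPaths hD.Cf_nonneg hs0 hxX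
  set R := Cf * growthBound T Cf (x₀.supNorm s) with hR
  have hR0 : 0 ≤ R := mul_nonneg hD.Cf_nonneg (growthBound_pos (x₀.supNorm_nonneg s)).le
  set c := Lf * (1 + |v₀| + ‖p‖) with hc
  have hc0 : 0 ≤ c := mul_nonneg hD.Lf_nonneg (by positivity)
  refine ⟨min (min δ₁ δ₂) (η / (16 * (c * R + 1))), by positivity, fun t ht htδ => ?_⟩
  have hst := ht.1.le
  have htT : t ∈ Icc s T := ⟨hst, ht.2⟩
  have ht0 : t ∈ Icc 0 T := ⟨hs.1.trans hst, ht.2⟩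
  have htδ' : t - s < min (min δ₁ δ₂) (η / (16 * (c * R + 1))) := by linarith
  rw [lt_min_iff, lt_min_iff, lt_div_iff₀ (by positivity)] at htδ'
  obtain ⟨⟨htδ₁, htδ₂⟩, htδ₃⟩ := htδ'
  have hts : 0 < t - s := sub_pos.2 ht.1
  refine ⟨x, hxX, y, hyX, ?_⟩
  have h1 := huY t htT
  rw [hYeq t htT] at h1
  have h2 := (abs_le.1 (hval α x hα hx t ht (by linarith))).1
  have h3 := value_le_integral_add_value hD hA hs0 hα hx htT
  have hYint' : IntervalIntegrable
      (fun r => inner ℝ (deriv y r) (-q) - D.hamiltonian r y (Y r) (-q)) volume s t :=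
    hYint.mono_set (by
      rw [uIcc_of_le hst, uIcc_of_le hs.2.le]; exact Icc_subset_Icc_right ht.2)
  have hℓint : IntervalIntegrable (fun r => D.lam r x (α r) * v₀ - D.ell r x (α r)) volume s t :=
    ((hD.intervalIntegrable_lam hA hα x hs0 ht0).mul_const _).sub
      (hD.intervalIntegrable_ell hA hα x hs0 ht0)
  have h4 : ∫ r in s..t, (inner ℝ (deriv x r) p + inner ℝ (deriv y r) q
        - doubledTerm M K v₀ p q ⟨r, x, y⟩) ≤
      ∫ r in s..t, ((D.lam r x (α r) * v₀ - D.ell r x (α r))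
        - (inner ℝ (deriv y r) (-q) - D.hamiltonian r y (Y r) (-q)) + 3 / 4 * η) := by
    refine intervalIntegral.integral_mono_ae_restrict hst
      (intervalIntegrable_inner_add_inner_sub_doubledTerm hD.Cf_nonneg hs0 hxX hyX M K v₀ p q htT)
      ((hℓint.sub hYint').add intervalIntegrable_const) ?_
    rw [Filter.EventuallyLE, ae_restrict_iff' measurableSet_Icc]
    filter_upwards [hD.hamiltonian_le_hamiltonian_add hM hK, hD.preHamiltonian_le_add,
      hD.isPathLipConst, hαH, hx.ae_deriv_eq, Measure.ae_ne volume s, Measure.ae_ne volume T]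
      with r e1 e2 e3 e4 e5 hr1 hr2 hr
    have hr' : r ∈ Ioo s T :=
      ⟨lt_of_le_of_ne hr.1 (Ne.symm hr1), lt_of_le_of_ne (hr.2.trans ht.2) hr2⟩
    have hr0 : r ∈ Ioo 0 T := ⟨hs.1.trans_lt hr'.1, hr'.2⟩
    have hYr := (abs_le.1 (hYζ r ⟨hr.1, hr.2.trans ht.2⟩ (by linarith [hr.2]))).2
    simp only at hYr
    have f1 := e1 hr0 x y v₀ (Y r) v₀ ζ p q hζ0.le (by linarith) (by linarith)
    have f2 := e2 hr0 x xs v₀ p (α r)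
    have f3 := (abs_le.1 (e3 hr0 x xs v₀ p)).1
    have f4 := e4 hr0
    have f5 : c * x.supDiff xs r ≤ η / 16 := by
      have g1 := supDiff_stopAdd_zero_le hT hR0 hs.1 hxl ⟨hr.1, hr'.2.le⟩
      have g2 : R * (r - s) ≤ R * (t - s) := by gcongr; exact hr.2
      have g3 := mul_le_mul_of_nonneg_left (g1.trans g2) hc0
      have g4 : c * (R * (t - s)) = c * R * (t - s) := by ring
      linarith
    rw [preHamiltonian, ← e5 hr'] at f2
    rw [inner_neg_right]
    linarith
  rw [intervalIntegral.integral_add (hℓint.sub hYint') intervalIntegrable_const,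
    intervalIntegral.integral_sub hℓint hYint', intervalIntegral.integral_const, smul_eq_mul] at h4
  linarith

end ControlData

end

theorem lemmaL {T : ℝ} (hT : 0 < T) {d : ℕ} {A : Type*} [TopologicalSpace A] [MeasurableSpace A]
    [BorelSpace A] [Nonempty A]
    (hA : ∃ S : ℕ → Set A, (⋃ n, S n) = Set.univ ∧
      ∀ n, IsCompact (S n) ∧ TopologicalSpace.MetrizableSpace (S n))
    (D : ControlData T d A) {Cf Clam Lf : ℝ} (hD : D.Admissible Cf Clam Lf) :
    (IsPathLipConst D.hamiltonian Lf ∧ IsGradLipConst D.hamiltonian Cf) ∧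
    ∀ M K : ℝ, IsPathLipConst D.hamiltonian M → IsGradLipConst D.hamiltonian K →
      (∀ u : TimePath T d → ℝ, IsMinimaxSub D.hamiltonian D.h Cf u →
        IsViscositySubDoubled M K Cf u
          (fun p => u ⟨p.time, p.left⟩ - D.value ⟨p.time, p.right⟩)) ∧
      (∀ u : TimePath T d → ℝ, IsMinimaxSuper D.hamiltonian D.h Cf u →
        IsViscositySubDoubled M K Cf D.value
          (fun p => D.value ⟨p.time, p.left⟩ - u ⟨p.time, p.right⟩)) := by
  have hv := ControlData.continuousOn_value hD hA
  refine ⟨⟨hD.isPathLipConst, hD.isGradLipConst⟩, fun M K hM hK => ⟨fun u hu => ?_, fun u hu => ?_⟩⟩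
  · refine ⟨upperSemicontinuousOn_doubled hu.1 hv.lowerSemicontinuousOn, ?_⟩
    intro s hs x y φ φt φx φy hφ htouch hw
    have h := hφ.bracket_nonneg (M := M) (K := K) (Υ := u ⟨s, x⟩) hs hD.Cf_nonneg htouch rfl rfl
      fun η hη => hD.exists_increment_of_isMinimaxSub hA hM hK hu hs hw _ _ hη
    rw [add_assoc]
    exact h
  · refine ⟨upperSemicontinuousOn_doubled hv.upperSemicontinuousOn hu.1, ?_⟩
    intro s hs x y φ φt φx φy hφ htouch hw
    have h := hφ.bracket_nonneg (M := M) (K := K) (Υ := D.value ⟨s, x⟩) hs hD.Cf_nonneg htouch rfl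
      rfl fun η hη => hD.exists_increment_of_isMinimaxSuper hA hM hK hu hs hw _ _ hη
    rw [add_assoc]
    exact h
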